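/- Let $p$ be a prime, let $E$ be a finite extension of $\mathbb{Q}_p$ containing $\sqrt p$, with ring of integers $\mathcal{O}_E$, uniformizer $\pi$, and valuation $v_p$ normalized by $v_p(p)=1$ (with $|\cdot|=p^{-v_p(\cdot)}$), and let $\mathcal{L}\in E$. Let $k=r+2$ and $n$ be integers with $k/2<n\le r\le p-1$. **Notation.** Let $\log_{\mathcal{L}}:\mathbb{Q}_p^*\to E$ be the homomorphism with $\log_{\mathcal{L}}(p)=\mathcal{L}$, $\log_{\mathcal{L}}(\zeta)=0$ if $\zeta^{p-1}=1$, and $\log_{\mathcal{L}}(u)=\sum_{m\ge1}(-1)^{m-1}(u-1)^m/m$ for $u\in1+p\mathbb{Z}_p$; the functions $z\mapsto z^m\log_{\mathcal{L}}(z)$, $m\ge1$, are extended by $0$ at $z=0$. Put $H_m=\sum_{i=1}^m 1/i$, let $v_-$ (resp. $v_+$) be the largest (resp. smallest) integer with $v_-<r/2<v_+$, and assume $\mathcal{L}\ne H_{v_-}+H_{v_+}$; put $$\nu=v_p(\mathcal{L}-H_{v_-}-H_{v_+}).$$ *The space $B_{k,\mathcal{L}}$.* For real $s\ge0$, a function $f:\mathbb{Z}_p\to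 E$ is in $\mathscr{C}^s(\mathbb{Z}_p,E)$ if there are functions $f^{(j)}:\mathbb{Z}_p\to E$, $0\le j\le\lfloor s\rfloor$, such that $\varepsilon(x,y)=f(x+y)-\sum_{j\le\lfloor s\rfloor}f^{(j)}(x)y^j/j!$ satisfies $\inf_{x\in\mathbb{Z}_p,\,y\in p^h\mathbb{Z}_p}(v_p(\varepsilon(x,y))-sh)\to\infty$ as $h\to\infty$; its norm is the supremum of all $|f^{(j)}(x)/j!|$ and all $|\varepsilon(x,y)|/|y|^s$, $y\ne0$. Let $D(k)$ be the space of functions $g:\mathbb{Q}_p\to E$ such that $g_1=g|_{\mathbb{Z}_p}$ is in $\mathscr{C}^{r/2}(\mathbb{Z}_p,E)$ and $z\mapsto z^rg(1/z)$ on $\mathbb{Z}_p\setminus\{0\}$ extends to a function $g_2\in\mathscr{C}^{r/2}(\mathbb{Z}_p,E)$, with norm $\max(\|g_1\|,\|g_2\|)$. Let $L(k,\mathcal{L})\subset D(k)$ be the subspace generated by the polynomials of degree $\le r$ and the finite sums $\sum_i a_i(z-z_i)^{n_i}\log_{\mathcal{L}}(z-z_i)$ with $a_i\in E$, $z_i\in\mathbb{Q}_p$,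 $n_i\in\{\lfloor r/2\rfloor+1,\dots,r\}$ and $\deg\sum_i a_i(z-z_i)^{n_i}<r/2$. Then $B_{k,\mathcal{L}}$ is the quotient of $D(k)$ by the closure of $L(k,\mathcal{L})$. *The lattice $\Theta_{k,\mathcal{L}}$.* Let $G=\mathrm{GL}_2(\mathbb{Q}_p)$, let $Z$ be its center, $B$ its subgroup of upper triangular matrices, and $I\subset\mathrm{GL}_2(\mathbb{Z}_p)$ the Iwahori subgroup of matrices that are upper triangular mod $p$. Let $\mathrm{Sym}^{r}E^2$ be the space of homogeneous polynomials of degree $r$ in $X,Y$, with $\left(\begin{smallmatrix}a&b\\c&d\end{smallmatrix}\right)P=|ad-bc|^{r/2}P(aX+cY,bX+dY)$, and let $\mathrm{ind}_{IZ}^G\,\mathrm{Sym}^{r}\mathcal{O}_E^2$ be the module of functions $F$ from $G$ to the polynomials in $\mathrm{Sym}^rE^2$ with coefficients in $\mathcal{O}_E$ such that $F(hg)=hF(g)$ for $h\in IZ$ and $F$ is supported on finitely many cosets $IZg$. Then $\Theta_{k,\mathcal{L}}\subset B_{k,\mathcal{L}}$ is the closure of the image of $\mathrm{ind}_{IZ}^G\,\mathrm{Sym}^{r}\mathcal{O}_E^2$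 under the map sending $F$ to the class of $$z\longmapsto\sum_{g\in G/IZ}\bigl(g\,F(g^{-1})\bigr)(z,1)\;\mathbb{1}_{BIZ}\!\left(\left(\begin{smallmatrix}1&0\\z&1\end{smallmatrix}\right)g\right).$$ **Statement.** Suppose that $\nu\le 1+r/2-n$ and let $x\in\mathbb{Q}$ with $x+\nu=r/2-n$. Write $p^x$ for any fixed element of $E$ of valuation $x$, and $p^{x+m}=p^xp^m$ for integers $m$. Let $I_n=\{0,1,\dots,n,p\}$ and let $\lambda_i\in\mathbb{Z}_p$ ($i\in I_n$) be such that $\lambda_p=-1$ and $\sum_{i\in I_n}\lambda_i i^j=0$ for $0\le j\le n$. Then the functions $$g(z)=p^x\sum_{i\in I_n}\lambda_i(z-i)^n\log_{\mathcal{L}}(z-i)$$ and $$f(z)=p^{1+x}\sum_{a=1}^{p-1}a^{-1}z^n\,\mathbb{1}_{a+p\mathbb{Z}_p}(z)+\sum_{j=\lceil r/2\rceil}^{n-1}(-1)^{n-j+1}\binom nj\,p^{x+n-j}\,\mathcal{L}\,z^j\,\mathbb{1}_{p\mathbb{Z}_p}(z)$$ belong to $D(k)$, and their classes in $B_{k,\mathcal{L}}$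 satisfy $$g\equiv f\pmod{\pi\,\Theta_{k,\mathcal{L}}}.$$ -/

import Mathlib

noncomputable section

namespace Breuil

/-! ### Functions of class `C^s` on `ℤ_p` -/

section Cs

variable {p : ℕ} [Fact p.Prime] {E : Type*} [NormedField E] [NormedAlgebra ℚ_[p] E]

/-- The Taylor remainder
`ε(x, y) = f (x + y) - ∑_{j ≤ ⌊s⌋} f^{(j)}(x) y ^ j / j!`, where `F j` plays the role of `f^{(j)}`. -/
def taylorRem (s : ℝ) (f : ℤ_[p] → E) (F : ℕ → ℤ_[p] → E) (x y : ℤ_[p]) : E :=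
  f (x + y) - ∑ j ∈ Finset.range (⌊s⌋₊ + 1),
    F j x * (algebraMap ℚ_[p] E (y : ℚ_[p])) ^ j / (Nat.factorial j : E)

/-- `F` is a family of derivatives of `f` up to order `⌊s⌋` witnessing that `f` is of class `C^s`:
`inf_{x ∈ ℤ_p, y ∈ p^h ℤ_p} (v_p (ε(x, y)) - s h) → ∞` as `h → ∞`. -/
def IsTaylorFamily (s : ℝ) (f : ℤ_[p] → E) (F : ℕ → ℤ_[p] → E) : Prop :=
  ∀ c : ℝ, 0 < c → ∃ H : ℕ, ∀ h : ℕ, H ≤ h → ∀ x y : ℤ_[p],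
    ‖y‖ ≤ (p : ℝ) ^ (-(h : ℝ)) → ‖taylorRem s f F x y‖ ≤ c * (p : ℝ) ^ (-(s * h))

/-- `f : ℤ_p → E` is of class `C^s`. -/
def IsCs (s : ℝ) (f : ℤ_[p] → E) : Prop := ∃ F, IsTaylorFamily s f F

/-- The maximum of `|f^{(j)}(x) / j!|` (for `j ≤ ⌊s⌋` and `x ∈ ℤ_p`) and of
`|ε(x, y)| / |y| ^ s` (for `x, y ∈ ℤ_p`, `y ≠ 0`), where `F j` plays the role of `f^{(j)}`. -/
def taylorNorm (s : ℝ) (f : ℤ_[p] → E) (F : ℕ → ℤ_[p] → E) : ENNReal :=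
  (⨆ j ∈ Finset.range (⌊s⌋₊ + 1), ⨆ x : ℤ_[p], ‖F j x / (Nat.factorial j : E)‖ₑ) ⊔
    ⨆ x : ℤ_[p], ⨆ y : ℤ_[p], ⨆ _ : y ≠ 0, ‖taylorRem s f F x y‖ₑ / ‖y‖ₑ ^ s

/-- The norm of `C^s(ℤ_p, E)`; the family of derivatives `F` in the infimum is unique up to order
`⌊s⌋`, and the infimum is `⊤` if `f` is not of class `C^s`. -/
def csNorm (s : ℝ) (f : ℤ_[p] → E) : ENNReal :=
  ⨅ F : ℕ → ℤ_[p] → E, ⨅ _ : IsTaylorFamily s f F, taylorNorm s f F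

theorem taylorRem_add (s : ℝ) (f g : ℤ_[p] → E) (F G : ℕ → ℤ_[p] → E) (x y : ℤ_[p]) :
    taylorRem s (f + g) (F + G) x y = taylorRem s f F x y + taylorRem s g G x y := by
  simp only [taylorRem, Pi.add_apply, add_mul, add_div, Finset.sum_add_distrib]
  ring

theorem taylorRem_smul (s : ℝ) (c : E) (f : ℤ_[p] → E) (F : ℕ → ℤ_[p] → E) (x y : ℤ_[p]) :
    taylorRem s (c • f) (c • F) x y = c * taylorRem s f F x y := by
  simp only [taylorRem, Pi.smul_apply, smul_eq_mul, mul_sub, Finset.mul_sum]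
  congr 1
  refine Finset.sum_congr rfl fun j _ => ?_
  ring

theorem IsTaylorFamily.zero (s : ℝ) :
    IsTaylorFamily s (0 : ℤ_[p] → E) (0 : ℕ → ℤ_[p] → E) := by
  intro c hc
  refine ⟨0, fun h _ x y _ => ?_⟩
  have : taylorRem s (0 : ℤ_[p] → E) (0 : ℕ → ℤ_[p] → E) x y = 0 := by simp [taylorRem]
  rw [this, norm_zero]
  positivity

theorem IsTaylorFamily.add {s : ℝ} {f g : ℤ_[p] → E} {F G : ℕ → ℤ_[p] → E}
    (hF : IsTaylorFamily s f F) (hG : IsTaylorFamily s g G) :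
    IsTaylorFamily s (f + g) (F + G) := by
  intro c hc
  obtain ⟨H₁, h₁⟩ := hF (c / 2) (half_pos hc)
  obtain ⟨H₂, h₂⟩ := hG (c / 2) (half_pos hc)
  refine ⟨max H₁ H₂, fun h hh x y hy => ?_⟩
  rw [taylorRem_add]
  have a := h₁ h (le_trans (le_max_left _ _) hh) x y hy
  have b := h₂ h (le_trans (le_max_right _ _) hh) x y hy
  calc _ ≤ _ := norm_add_le _ _
    _ ≤ _ := add_le_add a b
    _ = _ := by ring

theorem IsTaylorFamily.smul {s : ℝ} {f : ℤ_[p] → E} {F : ℕ → ℤ_[p] → E} (a : E)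
    (hF : IsTaylorFamily s f F) : IsTaylorFamily s (a • f) (a • F) := by
  intro c hc
  have ha : 0 < ‖a‖ + 1 := by positivity
  obtain ⟨H, hH⟩ := hF (c / (‖a‖ + 1)) (div_pos hc ha)
  refine ⟨H, fun h hh x y hy => ?_⟩
  rw [taylorRem_smul, norm_mul]
  have b := hH h hh x y hy
  have hp : 0 ≤ (p : ℝ) ^ (-(s * h)) := by positivity
  calc _ ≤ (‖a‖ + 1) * (c / (‖a‖ + 1) * (p : ℝ) ^ (-(s * h))) := by
        gcongr
        linarith
    _ = _ := by field_simp

theorem taylorNorm_add_le (s : ℝ) (f g : ℤ_[p] → E) (F G : ℕ → ℤ_[p] → E) :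
    taylorNorm s (f + g) (F + G) ≤ taylorNorm s f F + taylorNorm s g G := by
  refine sup_le (iSup₂_le fun j hj => iSup_le fun x => ?_)
    (iSup_le fun x => iSup_le fun y => iSup_le fun hy => ?_)
  · rw [Pi.add_apply, Pi.add_apply, add_div]
    refine (enorm_add_le _ _).trans (add_le_add ?_ ?_) <;>
    exact le_sup_of_le_left (le_iSup₂_of_le j hj (le_iSup_of_le x le_rfl))
  · rw [taylorRem_add]
    refine (ENNReal.div_le_div_right (enorm_add_le _ _) _).trans ?_
    rw [ENNReal.add_div]
    refine add_le_add ?_ ?_ <;>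
    exact le_sup_of_le_right (le_iSup_of_le x (le_iSup_of_le y (le_iSup_of_le hy le_rfl)))

theorem taylorNorm_smul_le (s : ℝ) (c : E) (f : ℤ_[p] → E) (F : ℕ → ℤ_[p] → E) :
    taylorNorm s (c • f) (c • F) ≤ ‖c‖ₑ * taylorNorm s f F := by
  refine sup_le (iSup₂_le fun j hj => iSup_le fun x => ?_)
    (iSup_le fun x => iSup_le fun y => iSup_le fun hy => ?_)
  · rw [Pi.smul_apply, Pi.smul_apply, smul_eq_mul, mul_div_assoc, enorm_mul]
    gcongr
    exact le_sup_of_le_left (le_iSup₂_of_le j hj (le_iSup_of_le x le_rfl))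
  · rw [taylorRem_smul, enorm_mul, mul_div_assoc]
    gcongr
    exact le_sup_of_le_right (le_iSup_of_le x (le_iSup_of_le y (le_iSup_of_le hy le_rfl)))

theorem csNorm_zero (s : ℝ) : csNorm s (0 : ℤ_[p] → E) = 0 := by
  refine le_antisymm ?_ bot_le
  refine iInf₂_le_of_le 0 (IsTaylorFamily.zero s) ?_
  have : ∀ x y : ℤ_[p], taylorRem s (0 : ℤ_[p] → E) (0 : ℕ → ℤ_[p] → E) x y = 0 := by
    intro x y; simp [taylorRem]
  simp [taylorNorm, this]

theorem csNorm_add_le (s : ℝ) (f g : ℤ_[p] → E) :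
    csNorm s (f + g) ≤ csNorm s f + csNorm s g := by
  simp only [csNorm]
  refine ENNReal.le_iInf₂_add_iInf₂ fun F hF G hG => ?_
  exact iInf₂_le_of_le (F + G) (hF.add hG) (taylorNorm_add_le s f g F G)

theorem csNorm_smul_le (s : ℝ) (c : E) (f : ℤ_[p] → E) :
    csNorm s (c • f) ≤ ‖c‖ₑ * csNorm s f := by
  rcases eq_or_ne c 0 with rfl | hc
  · rw [zero_smul, csNorm_zero]; exact bot_le
  · have h0 : ‖c‖ₑ ≠ 0 := by simpa using hc
    simp only [csNorm]
    rw [ENNReal.mul_iInf_of_ne h0 enorm_ne_top]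
    refine le_iInf fun F => ?_
    rw [ENNReal.mul_iInf_of_ne h0 enorm_ne_top]
    refine le_iInf fun hF => ?_
    exact iInf₂_le_of_le (c • F) (hF.smul c) (taylorNorm_smul_le s c f F)

end Cs

/-! ### The space `D(k)`, with `k = r + 2` -/

section Dk

variable (p : ℕ) [Fact p.Prime] (E : Type*) [NormedField E] [NormedAlgebra ℚ_[p] E] (r : ℕ)

variable {p E} in
/-- `g₁`, the restriction of `g : ℚ_p → E` to `ℤ_p`. -/
def restr (g : ℚ_[p] → E) : ℤ_[p] → E := fun z => g (z : ℚ_[p])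

variable {p E} in
/-- `h : ℤ_p → E` extends the function `z ↦ z ^ r * g (1 / z)` on `ℤ_p \ {0}`. -/
def IsExtAtInfty (g : ℚ_[p] → E) (h : ℤ_[p] → E) : Prop :=
  ∀ z : ℤ_[p], z ≠ 0 → h z = algebraMap ℚ_[p] E (z : ℚ_[p]) ^ r * g ((z : ℚ_[p])⁻¹)

/-- `D(k)` as a space of functions: those `g : ℚ_p → E` such that `g₁` is of class `C^{r/2}` and
`z ↦ z ^ r * g (1 / z)` extends to a function `g₂` of class `C^{r/2}` on `ℤ_p`. -/
def DSub : Submodule E (ℚ_[p] → E) where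
  carrier := {g | IsCs ((r : ℝ) / 2) (restr g) ∧
    ∃ h : ℤ_[p] → E, IsExtAtInfty r g h ∧ IsCs ((r : ℝ) / 2) h}
  zero_mem' := ⟨⟨0, IsTaylorFamily.zero _⟩, 0, fun z _ => by simp, ⟨0, IsTaylorFamily.zero _⟩⟩
  add_mem' := by
    rintro f g ⟨⟨F, hF⟩, h, hh, H, hH⟩ ⟨⟨F', hF'⟩, h', hh', H', hH'⟩
    refine ⟨⟨F + F', hF.add hF'⟩, h + h', fun z hz => ?_, ⟨H + H', hH.add hH'⟩⟩
    rw [Pi.add_apply, hh z hz, hh' z hz, Pi.add_apply, mul_add]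
  smul_mem' := by
    rintro c f ⟨⟨F, hF⟩, h, hh, H, hH⟩
    refine ⟨⟨c • F, hF.smul c⟩, c • h, fun z hz => ?_, ⟨c • H, hH.smul c⟩⟩
    rw [Pi.smul_apply, hh z hz, Pi.smul_apply, smul_eq_mul, smul_eq_mul]
    ring

/-- `D(k)`. This is a copy of `DSub`, made so as not to inherit the topology of pointwise
convergence; it is given the topology of the norm `dNorm` instead. -/
def DSpace : Type _ := ↥(DSub p E r)

instance : AddCommGroup (DSpace p E r) := inferInstanceAs (AddCommGroup ↥(DSub p E r))

instance : Module E (DSpace p E r) := inferInstanceAs (Module E ↥(DSub p E r))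

variable {p E r} in
/-- The function `ℚ_p → E` underlying an element of `D(k)`. -/
def DSpace.toFun (g : DSpace p E r) : ℚ_[p] → E := Subtype.val g

variable {p E r} in
/-- The norm `max (‖g₁‖, ‖g₂‖)` of `D(k)`, where the extension `g₂` is unique by continuity. -/
def dNorm (g : DSpace p E r) : ENNReal :=
  csNorm ((r : ℝ) / 2) (restr g.toFun) ⊔
    ⨅ h : ℤ_[p] → E, ⨅ _ : IsExtAtInfty r g.toFun h, csNorm ((r : ℝ) / 2) h

variable {p E r}

theorem dNorm_zero : dNorm (0 : DSpace p E r) = 0 := by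
  refine le_antisymm (sup_le ?_ ?_) bot_le
  · exact (csNorm_zero (p := p) (E := E) ((r : ℝ) / 2)).le
  · refine iInf₂_le_of_le 0 (fun z _ => ?_) (csNorm_zero _).le
    have : (0 : DSpace p E r).toFun = 0 := rfl
    simp [this]

theorem dNorm_add_le (f g : DSpace p E r) : dNorm (f + g) ≤ dNorm f + dNorm g := by
  refine sup_le ?_ ?_
  · exact (csNorm_add_le _ (restr f.toFun) (restr g.toFun)).trans
      (add_le_add le_sup_left le_sup_left)
  · refine le_trans ?_ (add_le_add le_sup_right le_sup_right)
    refine ENNReal.le_iInf₂_add_iInf₂ fun h hh h' hh' => ?_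
    refine iInf₂_le_of_le (h + h') (fun z hz => ?_) (csNorm_add_le _ _ _)
    have : (f + g).toFun = f.toFun + g.toFun := rfl
    rw [Pi.add_apply, hh z hz, hh' z hz, this, Pi.add_apply, mul_add]

theorem dNorm_smul_le (c : E) (g : DSpace p E r) : dNorm (c • g) ≤ ‖c‖ₑ * dNorm g := by
  rcases eq_or_ne c 0 with rfl | hc
  · rw [zero_smul, dNorm_zero]; exact bot_le
  have h0 : ‖c‖ₑ ≠ 0 := by simpa using hc
  refine sup_le ?_ ?_
  · exact (csNorm_smul_le _ c (restr g.toFun)).trans (mul_le_mul_right le_sup_left _)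
  · refine le_trans ?_ (mul_le_mul_right le_sup_right _)
    rw [ENNReal.mul_iInf_of_ne h0 enorm_ne_top]
    refine le_iInf fun h => ?_
    rw [ENNReal.mul_iInf_of_ne h0 enorm_ne_top]
    refine le_iInf fun hh => ?_
    refine iInf₂_le_of_le (c • h) (fun z hz => ?_) (csNorm_smul_le _ c h)
    have : (c • g).toFun = c • g.toFun := rfl
    rw [Pi.smul_apply, hh z hz, this, Pi.smul_apply, smul_eq_mul, smul_eq_mul]
    ring

theorem dNorm_neg (g : DSpace p E r) : dNorm (-g) = dNorm g := by
  have key : ∀ f : DSpace p E r, dNorm (-f) ≤ dNorm f := fun f => by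
    have := dNorm_smul_le (-1 : E) f
    simpa using this
  refine le_antisymm (key g) ?_
  have := key (-g)
  rwa [neg_neg] at this

/-- The distance `‖f - g‖` on `D(k)`. -/
instance : PseudoEMetricSpace (DSpace p E r) where
  edist f g := dNorm (f - g)
  edist_self f := by rw [sub_self, dNorm_zero]
  edist_comm f g := by rw [← dNorm_neg, neg_sub]
  edist_triangle f g h := by
    have := dNorm_add_le (f - g) (g - h)
    rwa [sub_add_sub_cancel] at this

theorem edist_def (f g : DSpace p E r) : edist f g = dNorm (f - g) := rfl

instance : ContinuousAdd (DSpace p E r) where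
  continuous_add := by
    have : LipschitzWith 2 (fun q : DSpace p E r × DSpace p E r => q.1 + q.2) := by
      intro q q'
      have h : q.1 + q.2 - (q'.1 + q'.2) = (q.1 - q'.1) + (q.2 - q'.2) := by abel
      rw [edist_def, h]
      refine (dNorm_add_le _ _).trans ?_
      rw [ENNReal.coe_ofNat, two_mul]
      exact add_le_add (le_max_left _ _) (le_max_right _ _)
    exact this.continuous

instance : ContinuousNeg (DSpace p E r) where
  continuous_neg := by
    have : LipschitzWith 1 (fun q : DSpace p E r => -q) := by
      intro q q'
      have h : -q - -q' = -(q - q') := by abel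
      rw [edist_def, h, dNorm_neg, ENNReal.coe_one, one_mul, edist_def]
    exact this.continuous

instance : IsTopologicalAddGroup (DSpace p E r) where

instance : ContinuousConstSMul E (DSpace p E r) where
  continuous_const_smul c := by
    have : LipschitzWith ‖c‖₊ (fun q : DSpace p E r => c • q) := by
      intro q q'
      rw [edist_def, ← smul_sub]
      exact dNorm_smul_le c _
    exact this.continuous

end Dk

/-! ### The branch of the logarithm with `log p = 𝓛` -/

section Log

variable (p : ℕ) [Fact p.Prime]

/-- The principal unit `u` in the decomposition `z = p ^ v(z) * ζ * u` of `z ∈ ℚ_pˣ`, where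
`ζ ^ (p - 1) = 1` and `u ∈ 1 + p ℤ_p`. -/
def principalUnit (z : ℚ_[p]) : ℚ_[p] :=
  open Classical in
  if h : ∃ u : ℚ_[p], ‖u - 1‖ < 1 ∧
      ∃ ζ : ℚ_[p], ζ ^ (p - 1) = 1 ∧ z = (p : ℚ_[p]) ^ z.valuation * ζ * u
  then h.choose else 1

/-- The usual series `log u = ∑_{m ≥ 1} (-1) ^ (m - 1) (u - 1) ^ m / m`. -/
def logSeries (u : ℚ_[p]) : ℚ_[p] := ∑' m : ℕ, (-1) ^ m * (u - 1) ^ (m + 1) / ((m : ℚ_[p]) + 1)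

variable {E : Type*} [NormedField E] [NormedAlgebra ℚ_[p] E]

/-- `log_𝓛 z = v(z) 𝓛 + log u` for `z = p ^ v(z) * ζ * u ≠ 0`. (The value at `0` plays no role,
as `log_𝓛 z` only occurs multiplied by a positive power of `z`.) -/
def logL (L : E) (z : ℚ_[p]) : E :=
  (z.valuation : E) * L + algebraMap ℚ_[p] E (logSeries p (principalUnit p z))

end Log

/-! ### The Banach space `B_{k,𝓛}` -/

section Bk

variable (p : ℕ) [Fact p.Prime] (E : Type*) [NormedField E] [NormedAlgebra ℚ_[p] E] (r : ℕ)

/-- The elements of `D(k)` that are polynomial functions of degree at most `r`. -/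
def polySet : Set (DSpace p E r) :=
  {g | ∃ P : Polynomial E, P.natDegree ≤ r ∧
    ∀ z : ℚ_[p], g.toFun z = P.eval (algebraMap ℚ_[p] E z)}

/-- The elements of `D(k)` of the form `∑_i a_i (z - z_i) ^ {n_i} log_𝓛 (z - z_i)` (a finite sum)
with `⌊r/2⌋ + 1 ≤ n_i ≤ r` and `deg ∑_i a_i (z - z_i) ^ {n_i} < r / 2`. -/
def polyLogSet (L : E) : Set (DSpace p E r) :=
  {g | ∃ (m : ℕ) (a : Fin m → E) (c : Fin m → ℚ_[p]) (d : Fin m → ℕ),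
    (∀ i, r / 2 + 1 ≤ d i ∧ d i ≤ r) ∧
    (∀ l : ℕ, (r : ℝ) / 2 ≤ l →
      (∑ i, Polynomial.C (a i) *
        (Polynomial.X - Polynomial.C (algebraMap ℚ_[p] E (c i))) ^ d i).coeff l = 0) ∧
    ∀ z : ℚ_[p], g.toFun z =
      ∑ i, a i * algebraMap ℚ_[p] E (z - c i) ^ d i * logL p L (z - c i)}

/-- The subspace `L(k, 𝓛)` of `D(k)`. -/
def LSub (L : E) : Submodule E (DSpace p E r) :=
  Submodule.span E (polySet p E r ∪ polyLogSet p E r L)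

/-- `B_{k,𝓛}`, the quotient of `D(k)` by the closure of `L(k, 𝓛)`. -/
abbrev BSpace (L : E) : Type _ := DSpace p E r ⧸ (LSub p E r L).topologicalClosure

variable {p E r} in
/-- The class in `B_{k,𝓛}` of an element of `D(k)`. -/
def toB (L : E) (g : DSpace p E r) : BSpace p E r L := Submodule.Quotient.mk g

end Bk

/-! ### The lattice `Θ_{k,𝓛}` -/

section Lattice

variable (p : ℕ) [Fact p.Prime]

/-- `G = GL₂(ℚ_p)`. -/
abbrev G2 : Type := GL (Fin 2) ℚ_[p]

/-- The Iwahori subgroup `I` of matrices in `GL₂(ℤ_p)` that are upper triangular modulo `p`. -/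
def iwahori : Subgroup (G2 p) where
  carrier := {g | (∀ i j, ‖(g : Matrix (Fin 2) (Fin 2) ℚ_[p]) i j‖ ≤ 1) ∧
    ‖(g : Matrix (Fin 2) (Fin 2) ℚ_[p]).det‖ = 1 ∧
    ‖(g : Matrix (Fin 2) (Fin 2) ℚ_[p]) 1 0‖ < 1}
  one_mem' := by
    refine ⟨fun i j => ?_, by simp, by simp⟩
    fin_cases i <;> fin_cases j <;> simp
  mul_mem' := by
    rintro g h ⟨hg, hgd, hg0⟩ ⟨hh, hhd, hh0⟩
    refine ⟨fun i j => ?_, ?_, ?_⟩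
    · rw [Units.val_mul, Matrix.mul_apply, Fin.sum_univ_two]
      refine (Padic.nonarchimedean _ _).trans (max_le ?_ ?_) <;> rw [norm_mul] <;>
      exact mul_le_one₀ (hg _ _) (norm_nonneg _) (hh _ _)
    · rw [Units.val_mul, Matrix.det_mul, norm_mul, hgd, hhd, one_mul]
    · rw [Units.val_mul, Matrix.mul_apply, Fin.sum_univ_two]
      refine (Padic.nonarchimedean _ _).trans_lt (max_lt ?_ ?_) <;> rw [norm_mul]
      · exact mul_lt_one_of_nonneg_of_lt_one_left (norm_nonneg _) hg0 (hh _ _)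
      · exact mul_lt_one_of_nonneg_of_lt_one_right (hg _ _) (norm_nonneg _) hh0
  inv_mem' := by
    rintro g ⟨hg, hgd, hg0⟩
    have hinv : ((g⁻¹ : G2 p) : Matrix (Fin 2) (Fin 2) ℚ_[p]) =
        ((g : Matrix (Fin 2) (Fin 2) ℚ_[p]).det)⁻¹ •
          (g : Matrix (Fin 2) (Fin 2) ℚ_[p]).adjugate := by
      rw [Matrix.coe_units_inv, Matrix.inv_def, Ring.inverse_eq_inv']
    refine ⟨fun i j => ?_, ?_, ?_⟩
    · rw [hinv, Matrix.smul_apply, smul_eq_mul, norm_mul, norm_inv, hgd, inv_one, one_mul,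
        Matrix.adjugate_fin_two]
      fin_cases i <;> fin_cases j <;> simp [hg]
    · rw [Matrix.coe_units_inv, Matrix.det_nonsing_inv, Ring.inverse_eq_inv', norm_inv, hgd,
        inv_one]
    · rw [hinv, Matrix.smul_apply, smul_eq_mul, norm_mul, norm_inv, hgd, inv_one, one_mul,
        Matrix.adjugate_fin_two]
      simpa using hg0

/-- The subgroup `IZ` of `G`, where `Z` is the center of `G`. -/
def IZ : Subgroup (G2 p) := iwahori p ⊔ Subgroup.center (G2 p)

/-- The matrix with rows `(1, 0)` and `(z, 1)`. -/
def lowerUni (z : ℚ_[p]) : G2 p :=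
  Matrix.GeneralLinearGroup.mkOfDetNeZero !![1, 0; z, 1] (by simp)

variable {E : Type*} [NormedField E] [NormedAlgebra ℚ_[p] E]

/-- The function `f_id`, the indicator function of `B I Z`, where `B` is the subgroup of upper
triangular matrices. -/
def fId (g : G2 p) : E :=
  open Classical in
  if ∃ b h : G2 p, (b : Matrix (Fin 2) (Fin 2) ℚ_[p]) 1 0 = 0 ∧ h ∈ IZ p ∧ g = b * h
  then 1 else 0

/-- The action of `G` on `Sym^r E² = ⊕ E X^i Y^{r-i}`, with `X = X 0` and `Y = X 1`, twisted by
`|det| ^ {r/2}`: the matrix with rows `(a, b)` and `(c, d)` sends `P` to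
`|ad - bc| ^ {r/2} P(a X + c Y, b X + d Y)`. Here `|t| ^ {r/2} = (√p) ^ {-r v(t)}`. -/
def symAct (sqrtp : E) (r : ℕ) (g : G2 p) (P : MvPolynomial (Fin 2) E) :
    MvPolynomial (Fin 2) E :=
  let e : Fin 2 → Fin 2 → E :=
    fun i j => algebraMap ℚ_[p] E ((g : Matrix (Fin 2) (Fin 2) ℚ_[p]) i j)
  MvPolynomial.C
      (sqrtp ^ (-((r : ℤ) * (g : Matrix (Fin 2) (Fin 2) ℚ_[p]).det.valuation))) *
    MvPolynomial.bind₁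
      ![MvPolynomial.C (e 0 0) * MvPolynomial.X 0 + MvPolynomial.C (e 1 0) * MvPolynomial.X 1,
        MvPolynomial.C (e 0 1) * MvPolynomial.X 0 + MvPolynomial.C (e 1 1) * MvPolynomial.X 1] P

/-- The compact induction `ind_{IZ}^G Sym^r 𝒪_E²`: the functions `F` from `G` to the homogeneous
polynomials of degree `r` in `X, Y` with coefficients in `𝒪_E` such that `F (h g) = h · F g` for
`h ∈ IZ`, and which are supported on finitely many cosets `IZ s`. -/
def indLattice (sqrtp : E) (r : ℕ) : Set (G2 p → MvPolynomial (Fin 2) E) :=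
  {F | (∀ g, (F g).IsHomogeneous r ∧ ∀ m, ‖(F g).coeff m‖ ≤ 1) ∧
    (∀ h ∈ IZ p, ∀ g, F (h * g) = symAct p sqrtp r h (F g)) ∧
    ∃ S : Set (G2 p), S.Finite ∧ ∀ g, F g ≠ 0 → ∃ s ∈ S, ∃ h ∈ IZ p, g = h * s}

/-- The uniformization `ind_{IZ}^G Sym^r E² → D(k)`. It is the composition of
`⟦g, P⟧ ↦ g P ⊗ ⟦g, 1⟧`, of `P ⊗ ⟦g, 1⟧ ↦ P ⊗ g f_id`, where `(g f_id)(g') = f_id (g' g)`, and of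
`P ⊗ f ↦ (z ↦ P(z, 1) f (lowerUni z))`. As `F` is the sum over the cosets `g IZ` of the elementary
functions `⟦g, F(g⁻¹)⟧`, it sends `F` to the sum over the cosets `g IZ` (with any choice of
representatives `g`) of the functions `z ↦ (g · F(g⁻¹))(z, 1) f_id (lowerUni z * g)`. -/
def uniformize (sqrtp : E) (r : ℕ) (F : G2 p → MvPolynomial (Fin 2) E) (z : ℚ_[p]) : E :=
  ∑ᶠ q : G2 p ⧸ IZ p,
    MvPolynomial.eval ![algebraMap ℚ_[p] E z, 1] (symAct p sqrtp r q.out (F q.out⁻¹)) *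
      fId p (lowerUni p z * q.out)

/-- `Θ_{k,𝓛}`, the closure of the image of `ind_{IZ}^G Sym^r 𝒪_E²` in `B_{k,𝓛}`. -/
def latticeTheta (sqrtp : E) (r : ℕ) (L : E) : Set (BSpace p E r L) :=
  closure {b | ∃ F ∈ indLattice p sqrtp r, ∃ g : DSpace p E r,
    g.toFun = uniformize p sqrtp r F ∧ toB L g = b}

end Lattice

/-! ### Numerical invariants -/

/-- `v_p` on `E`, normalized by `v_p(p) = 1` (to be used on nonzero elements only). -/
def vp (p : ℕ) {E : Type*} [NormedField E] (c : E) : ℝ := -Real.logb p ‖c‖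

/-- `𝓛 - H_- - H_+`, where `H_m = ∑_{i=1}^m 1/i`, and `H_±` is `H_m` for `m` the smallest integer
with `r/2 < m`, respectively the largest integer with `m < r/2` (`r ≥ 1`). -/
def shiftedL {E : Type*} [NormedField E] (r : ℕ) (L : E) : E :=
  L - ((harmonic ((r - 1) / 2) : ℚ) : E) - ((harmonic (r / 2 + 1) : ℚ) : E)

/-- `π` is a uniformizer of `E`: a generator of the maximal ideal of its valuation ring. -/
def IsUniformizer {E : Type*} [NormedField E] (π : E) : Prop :=
  ‖π‖ < 1 ∧ ∀ c : E, ‖c‖ < 1 → ‖c‖ ≤ ‖π‖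

/-- The indicator function of `a + p ℤ_p`. -/
def indBall (p : ℕ) [Fact p.Prime] (E : Type*) [NormedField E] (a z : ℚ_[p]) : E :=
  open Classical in if ‖z - a‖ < 1 then 1 else 0

end Breuil

end

noncomputable section

namespace Breuil

/-! Everything is cut into monomials on balls, for which membership in the lattice is an inequality
on the coefficient. The uniformization sends a monomial in X, Y placed at a suitable matrix to a
monomial on a ball, so c (z-α)^j on α+p^h ℤ_p with j ≤ r lies over Θ once v(c) ≥ (h-1)(r/2-j)
(`smul_ballMono_mem_latZero`). Polynomials of degree at most r die in B_{k,𝓛}, so a ball may be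
traded for its complement, which gives the condition v(c) ≥ h(r/2-j), weaker when j > r/2
(`smul_ballMono_mem_latZero'`). For j > r the same condition suffices, by subdividing the ball
repeatedly and using that Θ is closed (`IsCsLattice.smul_ballMono_mem`). A strict inequality gives π
Θ (`IsSmall.smul_mem`).

Of x and 𝓛 only two bounds matter: |p^x| ≤ p and |p^x 𝓛| ≤ p^{n-r/2}. The first comes from the bound
on ν. For the second, ν < 0 and the harmonic numbers involved are p-integral, so |𝓛| ≤ p^{-ν}. The
relations on λ give λ_i ≡ 0 mod p for 1 ≤ i ≤ n and λ_0 ≡ 1 mod p, by testing on products of linear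
factors (`exists_eval_relation`).

The function g is then split into four parts. Let lg denote the logarithm with lg p = 0. (1) Near i,
the terms (z-i)^n lg(z-i) are negligible (`singLog_mem`). (2) Near i, the terms 𝓛 v(z-i)(z-i)^n are
sums of (z-i)^n over the nested balls around i. Only the largest ball counts, and only for i = 0 and
i = p. There z^n-(z-p)^n expands into the second sum of f (`sum_singVal_sub_mem`). (3) On a+pℤ_p,
the terms with i not congruent to a have a Taylor expansion whose low coefficients are small, by the
relations on λ, except for the contribution of lg a - lg(a-p) ≡ p/a mod p². This is the first sum of
f (`norm_regCoeff_le_inv_pow`, `regLog_sub_mem`). (4) At infinity the relations on λ cancel the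
first n+1 terms of the expansion in 1/z. What remains has degree larger than r in the coordinate 1/z
and is negligible (`tsum_inftyCoeff_mem`). -/

open Finset Filter Topology

/-! ### Functions of class C^s with explicit ultrametric norm bounds, and their convergent sums. -/

section CsBound

variable {p : ℕ} [Fact p.Prime] {E : Type*} [NormedField E] [NormedAlgebra ℚ_[p] E]

variable (p E) in
/-- The embedding of `ℤ_p` into `E`. -/
def emb : ℤ_[p] →+* E := (algebraMap ℚ_[p] E).comp PadicInt.Coe.ringHom

theorem emb_apply (z : ℤ_[p]) : emb p E z = algebraMap ℚ_[p] E (z : ℚ_[p]) := rfl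

@[simp]
theorem norm_emb (z : ℤ_[p]) : ‖emb p E z‖ = ‖z‖ := by
  rw [emb_apply, norm_algebraMap', PadicInt.norm_def]

theorem one_lt_prime : (1 : ℝ) < p := by exact_mod_cast (Fact.out : p.Prime).one_lt

theorem prime_pos : (0 : ℝ) < p := by exact_mod_cast (Fact.out : p.Prime).pos

theorem norm_sub_le_max' {S : Type*} [SeminormedAddCommGroup S] [IsUltrametricDist S] (a b : S) :
    ‖a - b‖ ≤ max ‖a‖ ‖b‖ := by
  simpa [sub_eq_add_neg] using IsUltrametricDist.norm_add_le_max a (-b)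

/-- The Taylor remainder for a family `A` of divided derivatives `f^{(j)} / j!`. -/
def hasseRem (s : ℝ) (f : ℤ_[p] → E) (A : ℕ → ℤ_[p] → E) (x y : ℤ_[p]) : E :=
  f (x + y) - ∑ j ∈ range (⌊s⌋₊ + 1), A j x * emb p E y ^ j

/-- `f` is of class `C^s` with norm at most `C`. -/
def CsBound (s : ℝ) (f : ℤ_[p] → E) (C : ℝ) : Prop :=
  ∃ A : ℕ → ℤ_[p] → E, (∀ j ≤ ⌊s⌋₊, ∀ x, ‖A j x‖ ≤ C) ∧
    (∀ x y, ‖hasseRem s f A x y‖ ≤ C * ‖y‖ ^ s) ∧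
    ∀ c : ℝ, 0 < c → ∃ H : ℕ, ∀ x y : ℤ_[p], ‖y‖ ≤ (p : ℝ) ^ (-(H : ℝ)) →
      ‖hasseRem s f A x y‖ ≤ c * ‖y‖ ^ s

theorem CsBound.nonneg {s : ℝ} {f : ℤ_[p] → E} {C : ℝ} (h : CsBound s f C) : 0 ≤ C := by
  obtain ⟨A, h, -⟩ := h
  exact (norm_nonneg _).trans (h 0 (Nat.zero_le _) 0)

theorem CsBound.mono {s : ℝ} {f : ℤ_[p] → E} {C D : ℝ} (h : CsBound s f C) (hCD : C ≤ D) :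
    CsBound s f D := by
  obtain ⟨A, h₁, h₂, h₃⟩ := h
  exact ⟨A, fun j hj x => (h₁ j hj x).trans hCD, fun x y => (h₂ x y).trans (by gcongr), h₃⟩

theorem hasseRem_eq_taylorRem (s : ℝ) (f : ℤ_[p] → E) (A : ℕ → ℤ_[p] → E) (x y : ℤ_[p]) :
    taylorRem s f (fun j x => (Nat.factorial j : E) * A j x) x y = hasseRem s f A x y := by
  have : CharZero E := charZero_of_injective_algebraMap (algebraMap ℚ_[p] E).injective
  rw [taylorRem, hasseRem]
  congr 1
  refine sum_congr rfl fun j _ => ?_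
  have : (Nat.factorial j : E) ≠ 0 := by exact_mod_cast Nat.factorial_ne_zero j
  rw [emb_apply]
  field_simp

/-- This passes from bounds in ‖y‖^s and divided derivatives to the definitions used in the
statement: ‖y‖^s ≤ p^{-sh} on p^h ℤ_p, and multiplying by j! is reversible in characteristic zero.
-/
theorem CsBound.exists_isTaylorFamily {s : ℝ} (hs : 0 ≤ s) {f : ℤ_[p] → E} {C : ℝ}
    (h : CsBound s f C) :
    ∃ F, IsTaylorFamily s f F ∧ taylorNorm s f F ≤ ENNReal.ofReal C := by
  have : CharZero E := charZero_of_injective_algebraMap (algebraMap ℚ_[p] E).injective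
  obtain ⟨A, h₁, h₂, h₃⟩ := h
  refine ⟨fun j x => (Nat.factorial j : E) * A j x, fun c hc => ?_, ?_⟩
  · obtain ⟨H, hH⟩ := h₃ c hc
    refine ⟨H, fun h hh x y hy => ?_⟩
    rw [hasseRem_eq_taylorRem]
    have h1 : ‖y‖ ≤ (p : ℝ) ^ (-(H : ℝ)) := hy.trans
      (Real.rpow_le_rpow_of_exponent_le one_lt_prime.le (by simpa using hh))
    refine (hH x y h1).trans ?_
    gcongr
    calc ‖y‖ ^ s ≤ ((p : ℝ) ^ (-(h : ℝ))) ^ s := by gcongr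
      _ = _ := by rw [← Real.rpow_mul prime_pos.le]; ring_nf
  · refine sup_le (iSup₂_le fun j hj => iSup_le fun x => ?_)
      (iSup_le fun x => iSup_le fun y => iSup_le fun hy => ?_)
    · have : (Nat.factorial j : E) ≠ 0 := by exact_mod_cast Nat.factorial_ne_zero j
      rw [mul_div_cancel_left₀ _ this, ← ofReal_norm]
      exact ENNReal.ofReal_le_ofReal (h₁ j (by simpa [Nat.lt_succ_iff] using hj) x)
    · rw [hasseRem_eq_taylorRem]
      refine ENNReal.div_le_of_le_mul ?_
      have hy' : 0 < ‖y‖ := norm_pos_iff.mpr hy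
      rw [← ofReal_norm, ← ofReal_norm, ENNReal.ofReal_rpow_of_pos hy',
        ← ENNReal.ofReal_mul ((norm_nonneg _).trans (h₁ 0 (Nat.zero_le _) 0))]
      exact ENNReal.ofReal_le_ofReal (h₂ x y)

theorem CsBound.isCs {s : ℝ} (hs : 0 ≤ s) {f : ℤ_[p] → E} {C : ℝ} (h : CsBound s f C) :
    IsCs s f := by
  obtain ⟨F, hF, -⟩ := h.exists_isTaylorFamily hs
  exact ⟨F, hF⟩

theorem CsBound.csNorm_le {s : ℝ} (hs : 0 ≤ s) {f : ℤ_[p] → E} {C : ℝ} (h : CsBound s f C) :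
    csNorm s f ≤ ENNReal.ofReal C := by
  obtain ⟨F, hF, hC⟩ := h.exists_isTaylorFamily hs
  exact iInf₂_le_of_le F hF hC

theorem CsBound.zero (s : ℝ) {C : ℝ} (hC : 0 ≤ C) : CsBound s (0 : ℤ_[p] → E) C := by
  have h : ∀ x y : ℤ_[p], hasseRem s (0 : ℤ_[p] → E) 0 x y = 0 := by simp [hasseRem]
  refine ⟨0, fun j _ x => by simpa, fun x y => ?_, fun c hc => ⟨0, fun x y _ => ?_⟩⟩ <;>
  · rw [h, norm_zero]
    positivity

theorem CsBound.smul {s : ℝ} {f : ℤ_[p] → E} {C : ℝ} (h : CsBound s f C) (a : E) :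
    CsBound s (a • f) (‖a‖ * C) := by
  obtain ⟨A, h₁, h₂, h₃⟩ := h
  have key : ∀ x y, hasseRem s (a • f) (a • A) x y = a * hasseRem s f A x y := fun x y => by
    simp only [hasseRem, Pi.smul_apply, smul_eq_mul, mul_sub, mul_sum, mul_assoc]
  refine ⟨a • A, fun j hj x => ?_, fun x y => ?_, fun c hc => ?_⟩
  · rw [Pi.smul_apply, Pi.smul_apply, norm_smul]
    gcongr
    exact h₁ j hj x
  · rw [key, norm_mul, mul_assoc]
    gcongr
    exact h₂ x y
  · have ha : 0 < ‖a‖ + 1 := by positivity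
    obtain ⟨H, hH⟩ := h₃ (c / (‖a‖ + 1)) (div_pos hc ha)
    refine ⟨H, fun x y hy => ?_⟩
    rw [key, norm_mul]
    have h0 : 0 ≤ ‖y‖ ^ s := by positivity
    calc _ ≤ (‖a‖ + 1) * (c / (‖a‖ + 1) * ‖y‖ ^ s) := by
          gcongr
          · linarith
          · exact hH x y hy
      _ = _ := by field_simp

/-- At y = 0 the remainder vanishes because 0^s = 0, so f coincides with its zeroth coefficient. -/
theorem CsBound.norm_le {s : ℝ} {f : ℤ_[p] → E} {C : ℝ} (hs : 0 < s) (h : CsBound s f C)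
    (x : ℤ_[p]) : ‖f x‖ ≤ C := by
  obtain ⟨A, h₁, h₂, -⟩ := h
  have := h₂ x 0
  rw [norm_zero, Real.zero_rpow hs.ne', mul_zero, norm_le_zero_iff, hasseRem, add_zero,
    sum_range_succ', map_zero, sub_eq_zero] at this
  rw [this]
  simpa using h₁ 0 (Nat.zero_le _) x

variable [IsUltrametricDist E]

theorem CsBound.add {s : ℝ} {f g : ℤ_[p] → E} {C : ℝ} (hf : CsBound s f C)
    (hg : CsBound s g C) : CsBound s (f + g) C := by
  obtain ⟨A, h₁, h₂, h₃⟩ := hf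
  obtain ⟨B, k₁, k₂, k₃⟩ := hg
  have key : ∀ x y, hasseRem s (f + g) (A + B) x y = hasseRem s f A x y + hasseRem s g B x y :=
    fun x y => by
      simp only [hasseRem, Pi.add_apply, add_mul, sum_add_distrib]
      ring
  refine ⟨A + B, fun j hj x => ?_, fun x y => ?_, fun c hc => ?_⟩
  · exact (IsUltrametricDist.norm_add_le_max _ _).trans (max_le (h₁ j hj x) (k₁ j hj x))
  · rw [key]
    exact (IsUltrametricDist.norm_add_le_max _ _).trans (max_le (h₂ x y) (k₂ x y))
  · obtain ⟨H₁, hH₁⟩ := h₃ c hc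
    obtain ⟨H₂, hH₂⟩ := k₃ c hc
    refine ⟨max H₁ H₂, fun x y hy => ?_⟩
    rw [key]
    have h1 : ∀ H : ℕ, H ≤ max H₁ H₂ → ‖y‖ ≤ (p : ℝ) ^ (-(H : ℝ)) := fun H hH => hy.trans
      (Real.rpow_le_rpow_of_exponent_le one_lt_prime.le (neg_le_neg (by exact_mod_cast hH)))
    exact (IsUltrametricDist.norm_add_le_max _ _).trans
      (max_le (hH₁ x y (h1 _ (le_max_left _ _))) (hH₂ x y (h1 _ (le_max_right _ _))))

theorem CsBound.sum {s : ℝ} {ι : Type*} (t : Finset ι) {f : ι → ℤ_[p] → E} {C : ℝ} (hC : 0 ≤ C)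
    (hf : ∀ i ∈ t, CsBound s (f i) C) : CsBound s (∑ i ∈ t, f i) C :=
  sum_induction f (CsBound s · C) (fun _ _ => CsBound.add) (CsBound.zero s hC) hf

variable [CompleteSpace E]

theorem summable_of_norm_le {ι : Type*} {a : ι → E} {C : ι → ℝ} (h : ∀ i, ‖a i‖ ≤ C i)
    (hC : Tendsto C cofinite (𝓝 0)) : Summable a :=
  NonarchimedeanAddGroup.summable_of_tendsto_cofinite_zero (squeeze_zero_norm h hC)

theorem CsBound.summable {s : ℝ} (hs : 0 < s) {ι : Type*} {f : ι → ℤ_[p] → E} {C : ι → ℝ}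
    (hf : ∀ i, CsBound s (f i) (C i)) (hC : Tendsto C cofinite (𝓝 0)) (z : ℤ_[p]) :
    Summable fun i => f i z :=
  summable_of_norm_le (fun i => (hf i).norm_le hs z) hC

theorem CsBound.tsum {s : ℝ} (hs : 0 < s) {ι : Type*} {f : ι → ℤ_[p] → E} {C : ι → ℝ} {D : ℝ}
    (hf : ∀ i, CsBound s (f i) (C i)) (hC : Tendsto C cofinite (𝓝 0)) (hD : 0 ≤ D)
    (hCD : ∀ i, C i ≤ D) : CsBound s (fun z => ∑' i, f i z) D := by
  have hsum := CsBound.summable hs hf hC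
  choose A h₁ h₂ h₃ using hf
  have hsumA : ∀ j ≤ ⌊s⌋₊, ∀ x, Summable fun i => A i j x := fun j hj x =>
    summable_of_norm_le (fun i => h₁ i j hj x) hC
  have key : ∀ x y, hasseRem s (fun z => ∑' i, f i z) (fun j x => ∑' i, A i j x) x y =
      ∑' i, hasseRem s (f i) (A i) x y := fun x y => by
    have h0 : ∀ j ∈ range (⌊s⌋₊ + 1), Summable fun i => A i j x * emb p E y ^ j := fun j hj =>
      (hsumA j (by simpa [Nat.lt_succ_iff] using hj) x).mul_right _
    simp only [hasseRem]
    rw [(hsum _).tsum_sub (summable_sum h0), Summable.tsum_finsetSum h0]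
    simp only [tsum_mul_right]
  refine ⟨fun j x => ∑' i, A i j x, fun j hj x => ?_, fun x y => ?_, fun c hc => ?_⟩
  · exact IsUltrametricDist.norm_tsum_le_of_forall_le_of_nonneg hD
      fun i => (h₁ i j hj x).trans (hCD i)
  · rw [key]
    refine IsUltrametricDist.norm_tsum_le_of_forall_le_of_nonneg (by positivity)
      fun i => (h₂ i x y).trans ?_
    gcongr
    exact hCD i
  -- Outside a finite set of indices the global bound C i is already below c. The decay condition of
  -- a single term is needed only on that finite set.
  · have hfin : {i | ¬ C i < c}.Finite := by
      simpa [Filter.eventually_cofinite] using hC.eventually (gt_mem_nhds hc)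
    choose H hH using fun i => h₃ i c hc
    refine ⟨hfin.toFinset.sup H, fun x y hy => ?_⟩
    rw [key]
    refine IsUltrametricDist.norm_tsum_le_of_forall_le_of_nonneg (by positivity) fun i => ?_
    by_cases hi : C i < c
    · refine (h₂ i x y).trans ?_
      gcongr
    · refine hH i x y (hy.trans
        (Real.rpow_le_rpow_of_exponent_le one_lt_prime.le (neg_le_neg ?_)))
      exact_mod_cast le_sup (f := H) (hfin.mem_toFinset.mpr hi)

/-- A pointwise sum of functions whose norms tend to `0` is approximated by its partial sums. -/
theorem CsBound.exists_finset_tsum_sub {s : ℝ} (hs : 0 < s) {ι : Type*} {f : ι → ℤ_[p] → E}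
    {C : ι → ℝ} (hf : ∀ i, CsBound s (f i) (C i)) (hC : Tendsto C cofinite (𝓝 0)) {ε : ℝ}
    (hε : 0 < ε) : ∃ t : Finset ι, CsBound s ((fun z => ∑' i, f i z) - ∑ i ∈ t, f i) ε := by
  classical
  have hfin : {i | ¬ C i < ε}.Finite := by
    simpa [Filter.eventually_cofinite] using hC.eventually (gt_mem_nhds hε)
  refine ⟨hfin.toFinset, ?_⟩
  have hsum := CsBound.summable hs hf hC
  have h := CsBound.tsum (D := ε) (f := fun i => if i ∈ hfin.toFinset then 0 else f i)
    (C := fun i => if i ∈ hfin.toFinset then 0 else C i) hs (fun i => ?_) ?_ hε.le fun i => ?_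
  · convert h using 1
    ext z
    rw [Pi.sub_apply, Finset.sum_apply, sub_eq_iff_eq_add',
      ← (hsum z).sum_add_tsum_compl (s := hfin.toFinset),
      tsum_subtype (s := ((hfin.toFinset : Set ι))ᶜ) (f := fun i => f i z)]
    congr 1
    refine tsum_congr fun i => ?_
    rcases lt_or_ge (C i) ε with hi | hi
    · simp [Set.indicator, hi.not_ge]
    · simp [Set.indicator, hi]
  · by_cases hi : i ∈ hfin.toFinset
    · simp only [hi, if_true]
      exact CsBound.zero s le_rfl
    · simp only [hi, if_false]
      exact hf i
  · refine squeeze_zero (fun i => ?_) (fun i => ?_) hC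
    · split_ifs
      exacts [le_rfl, (hf i).nonneg]
    · split_ifs
      exacts [(hf i).nonneg, le_rfl]
  · split_ifs with hi
    · exact hε.le
    · simpa using le_of_lt (not_not.mp (fun h => hi (hfin.mem_toFinset.mpr h)))

end CsBound

/-! ### Norms of monomials on balls. -/

section BallMono

variable {p : ℕ} [Fact p.Prime] {E : Type*} [NormedField E] [NormedAlgebra ℚ_[p] E]

variable (E) in
/-- The function equal to `(z - α) ^ M` on `α + p ^ h ℤ_p` and to `0` elsewhere. -/
def ballMono (M : ℕ) (α : ℤ_[p]) (h : ℕ) (z : ℤ_[p]) : E :=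
  open Classical in if ‖z - α‖ ≤ (p : ℝ) ^ (-(h : ℝ)) then emb p E (z - α) ^ M else 0

/-- The exponent ⌊s⌋+1 exceeds s strictly, so a remainder of that order is o(‖y‖^s); the surplus is
the exponent `e`. -/
theorem exists_mul_norm_pow_le {s : ℝ} (hs : 0 < s) (K : ℝ) {c : ℝ} (hc : 0 < c) :
    ∃ H : ℕ, ∀ y : ℤ_[p], ‖y‖ ≤ (p : ℝ) ^ (-(H : ℝ)) →
      K * ‖y‖ ^ (⌊s⌋₊ + 1) ≤ c * ‖y‖ ^ s := by
  set e : ℝ := (⌊s⌋₊ : ℝ) + 1 - s with he_def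
  have he : 0 < e := sub_pos.mpr (Nat.lt_floor_add_one s)
  have hlt : (p : ℝ) ^ (-e) < 1 := Real.rpow_lt_one_of_one_lt_of_neg one_lt_prime (by linarith)
  have hK : 0 < c / (|K| + 1) := by positivity
  obtain ⟨H, hH⟩ := exists_pow_lt_of_lt_one hK hlt
  refine ⟨H, fun y hy => ?_⟩
  rcases eq_or_ne y 0 with rfl | hy0
  · rw [norm_zero, Real.zero_rpow hs.ne']
    simp
  have hy' : 0 < ‖y‖ := norm_pos_iff.mpr hy0
  have h1 : ‖y‖ ^ (⌊s⌋₊ + 1) = ‖y‖ ^ s * ‖y‖ ^ e := by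
    rw [← Real.rpow_add hy', ← Real.rpow_natCast]
    congr 1
    push_cast
    rw [he_def]
    ring
  have h2 : ‖y‖ ^ e ≤ c / (|K| + 1) := by
    calc ‖y‖ ^ e ≤ ((p : ℝ) ^ (-(H : ℝ))) ^ e := by gcongr
      _ = ((p : ℝ) ^ (-e)) ^ H := by
        rw [← Real.rpow_natCast, ← Real.rpow_mul prime_pos.le, ← Real.rpow_mul prime_pos.le]
        ring_nf
      _ ≤ _ := hH.le
  have h3 : K * ‖y‖ ^ e ≤ c :=
    calc K * ‖y‖ ^ e ≤ (|K| + 1) * (c / (|K| + 1)) := by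
          gcongr
          linarith [le_abs_self K]
      _ = c := by field_simp
  calc K * ‖y‖ ^ (⌊s⌋₊ + 1) = (K * ‖y‖ ^ e) * ‖y‖ ^ s := by rw [h1]; ring
    _ ≤ _ := by gcongr

theorem norm_pow_le_rpow {s t : ℝ} (hs : 0 < s) (ht0 : 0 ≤ t) (ht1 : t ≤ 1) :
    t ^ (⌊s⌋₊ + 1) ≤ t ^ s := by
  rcases ht0.eq_or_lt with rfl | ht
  · rw [Real.zero_rpow hs.ne']
    simp
  · rw [← Real.rpow_natCast]
    exact Real.rpow_le_rpow_of_exponent_ge ht ht1 (by push_cast; exact (Nat.lt_floor_add_one s).le)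

theorem pow_le_rpow_of_one_le {s t : ℝ} {j : ℕ} (hs : 0 < s) (hj : j ≤ ⌊s⌋₊) (ht : 1 ≤ t) :
    t ^ j ≤ t ^ s := by
  rw [← Real.rpow_natCast]
  exact Real.rpow_le_rpow_of_exponent_le ht ((Nat.le_floor_iff hs.le).mp hj)

theorem norm_emb_pow_le {ρ : ℝ} {z : ℤ_[p]} (hz : ‖z‖ ≤ ρ) (M : ℕ) : ‖emb p E z ^ M‖ ≤ ρ ^ M := by
  rw [norm_pow, norm_emb]
  gcongr

variable [IsUltrametricDist E]

theorem norm_natCast_le_one' (m : ℕ) : ‖(m : E)‖ ≤ 1 := IsUltrametricDist.norm_natCast_le_one E m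

/-- Measured in units of the radius ρ, the Taylor term of order j is at most ρ^M (‖y‖/ρ)^j. If ‖y‖ ≤
ρ, only orders above ⌊s⌋ remain in the remainder. If ‖y‖ > ρ, the value and the Taylor polynomial
are bounded separately, each by ρ^M (‖y‖/ρ)^s. -/
theorem CsBound.ballMono {s : ℝ} (hs : 0 < s) (M : ℕ) (α : ℤ_[p]) (h : ℕ) :
    CsBound s (ballMono E M α h) ((p : ℝ) ^ (h * (s - M))) := by
  classical
  set ρ : ℝ := (p : ℝ) ^ (-(h : ℝ)) with hρ_def
  have hρ : 0 < ρ := Real.rpow_pos_of_pos prime_pos _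
  have hρ1 : ρ ≤ 1 := Real.rpow_le_one_of_one_le_of_nonpos one_lt_prime.le (by simp)
  have hC : (p : ℝ) ^ (h * (s - M)) = ρ ^ M / ρ ^ s := by
    rw [hρ_def, ← Real.rpow_natCast, ← Real.rpow_mul prime_pos.le, ← Real.rpow_mul prime_pos.le,
      ← Real.rpow_sub prime_pos]
    ring_nf
  rw [hC]
  set N := ⌊s⌋₊
  let A : ℕ → ℤ_[p] → E := fun j x =>
    if ‖x - α‖ ≤ ρ then (M.choose j : E) * emb p E (x - α) ^ (M - j) else 0
  have hA : ∀ j x, ‖A j x‖ * ρ ^ j ≤ ρ ^ M := fun j x => by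
    by_cases hx : ‖x - α‖ ≤ ρ
    · simp only [A, hx, if_true, norm_mul]
      rcases le_or_gt j M with hj | hj
      · calc _ ≤ 1 * ρ ^ (M - j) * ρ ^ j := by
              gcongr
              · exact norm_natCast_le_one' _
              · exact norm_emb_pow_le hx _
          _ = ρ ^ M := by rw [one_mul, ← pow_add, Nat.sub_add_cancel hj]
      · rw [Nat.choose_eq_zero_of_lt hj]
        simp only [Nat.cast_zero, norm_zero, zero_mul]
        positivity
    · simp only [A, hx, if_false, norm_zero, zero_mul]
      positivity
  have hAy : ∀ j x (y : ℤ_[p]), ‖A j x * emb p E y ^ j‖ ≤ ρ ^ M * (‖y‖ / ρ) ^ j :=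
    fun j x y => by
      rw [norm_mul, norm_pow, norm_emb, div_pow]
      calc ‖A j x‖ * ‖y‖ ^ j = ‖A j x‖ * ρ ^ j * (‖y‖ ^ j / ρ ^ j) := by field_simp
        _ ≤ _ := by
          gcongr
          exact hA j x
  have hsmall : ∀ x y : ℤ_[p], ‖y‖ ≤ ρ →
      ‖hasseRem s (Breuil.ballMono E M α h) A x y‖ ≤ ρ ^ M * (‖y‖ / ρ) ^ (N + 1) := fun x y hy => by
    by_cases hx : ‖x - α‖ ≤ ρ
    · have hxy : ‖x + y - α‖ ≤ ρ := by
        rw [add_sub_right_comm]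
        exact (IsUltrametricDist.norm_add_le_max _ _).trans (max_le hx hy)
      have h1 : Breuil.ballMono E M α h (x + y) =
          ∑ j ∈ range (max (M + 1) (N + 1)), A j x * emb p E y ^ j := by
        rw [Breuil.ballMono, if_pos hxy, add_sub_right_comm, map_add, add_comm, add_pow]
        refine (sum_subset (range_mono (le_max_left _ _)) fun j _ hj => ?_).trans
          (sum_congr rfl fun j _ => ?_)
        · rw [Nat.choose_eq_zero_of_lt (by simpa using hj)]
          simp
        · simp only [A, hx, if_true]
          ring
      rw [hasseRem, h1, ← sum_Ico_eq_sub _ (le_max_right _ _)]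
      refine IsUltrametricDist.norm_sum_le_of_forall_le_of_nonneg (by positivity) fun j hj => ?_
      refine (hAy j x y).trans ?_
      gcongr ?_ * ?_
      exact pow_le_pow_of_le_one (by positivity) (div_le_one_of_le₀ hy hρ.le) (mem_Ico.mp hj).1
    · have hxy : ¬ ‖x + y - α‖ ≤ ρ := fun hxy => hx <| by
        have : x - α = (x + y - α) - y := by ring
        rw [this]
        exact (norm_sub_le_max' _ _).trans (max_le hxy hy)
      have : hasseRem s (Breuil.ballMono E M α h) A x y = 0 := by
        rw [hasseRem, Breuil.ballMono, if_neg hxy]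
        simp [A, hx]
      rw [this, norm_zero]
      positivity
  have hscale : ∀ y : ℤ_[p], ρ ^ M / ρ ^ s * ‖y‖ ^ s = ρ ^ M * (‖y‖ / ρ) ^ s := fun y => by
    rw [Real.div_rpow (norm_nonneg _) hρ.le]
    ring
  refine ⟨A, fun j hj x => ?_, fun x y => ?_, fun c hc => ?_⟩
  · rw [le_div_iff₀ (by positivity)]
    refine le_trans ?_ (hA j x)
    gcongr
    rw [← Real.rpow_natCast]
    exact Real.rpow_le_rpow_of_exponent_ge hρ hρ1 ((Nat.le_floor_iff hs.le).mp hj)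
  · rw [hscale]
    rcases le_or_gt ‖y‖ ρ with hy | hy
    · refine (hsmall x y hy).trans ?_
      gcongr ?_ * ?_
      exact norm_pow_le_rpow hs (by positivity) (div_le_one_of_le₀ hy hρ.le)
    · have ht : 1 ≤ ‖y‖ / ρ := (one_le_div hρ).mpr hy.le
      refine (norm_sub_le_max' _ _).trans (max_le ?_ ?_)
      · have h1 : ‖Breuil.ballMono E M α h (x + y)‖ ≤ ρ ^ M := by
          rw [Breuil.ballMono]
          split_ifs with hxy
          · exact norm_emb_pow_le hxy M
          · rw [norm_zero]; positivity
        exact h1.trans (le_mul_of_one_le_right (by positivity) (Real.one_le_rpow ht hs.le))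
      · refine IsUltrametricDist.norm_sum_le_of_forall_le_of_nonneg (by positivity) fun j hj => ?_
        refine (hAy j x y).trans ?_
        gcongr ?_ * ?_
        exact pow_le_rpow_of_one_le hs (Nat.lt_succ_iff.mp (mem_range.mp hj)) ht
  · obtain ⟨H, hH⟩ := exists_mul_norm_pow_le (p := p) hs (ρ ^ M / ρ ^ (N + 1)) hc
    refine ⟨max H h, fun x y hy => ?_⟩
    have h1 : ∀ k : ℕ, k ≤ max H h → ‖y‖ ≤ (p : ℝ) ^ (-(k : ℝ)) := fun k hk => hy.trans
      (Real.rpow_le_rpow_of_exponent_le one_lt_prime.le (neg_le_neg (by exact_mod_cast hk)))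
    refine (hsmall x y (h1 h (le_max_right _ _))).trans (le_trans (le_of_eq ?_)
      (hH y (h1 H (le_max_left _ _))))
    rw [div_pow]
    ring

end BallMono

/-! ### Change of chart z ↦ 1/z on the units. -/

section Inversion

variable {p : ℕ} [Fact p.Prime] {E : Type*} [NormedField E] [NormedAlgebra ℚ_[p] E]

/-- The function `w ↦ w ^ r * f (1 / w)` on the units, extended by `0`. -/
def unitInv (r : ℕ) (f : ℤ_[p] → E) (w : ℤ_[p]) : E :=
  open Classical in if ‖w‖ = 1 then emb p E w ^ r * f w.inv else 0

variable [IsUltrametricDist E]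

/-- With u = 1/w and u' = 1/(w+y) one has u'-u = -y u u'. Hence (w+y)^r (u'-u)^j = (-u y)^j
(w+y)^{r-j} is a polynomial in y for j ≤ r, and the Taylor expansion of f at u transports to one at
w with no loss in the constant. The condition s ≤ r guarantees j ≤ r for every order used. -/
theorem CsBound.unitInv {s : ℝ} (hs : 0 < s) {r : ℕ} (hr : s ≤ r) {f : ℤ_[p] → E} {C : ℝ}
    (hf : CsBound s f C) : CsBound s (unitInv r f) C := by
  classical
  have hC := hf.nonneg
  have hfC := hf.norm_le hs
  obtain ⟨A, h₁, h₂, h₃⟩ := hf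
  set N := ⌊s⌋₊ with hN
  have hNr : N ≤ r := Nat.floor_le_of_le hr
  have hinv : ∀ {w : ℤ_[p]}, ‖w‖ = 1 → ‖w.inv‖ = 1 := fun {w} hw => by
    have := congr_arg norm (PadicInt.mul_inv hw)
    rwa [norm_mul, hw, one_mul, norm_one] at this
  -- This is the coefficient of y^m in (w+y)^r (u'-u)^j.
  let b : ℤ_[p] → ℕ → ℕ → E := fun w j m =>
    if j ≤ m then (-1) ^ j * emb p E w.inv ^ j * ((r - j).choose (m - j) : E) * emb p E w ^ (r - m)
    else 0
  have hb : ∀ w, ‖w‖ = 1 → ∀ j m, ‖b w j m‖ ≤ 1 := fun w hw j m => by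
    simp only [b]
    split_ifs
    · simp only [norm_mul, norm_pow, norm_neg, norm_one, one_pow, one_mul, norm_emb, hinv hw, hw,
        mul_one]
      exact norm_natCast_le_one' _
    · simp
  let B : ℕ → ℤ_[p] → E := fun m w =>
    if ‖w‖ = 1 then ∑ j ∈ range (N + 1), A j w.inv * b w j m else 0
  have hB : ∀ m w, ‖B m w‖ ≤ C := fun m w => by
    simp only [B]
    split_ifs with hw
    · refine IsUltrametricDist.norm_sum_le_of_forall_le_of_nonneg hC fun j hj => ?_
      rw [norm_mul]
      exact (mul_le_of_le_one_right (norm_nonneg _) (hb w hw j m)).trans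
        (h₁ j (Nat.lt_succ_iff.mp (mem_range.mp hj)) _)
    · simpa using hC
  have hfi : ∀ w, ‖Breuil.unitInv r f w‖ ≤ C := fun w => by
    rw [Breuil.unitInv]
    split_ifs with hw
    · rw [norm_mul, norm_pow, norm_emb, hw, one_pow, one_mul]
      exact hfC _
    · simpa using hC
  have hmain : ∀ w y : ℤ_[p], ‖y‖ < 1 → ∃ u δ : ℤ_[p], ‖δ‖ = ‖y‖ ∧
      ‖hasseRem s (Breuil.unitInv r f) B w y‖ ≤
        max ‖hasseRem s f A u δ‖ (C * ‖y‖ ^ (N + 1)) := fun w y hy => by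
    by_cases hw : ‖w‖ = 1
    · have hw' : ‖w + y‖ = 1 := by
        rw [IsUltrametricDist.norm_add_eq_max_of_norm_ne_norm (by rw [hw]; exact hy.ne'), hw]
        exact max_eq_left hy.le
      set u := w.inv
      set u' := (w + y).inv
      have hu : w * u = 1 := PadicInt.mul_inv hw
      have hu' : (w + y) * u' = 1 := PadicInt.mul_inv hw'
      have hδ : u' - u = -(y * u * u') := by linear_combination (-u') * hu + u * hu'
      refine ⟨u, u' - u, ?_, ?_⟩
      · rw [hδ, norm_neg, norm_mul, norm_mul, hinv hw, hinv hw', mul_one, mul_one]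
      have hterm : ∀ j ∈ range (N + 1), emb p E (w + y) ^ r * emb p E (u' - u) ^ j =
          ∑ m ∈ range (r + 1), b w j m * emb p E y ^ m := fun j hj => by
        have hjr : j ≤ r := (Nat.lt_succ_iff.mp (mem_range.mp hj)).trans hNr
        have h1 : emb p E (w + y) ^ r * emb p E (u' - u) ^ j =
            (-1) ^ j * emb p E u ^ j * emb p E y ^ j * (emb p E y + emb p E w) ^ (r - j) := by
          have h2 : emb p E (w + y) ^ j * emb p E u' ^ j = 1 := by
            rw [← mul_pow, ← map_mul, hu', map_one, one_pow]
          have h3 : emb p E (w + y) ^ r = emb p E (w + y) ^ (r - j) * emb p E (w + y) ^ j := by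
            rw [← pow_add, Nat.sub_add_cancel hjr]
          rw [hδ, h3, map_neg, map_mul, map_mul, neg_eq_neg_one_mul, mul_pow, mul_pow, mul_pow,
            ← map_add, add_comm y w]
          linear_combination (emb p E (w + y) ^ (r - j) * (-1) ^ j * emb p E y ^ j *
            emb p E u ^ j) * h2
        rw [h1, add_pow, mul_sum, range_eq_Ico, range_eq_Ico]
        symm
        rw [← sum_Ico_consecutive _ (Nat.zero_le j) (by omega : j ≤ r + 1),
          sum_eq_zero (fun m hm => ?_), zero_add]
        · rw [sum_Ico_eq_sum_range, range_eq_Ico]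
          refine sum_congr (by congr 1; omega) fun i hi => ?_
          simp only [b, Nat.le_add_right, if_true, Nat.add_sub_cancel_left, pow_add, Nat.sub_add_eq]
          ring
        · have : ¬ j ≤ m := by have := (mem_Ico.mp hm).2; omega
          simp [b, this]
      -- The transported expansion has degree r in y; its terms of degree above ⌊s⌋ are moved into
      -- the remainder.
      have hrem : hasseRem s (Breuil.unitInv r f) B w y =
          emb p E (w + y) ^ r * hasseRem s f A u (u' - u) +
            ∑ m ∈ Ico (N + 1) (r + 1), B m w * emb p E y ^ m := by
        have h4 : ∑ j ∈ range (N + 1), A j u * (emb p E (w + y) ^ r * emb p E (u' - u) ^ j) =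
            ∑ m ∈ range (r + 1), B m w * emb p E y ^ m := by
          rw [sum_congr rfl fun j hj => by rw [hterm j hj]]
          simp only [mul_sum]
          rw [sum_comm]
          refine sum_congr rfl fun m _ => ?_
          simp only [B, hw, if_true, sum_mul]
          exact sum_congr rfl fun j _ => by ring
        rw [sum_Ico_eq_sub _ (by omega : N + 1 ≤ r + 1), ← h4, hasseRem, hasseRem,
          Breuil.unitInv, if_pos hw', add_sub_cancel, mul_sub, mul_sum]
        rw [sum_congr rfl fun j _ => mul_left_comm (A j u) _ _]
        ring
      rw [hrem]
      refine (IsUltrametricDist.norm_add_le_max _ _).trans (max_le_max ?_ ?_)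
      · rw [norm_mul, norm_pow, norm_emb, hw', one_pow, one_mul]
      · refine IsUltrametricDist.norm_sum_le_of_forall_le_of_nonneg (by positivity) fun m hm => ?_
        rw [norm_mul, norm_pow, norm_emb]
        exact mul_le_mul (hB m w) (pow_le_pow_of_le_one (norm_nonneg _) hy.le (mem_Ico.mp hm).1)
          (by positivity) hC
    · have hw' : ¬ ‖w + y‖ = 1 := fun h => hw <| by
        have h5 : w = (w + y) - y := by ring
        rw [h5, sub_eq_add_neg, IsUltrametricDist.norm_add_eq_max_of_norm_ne_norm
          (by rw [h, norm_neg]; exact hy.ne'), h, norm_neg]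
        exact max_eq_left hy.le
      refine ⟨0, y, rfl, ?_⟩
      have : hasseRem s (Breuil.unitInv r f) B w y = 0 := by
        rw [hasseRem, Breuil.unitInv, if_neg hw']
        simp [B, hw]
      rw [this, norm_zero]
      positivity
  refine ⟨B, fun j _ x => hB j x, fun w y => ?_, fun c hc => ?_⟩
  · rcases (PadicInt.norm_le_one y).lt_or_eq with hy | hy
    · obtain ⟨u, δ, hδ, h⟩ := hmain w y hy
      refine h.trans (max_le ((h₂ u δ).trans (by rw [hδ])) ?_)
      gcongr
      exact norm_pow_le_rpow hs (norm_nonneg _) hy.le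
    · rw [hy, Real.one_rpow, mul_one]
      refine (norm_sub_le_max' _ _).trans (max_le (hfi _) ?_)
      refine IsUltrametricDist.norm_sum_le_of_forall_le_of_nonneg hC fun j _ => ?_
      rw [norm_mul, norm_pow, norm_emb, hy, one_pow, mul_one]
      exact hB _ _
  · obtain ⟨H₁, hH₁⟩ := h₃ c hc
    obtain ⟨H₂, hH₂⟩ := exists_mul_norm_pow_le (p := p) hs C hc
    refine ⟨max 1 (max H₁ H₂), fun w y hy => ?_⟩
    have h1 : ∀ k : ℕ, k ≤ max 1 (max H₁ H₂) → ‖y‖ ≤ (p : ℝ) ^ (-(k : ℝ)) := fun k hk => hy.trans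
      (Real.rpow_le_rpow_of_exponent_le one_lt_prime.le (neg_le_neg (by exact_mod_cast hk)))
    obtain ⟨u, δ, hδ, h⟩ := hmain w y ((h1 1 (le_max_left _ _)).trans_lt
      (Real.rpow_lt_one_of_one_lt_of_neg one_lt_prime (by simp)))
    refine h.trans (max_le ?_ (hH₂ y (h1 H₂ (by simp))))
    rw [← hδ]
    exact hH₁ u δ (by rw [hδ]; exact h1 H₁ (by simp))

end Inversion

/-! ### Closed lattices of C^s functions; monomials of degree larger than r. -/

section CsLattice

variable {p : ℕ} [Fact p.Prime] {E : Type*} [NormedField E] [NormedAlgebra ℚ_[p] E]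

theorem norm_le_rpow_iff_dvd (x : ℤ_[p]) (h : ℕ) :
    ‖x‖ ≤ (p : ℝ) ^ (-(h : ℝ)) ↔ (p : ℤ_[p]) ^ h ∣ x := by
  rw [← Ideal.mem_span_singleton, ← PadicInt.norm_le_pow_iff_mem_span_pow, zpow_neg, zpow_natCast,
    Real.rpow_neg prime_pos.le, Real.rpow_natCast]

theorem ballMono_apply (M : ℕ) (α : ℤ_[p]) (h : ℕ) (z : ℤ_[p]) [Decidable ((p : ℤ_[p]) ^ h ∣ z - α)] :
    ballMono E M α h z = if (p : ℤ_[p]) ^ h ∣ z - α then emb p E (z - α) ^ M else 0 := by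
  simp only [ballMono, norm_le_rpow_iff_dvd]

theorem ballMono_of_dvd {M : ℕ} {α : ℤ_[p]} {h : ℕ} {z : ℤ_[p]} (hz : (p : ℤ_[p]) ^ h ∣ z - α) :
    ballMono E M α h z = emb p E (z - α) ^ M := by
  classical rw [ballMono_apply, if_pos hz]

theorem ballMono_of_not_dvd {M : ℕ} {α : ℤ_[p]} {h : ℕ} {z : ℤ_[p]}
    (hz : ¬ (p : ℤ_[p]) ^ h ∣ z - α) : ballMono E M α h z = 0 := by
  classical rw [ballMono_apply, if_neg hz]

theorem ballMono_expand {M : ℕ} {α β : ℤ_[p]} {h : ℕ} {z : ℤ_[p]} (hz : (p : ℤ_[p]) ^ h ∣ z - β) :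
    emb p E (z - α) ^ M = ∑ j ∈ range (M + 1),
      (M.choose j : E) * emb p E (β - α) ^ (M - j) * ballMono E j β h z := by
  have : z - α = (z - β) + (β - α) := by ring
  rw [this, map_add, add_pow]
  refine sum_congr rfl fun j _ => ?_
  rw [ballMono_of_dvd hz]
  ring

theorem exists_digit (t : ℤ_[p]) : ∃ b < p, (p : ℤ_[p]) ∣ t - b := by
  obtain ⟨b, hb, h⟩ := PadicInt.exists_mem_range (x := t)
  refine ⟨b, hb, ?_⟩
  rwa [PadicInt.maximalIdeal_eq_span_p, Ideal.mem_span_singleton] at h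

theorem digit_unique {t : ℤ_[p]} {a b : ℕ} (ha : a < p) (hb : b < p) (hat : (p : ℤ_[p]) ∣ t - a)
    (hbt : (p : ℤ_[p]) ∣ t - b) : a = b := by
  have h := dvd_sub hbt hat
  rw [sub_sub_sub_cancel_left] at h
  have h' : ((p ^ 1 : ℤ)) ∣ ((a : ℤ) - b) := by
    rw [← PadicInt.pow_p_dvd_int_iff]
    push_cast
    simpa using h
  rw [pow_one] at h'
  have := Int.eq_zero_of_abs_lt_dvd h' (by rw [abs_lt]; constructor <;> omega)
  omega

/-- The ball is divided into p balls of the next level, and the monomial is re-expanded at each new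
centre. -/
theorem ballMono_split (M : ℕ) (α : ℤ_[p]) (h : ℕ) :
    ballMono E M α h = ∑ b ∈ range p, ∑ j ∈ range (M + 1),
      ((M.choose j : E) * emb p E ((p : ℤ_[p]) ^ h * (b : ℤ_[p])) ^ (M - j)) •
        ballMono E j (α + (p : ℤ_[p]) ^ h * (b : ℤ_[p])) (h + 1) := by
  have hp0 : (p : ℤ_[p]) ^ h ≠ 0 := pow_ne_zero _ (by exact_mod_cast (Fact.out : p.Prime).ne_zero)
  have hsub : ∀ (z : ℤ_[p]) (b : ℕ), z - (α + (p : ℤ_[p]) ^ h * (b : ℤ_[p])) = (z - α) - p ^ h * b :=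
    fun z b => by ring
  ext z
  simp only [Finset.sum_apply, Pi.smul_apply, smul_eq_mul]
  by_cases hz : (p : ℤ_[p]) ^ h ∣ z - α
  · obtain ⟨t, ht⟩ := hz
    obtain ⟨b, hb, hbt⟩ := exists_digit t
    have hdvd : ∀ b' : ℕ, (p : ℤ_[p]) ^ (h + 1) ∣ z - (α + (p : ℤ_[p]) ^ h * b') ↔
        (p : ℤ_[p]) ∣ t - b' := fun b' => by
      rw [hsub, ht, ← mul_sub, pow_succ, mul_dvd_mul_iff_left hp0]
    rw [sum_eq_single b]
    · rw [ballMono_of_dvd ⟨t, ht⟩, ballMono_expand ((hdvd b).mpr hbt)]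
      simp only [add_sub_cancel_left]
    · intro b' hb' hne
      refine sum_eq_zero fun j _ => ?_
      rw [ballMono_of_not_dvd, mul_zero]
      rw [hdvd]
      exact fun h' => hne (digit_unique (mem_range.mp hb') hb h' hbt)
    · exact fun h' => absurd (mem_range.mpr hb) h'
  · rw [ballMono_of_not_dvd hz]
    refine (sum_eq_zero fun b _ => sum_eq_zero fun j _ => ?_).symm
    rw [ballMono_of_not_dvd, mul_zero]
    intro h'
    refine hz ?_
    have := (dvd_of_mul_right_dvd (pow_succ (p : ℤ_[p]) h ▸ h'))
    rw [hsub] at this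
    simpa using dvd_add this (dvd_mul_right ((p : ℤ_[p]) ^ h) (b : ℤ_[p]))

/-- A closed `𝒪_E`-submodule of the space of functions of class `C^s` supported on
`p ^ h₀ ℤ_p`. -/
structure IsCsLattice (s : ℝ) (h₀ : ℕ) (K : Set (ℤ_[p] → E)) : Prop where
  zero_mem : 0 ∈ K
  add_mem : ∀ {f g}, f ∈ K → g ∈ K → f + g ∈ K
  smul_mem : ∀ {f} {c : E}, ‖c‖ ≤ 1 → f ∈ K → c • f ∈ K
  supp : ∀ {f}, f ∈ K → ∀ z, ¬ (p : ℤ_[p]) ^ h₀ ∣ z → f z = 0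
  closed : ∀ {f C}, CsBound s f C → (∀ z, ¬ (p : ℤ_[p]) ^ h₀ ∣ z → f z = 0) →
    (∀ ε > 0, ∃ g ∈ K, CsBound s (f - g) ε) → f ∈ K

theorem IsCsLattice.sum_mem {s : ℝ} {h₀ : ℕ} {K : Set (ℤ_[p] → E)} (hK : IsCsLattice s h₀ K)
    {ι : Type*} (t : Finset ι) {f : ι → ℤ_[p] → E} (hf : ∀ i ∈ t, f i ∈ K) : ∑ i ∈ t, f i ∈ K :=
  sum_induction f (· ∈ K) (fun _ _ => hK.add_mem) hK.zero_mem hf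

theorem ballMono_supp {h₀ h : ℕ} (hh : h₀ ≤ h) {M : ℕ} {α : ℤ_[p]} (hα : (p : ℤ_[p]) ^ h₀ ∣ α)
    (z : ℤ_[p]) (hz : ¬ (p : ℤ_[p]) ^ h₀ ∣ z) : ballMono E M α h z = 0 := by
  rw [ballMono_of_not_dvd]
  exact fun h' => hz (by simpa using dvd_add ((pow_dvd_pow _ hh).trans h') hα)

variable [IsUltrametricDist E]

theorem IsCsLattice.tsum_mem [CompleteSpace E] {s : ℝ} (hs : 0 < s) {h₀ : ℕ}
    {K : Set (ℤ_[p] → E)} (hK : IsCsLattice s h₀ K) {ι : Type*} {f : ι → ℤ_[p] → E} {C : ι → ℝ}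
    (hf : ∀ i, CsBound s (f i) (C i)) (hC : Tendsto C cofinite (𝓝 0)) (hfK : ∀ i, f i ∈ K) :
    (fun z => ∑' i, f i z) ∈ K := by
  -- The tolerance 1 is arbitrary: it only serves to exhibit some finite bound for the whole sum.
  obtain ⟨t, ht⟩ := CsBound.exists_finset_tsum_sub hs hf hC one_pos
  have hfin : CsBound s (∑ i ∈ t, f i) (∑ i ∈ t, C i) :=
    CsBound.sum t (sum_nonneg fun i _ => (hf i).nonneg) fun i hi =>
      (hf i).mono (single_le_sum (fun i _ => (hf i).nonneg) hi)
  refine hK.closed (C := max 1 (∑ i ∈ t, C i)) ?_ (fun z hz => ?_) fun ε hε => ?_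
  · simpa using (ht.mono (le_max_left _ _)).add (hfin.mono (le_max_right _ _))
  · simp [hK.supp (hfK _) z hz]
  · obtain ⟨t, ht⟩ := CsBound.exists_finset_tsum_sub hs hf hC hε
    exact ⟨_, hK.sum_mem t fun i _ => hfK i, ht⟩

/-- A closed lattice that contains the suitably normalized monomials of degree at most `r` on balls
also contains those of degree larger than `r`. -/
theorem IsCsLattice.smul_ballMono_mem {s : ℝ} (hs : 0 < s) {r : ℕ} (hsr : s ≤ r) {h₀ : ℕ}
    {K : Set (ℤ_[p] → E)} (hK : IsCsLattice s h₀ K)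
    (hmono : ∀ j ≤ r, ∀ (α : ℤ_[p]) (h : ℕ) (c : E), h₀ ≤ h → (p : ℤ_[p]) ^ h₀ ∣ α →
      ‖c‖ ≤ (p : ℝ) ^ (-(((h : ℝ) - 1) * (s - j))) → c • ballMono E j α h ∈ K)
    {M : ℕ} (hM : r < M) {α : ℤ_[p]} {h : ℕ} {c : E} (hh : h₀ ≤ h) (hα : (p : ℤ_[p]) ^ h₀ ∣ α)
    (hc : ‖c‖ ≤ (p : ℝ) ^ (-((h : ℝ) * (s - M)))) : c • ballMono E M α h ∈ K := by
  have hp0 : (p : E) ≠ 0 := by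
    have := (algebraMap ℚ_[p] E).injective
    have h1 : (p : ℚ_[p]) ≠ 0 := by exact_mod_cast (Fact.out : p.Prime).ne_zero
    simpa using (map_ne_zero (algebraMap ℚ_[p] E)).mpr h1
  have hpn : ‖(p : E)‖ = (p : ℝ) ^ (-1 : ℝ) := by
    have := norm_algebraMap' E (p : ℚ_[p])
    rw [map_natCast, Padic.norm_p] at this
    rw [this, Real.rpow_neg_one]
  have hbound : ∀ {M : ℕ} {α : ℤ_[p]} {h : ℕ} {c : E} {e : ℝ},
      ‖c‖ ≤ (p : ℝ) ^ (-((h : ℝ) * (s - M)) - e) →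
      CsBound s (c • ballMono E M α h) ((p : ℝ) ^ (-e)) := fun {M α h c e} hc => by
    refine ((CsBound.ballMono hs M α h).smul c).mono ?_
    calc _ ≤ (p : ℝ) ^ (-((h : ℝ) * (s - M)) - e) * (p : ℝ) ^ (h * (s - M)) := by gcongr
      _ = _ := by rw [← Real.rpow_add prime_pos]; ring_nf
  -- Each subdivision of the ball gains a factor p in the approximation by elements of K, so t
  -- subdivisions give an error p^{-t}.
  have key : ∀ t : ℕ, ∀ M, r < M → ∀ (α : ℤ_[p]) (h : ℕ) (c : E), h₀ ≤ h → (p : ℤ_[p]) ^ h₀ ∣ α →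
      ‖c‖ ≤ (p : ℝ) ^ (-((h : ℝ) * (s - M))) →
      ∃ g ∈ K, CsBound s (c • ballMono E M α h - g) ((p : ℝ) ^ (-(t : ℝ))) := by
    intro t
    induction t with
    | zero =>
      intro M hM α h c hh hα hc
      refine ⟨0, hK.zero_mem, ?_⟩
      rw [sub_zero]
      exact hbound (by simpa using hc)
    | succ t ih =>
      intro M hM α h c hh hα hc
      have hterm : ∀ b j : ℕ, j ≤ M → ∃ g ∈ K, CsBound s
          ((c * ((M.choose j : E) * emb p E ((p : ℤ_[p]) ^ h * (b : ℤ_[p])) ^ (M - j))) •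
            ballMono E j (α + (p : ℤ_[p]) ^ h * (b : ℤ_[p])) (h + 1) - g)
          ((p : ℝ) ^ (-((t + 1 : ℕ) : ℝ))) := by
        intro b j hjM
        set d : E := c * ((M.choose j : E) * emb p E ((p : ℤ_[p]) ^ h * (b : ℤ_[p])) ^ (M - j))
        have hd : ‖d‖ ≤ (p : ℝ) ^ (-((h : ℝ) * (s - j))) := by
          have h1 : ‖(p : ℤ_[p]) ^ h * b‖ ≤ (p : ℝ) ^ (-(h : ℝ)) :=
            (norm_le_rpow_iff_dvd _ _).mpr (dvd_mul_right _ _)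
          calc ‖d‖ ≤ (p : ℝ) ^ (-((h : ℝ) * (s - M))) *
                (1 * ((p : ℝ) ^ (-(h : ℝ))) ^ (M - j)) := by
                rw [norm_mul, norm_mul]
                gcongr
                · exact norm_natCast_le_one' _
                · exact norm_emb_pow_le h1 _
            _ = _ := by
                rw [one_mul, ← Real.rpow_natCast, ← Real.rpow_mul prime_pos.le,
                  ← Real.rpow_add prime_pos]
                push_cast [hjM]
                ring_nf
        have hβ : (p : ℤ_[p]) ^ h₀ ∣ α + (p : ℤ_[p]) ^ h * b :=
          dvd_add hα ((pow_dvd_pow _ hh).trans (dvd_mul_right _ _))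
        rcases le_or_gt j r with hj | hj
        -- For degrees at most r the assumed normalization at level h+1 has exponent (h+1)-1 = h,
        -- which is exactly the bound available for `d`.
        · refine ⟨_, hmono j hj _ (h + 1) d (by omega) hβ (by push_cast; simpa using hd), ?_⟩
          rw [sub_self]
          exact CsBound.zero s (Real.rpow_nonneg prime_pos.le _)
        · have hj1 : s + 1 ≤ j := by
            have : (r : ℝ) + 1 ≤ j := by exact_mod_cast hj
            linarith
          -- Passing from level h to h+1 relaxes the bound by p^{j-s}. Since j ≥ r+1 ≥ s+1 this is
          -- at least p, so d/p still satisfies the induction hypothesis.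
          have hd' : ‖(p : E)⁻¹ * d‖ ≤ (p : ℝ) ^ (-(((h + 1 : ℕ) : ℝ) * (s - j))) := by
            rw [norm_mul, norm_inv, hpn, ← Real.rpow_neg prime_pos.le]
            calc _ ≤ (p : ℝ) ^ (-(-1 : ℝ)) * (p : ℝ) ^ (-((h : ℝ) * (s - j))) := by gcongr
              _ = (p : ℝ) ^ (1 - (h : ℝ) * (s - j)) := by
                rw [← Real.rpow_add prime_pos]; ring_nf
              _ ≤ _ := Real.rpow_le_rpow_of_exponent_le one_lt_prime.le (by push_cast; linarith)
          obtain ⟨g, hg, hgb⟩ := ih j hj _ (h + 1) _ (by omega) hβ hd'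
          refine ⟨(p : E) • g, hK.smul_mem (norm_natCast_le_one' _) hg, ?_⟩
          convert hgb.smul (p : E) using 1
          · rw [smul_sub, smul_smul, mul_inv_cancel_left₀ hp0]
          · rw [hpn, ← Real.rpow_add prime_pos]
            push_cast
            ring_nf
      choose! g hgK hgb using hterm
      refine ⟨∑ b ∈ range p, ∑ j ∈ range (M + 1), g b j,
        hK.sum_mem _ fun b _ => hK.sum_mem _ fun j hj =>
          hgK b j (Nat.lt_succ_iff.mp (mem_range.mp hj)), ?_⟩
      rw [ballMono_split, smul_sum, ← sum_sub_distrib]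
      refine CsBound.sum _ (Real.rpow_nonneg prime_pos.le _) fun b _ => ?_
      rw [smul_sum, ← sum_sub_distrib]
      refine CsBound.sum _ (Real.rpow_nonneg prime_pos.le _) fun j hj => ?_
      rw [smul_smul]
      exact hgb b j (Nat.lt_succ_iff.mp (mem_range.mp hj))
  refine hK.closed (C := (p : ℝ) ^ (-(0 : ℝ))) (hbound (by simpa using hc)) (fun z hz => ?_)
    fun ε hε => ?_
  · rw [Pi.smul_apply, ballMono_supp hh hα z hz, smul_zero]
  · obtain ⟨t, ht⟩ := PadicInt.exists_pow_neg_lt p hε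
    obtain ⟨g, hg, hgb⟩ := key t M hM α h c hh hα hc
    refine ⟨g, hg, hgb.mono ?_⟩
    rw [zpow_neg, zpow_natCast] at ht
    rw [Real.rpow_neg prime_pos.le, Real.rpow_natCast]
    exact ht.le

end CsLattice

/-! ### The compact induction and explicit elements in the image of its lattice. -/

section Induction

variable {p : ℕ} [Fact p.Prime] {E : Type*} [NormedField E] [NormedAlgebra ℚ_[p] E]

theorem prime_ne_zero_field : (p : E) ≠ 0 := by
  have h1 : (p : ℚ_[p]) ≠ 0 := by exact_mod_cast (Fact.out : p.Prime).ne_zero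
  simpa using (map_ne_zero (algebraMap ℚ_[p] E)).mpr h1

theorem norm_prime_field : ‖(p : E)‖ = (p : ℝ)⁻¹ := by
  rw [← Padic.norm_p (p := p), ← norm_algebraMap' E (p : ℚ_[p]), map_natCast]

theorem sqrtp_ne_zero {sqrtp : E} (hsqrtp : sqrtp ^ 2 = (p : E)) : sqrtp ≠ 0 := by
  rintro rfl
  exact prime_ne_zero_field (p := p) (E := E) (by rw [← hsqrtp]; simp)

theorem norm_sqrtp {sqrtp : E} (hsqrtp : sqrtp ^ 2 = (p : E)) :
    ‖sqrtp‖ = (p : ℝ) ^ (-(1 / 2) : ℝ) := by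
  have h : ‖sqrtp‖ ^ 2 = ((p : ℝ) ^ (-(1 / 2) : ℝ)) ^ 2 := by
    rw [← norm_pow, hsqrtp, norm_prime_field, ← Real.rpow_natCast, ← Real.rpow_mul prime_pos.le]
    norm_num
    rw [Real.rpow_neg_one]
  exact (pow_left_inj₀ (norm_nonneg _) (Real.rpow_nonneg prime_pos.le _) two_ne_zero).mp h

variable (E) in
/-- The linear forms substituted for `X` and `Y` by the action of `g`. -/
def linForm (g : G2 p) (i : Fin 2) : MvPolynomial (Fin 2) E :=
  ∑ k, MvPolynomial.C (algebraMap ℚ_[p] E ((g : Matrix (Fin 2) (Fin 2) ℚ_[p]) k i)) *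
    MvPolynomial.X k

theorem symAct_eq (sqrtp : E) (r : ℕ) (g : G2 p) (P : MvPolynomial (Fin 2) E) :
    symAct p sqrtp r g P = MvPolynomial.C
      (sqrtp ^ (-((r : ℤ) * (g : Matrix (Fin 2) (Fin 2) ℚ_[p]).det.valuation))) *
        MvPolynomial.bind₁ (linForm E g) P := by
  rw [symAct]
  congr 2
  ext i : 1
  fin_cases i <;> simp [linForm, Fin.sum_univ_two]

theorem det_ne_zero (g : G2 p) : (g : Matrix (Fin 2) (Fin 2) ℚ_[p]).det ≠ 0 :=
  g.det_ne_zero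

theorem symAct_mul {sqrtp : E} (hsqrtp : sqrtp ^ 2 = (p : E)) (r : ℕ) (g h : G2 p)
    (P : MvPolynomial (Fin 2) E) :
    symAct p sqrtp r (g * h) P = symAct p sqrtp r g (symAct p sqrtp r h P) := by
  simp only [symAct_eq, map_mul, MvPolynomial.bind₁_C_right, MvPolynomial.bind₁_bind₁]
  rw [← mul_assoc, ← map_mul, ← zpow_add₀ (sqrtp_ne_zero hsqrtp), Units.val_mul, Matrix.det_mul,
    Padic.valuation_mul (det_ne_zero g) (det_ne_zero h)]
  congr 2
  · congr 1
    ring_nf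
  · congr 1
    ext i : 1
    simp only [linForm, map_sum, map_mul, MvPolynomial.bind₁_C_right, MvPolynomial.bind₁_X_right,
      Matrix.mul_apply, mul_sum, sum_mul, Units.val_mul]
    rw [sum_comm]
    refine sum_congr rfl fun k _ => sum_congr rfl fun l _ => ?_
    ring

@[simp]
theorem symAct_zero (sqrtp : E) (r : ℕ) (g : G2 p) : symAct p sqrtp r g 0 = 0 := by
  simp [symAct_eq]

theorem symAct_add (sqrtp : E) (r : ℕ) (g : G2 p) (P Q : MvPolynomial (Fin 2) E) :
    symAct p sqrtp r g (P + Q) = symAct p sqrtp r g P + symAct p sqrtp r g Q := by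
  simp [symAct_eq, mul_add]

theorem symAct_smul (sqrtp : E) (r : ℕ) (g : G2 p) (c : E) (P : MvPolynomial (Fin 2) E) :
    symAct p sqrtp r g (c • P) = c • symAct p sqrtp r g P := by
  simp [symAct_eq]

theorem eval_symAct (sqrtp : E) (r : ℕ) (g : G2 p) (P : MvPolynomial (Fin 2) E)
    (v : Fin 2 → E) : MvPolynomial.eval v (symAct p sqrtp r g P) =
      sqrtp ^ (-((r : ℤ) * (g : Matrix (Fin 2) (Fin 2) ℚ_[p]).det.valuation)) *
        MvPolynomial.eval (fun i => ∑ k, algebraMap ℚ_[p] E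
          ((g : Matrix (Fin 2) (Fin 2) ℚ_[p]) k i) * v k) P := by
  rw [symAct_eq, map_mul, MvPolynomial.eval_C, MvPolynomial.eval, MvPolynomial.eval₂Hom_bind₁]
  congr 3
  ext i
  simp [linForm]

theorem symAct_isHomogeneous (sqrtp : E) (r : ℕ) (g : G2 p) {P : MvPolynomial (Fin 2) E}
    (hP : P.IsHomogeneous r) : (symAct p sqrtp r g P).IsHomogeneous r := by
  rw [symAct_eq]
  have h : ∀ i, (linForm E g i).IsHomogeneous 1 := fun i =>
    MvPolynomial.IsHomogeneous.sum _ _ _ fun k _ => by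
      simpa using (MvPolynomial.isHomogeneous_C (Fin 2) _).mul (MvPolynomial.isHomogeneous_X E k)
  have h2 := hP.aeval (linForm E g) h
  rw [one_mul] at h2
  simpa using (MvPolynomial.isHomogeneous_C (Fin 2) _).mul h2

section Ultrametric

variable [IsUltrametricDist E]

variable (E) in
/-- The polynomials with coefficients in `𝒪_E`. -/
def intPoly : Subring (MvPolynomial (Fin 2) E) where
  carrier := {P | ∀ m, ‖P.coeff m‖ ≤ 1}
  mul_mem' {P Q} hP hQ m := by
    classical
    rw [MvPolynomial.coeff_mul]
    refine IsUltrametricDist.norm_sum_le_of_forall_le_of_nonneg zero_le_one fun x _ => ?_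
    rw [norm_mul]
    exact mul_le_one₀ (hP _) (norm_nonneg _) (hQ _)
  one_mem' m := by
    classical
    rw [MvPolynomial.coeff_one]
    split_ifs <;> simp
  add_mem' {P Q} hP hQ m := by
    rw [MvPolynomial.coeff_add]
    exact (IsUltrametricDist.norm_add_le_max _ _).trans (max_le (hP m) (hQ m))
  zero_mem' m := by simp
  neg_mem' {P} hP m := by simpa using hP m

theorem C_mem_intPoly {c : E} (hc : ‖c‖ ≤ 1) : MvPolynomial.C c ∈ intPoly E := fun m => by
  classical
  rw [MvPolynomial.coeff_C]
  split_ifs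
  · exact hc
  · simp

theorem X_mem_intPoly (i : Fin 2) : MvPolynomial.X i ∈ intPoly E := fun m => by
  classical
  rw [MvPolynomial.coeff_X]
  split_ifs <;> simp

theorem symAct_mem_intPoly_of_mem_iwahori {sqrtp : E} (r : ℕ) {g : G2 p} (hg : g ∈ iwahori p)
    {P : MvPolynomial (Fin 2) E} (hP : P ∈ intPoly E) : symAct p sqrtp r g P ∈ intPoly E := by
  obtain ⟨h1, h2, -⟩ := hg
  have hv : (g : Matrix (Fin 2) (Fin 2) ℚ_[p]).det.valuation = 0 := by
    rw [Padic.norm_eq_zpow_neg_valuation (det_ne_zero g)] at h2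
    have := (zpow_eq_one_iff_right₀ prime_pos.le one_lt_prime.ne').mp h2
    simpa using this
  rw [symAct_eq, hv, mul_zero, neg_zero, zpow_zero, map_one, one_mul]
  change MvPolynomial.aeval (linForm E g) P ∈ intPoly E
  rw [MvPolynomial.aeval_def, MvPolynomial.eval₂_eq']
  refine Subring.sum_mem _ fun m _ => Subring.mul_mem _ (C_mem_intPoly (hP m))
    (Subring.prod_mem _ fun i _ => Subring.pow_mem _ (Subring.sum_mem _ fun k _ =>
      Subring.mul_mem _ (C_mem_intPoly ?_) (X_mem_intPoly k)) _)
  rw [norm_algebraMap']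
  exact h1 k i

/-- A scalar matrix a multiplies homogeneous polynomials of degree r by a^r, and the twist
|det|^{r/2} = |a|^r compensates its size. The centre therefore acts through scalars of norm 1. -/
theorem symAct_mem_intPoly_of_mem_center {sqrtp : E} (hsqrtp : sqrtp ^ 2 = (p : E)) (r : ℕ)
    {g : G2 p} (hg : g ∈ Subgroup.center (G2 p)) {P : MvPolynomial (Fin 2) E}
    (hr : P.IsHomogeneous r) (hP : P ∈ intPoly E) : symAct p sqrtp r g P ∈ intPoly E := by
  obtain ⟨a, ha⟩ := Matrix.GeneralLinearGroup.mem_center_iff_val_mem_range_scalar.mp hg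
  have hdet : (g : Matrix (Fin 2) (Fin 2) ℚ_[p]).det = a * a := by
    rw [← ha]
    simp [Matrix.scalar_apply, sq]
  have ha0 : a ≠ 0 := fun h => det_ne_zero g (by rw [hdet, h, zero_mul])
  have hlin : ∀ i, linForm E g i = MvPolynomial.C (algebraMap ℚ_[p] E a) * MvPolynomial.X i :=
    fun i => by
      rw [linForm, ← ha]
      fin_cases i <;> simp [Fin.sum_univ_two, Matrix.scalar_apply]
  rw [symAct_eq, hdet, Padic.valuation_mul ha0 ha0]
  set u : E := sqrtp ^ (-((r : ℤ) * (a.valuation + a.valuation)))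
  have hu : ‖u * algebraMap ℚ_[p] E a ^ r‖ = 1 := by
    rw [norm_mul, norm_pow, norm_algebraMap', norm_zpow, norm_sqrtp hsqrtp,
      Padic.norm_eq_zpow_neg_valuation ha0, ← Real.rpow_intCast, ← Real.rpow_intCast,
      ← Real.rpow_natCast, ← Real.rpow_mul prime_pos.le, ← Real.rpow_mul prime_pos.le,
      ← Real.rpow_add prime_pos]
    push_cast
    ring_nf
    simp
  have hbind : MvPolynomial.C u * MvPolynomial.bind₁ (linForm E g) P =
      MvPolynomial.C (u * algebraMap ℚ_[p] E a ^ r) * P := by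
    rw [map_mul, mul_assoc]
    congr 1
    change MvPolynomial.aeval (linForm E g) P = _
    conv_rhs => rw [P.as_sum, mul_sum]
    rw [MvPolynomial.aeval_def, MvPolynomial.eval₂_eq']
    refine sum_congr rfl fun m hm => ?_
    have hdeg := hr (MvPolynomial.mem_support_iff.mp hm)
    simp only [hlin, mul_pow, prod_mul_distrib, prod_pow_eq_pow_sum]
    have hm' : ∑ i, m i = r := by
      rw [← hdeg, Finsupp.weight_apply, Finsupp.sum_fintype _ _ (by simp)]
      simp
    rw [hm', MvPolynomial.monomial_eq, Finsupp.prod_fintype _ _ (by simp), map_pow,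
      MvPolynomial.algebraMap_eq]
    ring
  rw [hbind]
  exact Subring.mul_mem _ (C_mem_intPoly hu.le) hP

theorem symAct_mem_intPoly {sqrtp : E} (hsqrtp : sqrtp ^ 2 = (p : E)) (r : ℕ) {g : G2 p}
    (hg : g ∈ IZ p) {P : MvPolynomial (Fin 2) E} (hr : P.IsHomogeneous r) (hP : P ∈ intPoly E) :
    symAct p sqrtp r g P ∈ intPoly E := by
  obtain ⟨y, hy, z, hz, rfl⟩ := Subgroup.mem_sup_of_normal_right.mp hg
  rw [symAct_mul hsqrtp]
  exact symAct_mem_intPoly_of_mem_iwahori r hy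
    (symAct_mem_intPoly_of_mem_center hsqrtp r hz hr hP)

/-- The function supported on `IZ g⁻¹` whose value at `g⁻¹` is `P`. -/
def elemFn (sqrtp : E) (r : ℕ) (g : G2 p) (P : MvPolynomial (Fin 2) E) (x : G2 p) :
    MvPolynomial (Fin 2) E :=
  open Classical in if x * g ∈ IZ p then symAct p sqrtp r (x * g) P else 0

theorem elemFn_mem {sqrtp : E} (hsqrtp : sqrtp ^ 2 = (p : E)) (r : ℕ) (g : G2 p)
    {P : MvPolynomial (Fin 2) E} (hr : P.IsHomogeneous r) (hP : P ∈ intPoly E) :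
    elemFn sqrtp r g P ∈ indLattice p sqrtp r := by
  refine ⟨fun x => ?_, fun h hh x => ?_, {g⁻¹}, Set.finite_singleton _, fun x hx => ?_⟩
  · rw [elemFn]
    split_ifs with hx
    · exact ⟨symAct_isHomogeneous _ _ _ hr, symAct_mem_intPoly hsqrtp r hx hr hP⟩
    · exact ⟨MvPolynomial.isHomogeneous_zero _ _ _, (intPoly E).zero_mem⟩
  · have : h * x * g ∈ IZ p ↔ x * g ∈ IZ p := by
      rw [mul_assoc]
      exact Subgroup.mul_mem_cancel_left _ hh
    rw [elemFn, elemFn]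
    by_cases hx : x * g ∈ IZ p
    · rw [if_pos hx, if_pos (this.mpr hx), mul_assoc, symAct_mul hsqrtp]
    · rw [if_neg hx, if_neg (mt this.mp hx), symAct_zero]
  · refine ⟨g⁻¹, rfl, x * g, ?_, by group⟩
    by_contra h
    exact hx (by rw [elemFn, if_neg h])

end Ultrametric

/-- Membership in B I Z depends only on the bottom row (c, d). Left multiplication by B and the
centre rescale the bottom row of an Iwahori matrix, whose last entry is a unit and whose first entry
is not. Conversely, if |c| < |d|, splitting off the lower unipotent matrix with entry c/d, which
lies in I, leaves an upper triangular matrix. -/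
theorem fId_eq_one_or_zero (g : G2 p) : (fId p g : E) =
    open Classical in
    if ‖(g : Matrix (Fin 2) (Fin 2) ℚ_[p]) 1 0‖ < ‖(g : Matrix (Fin 2) (Fin 2) ℚ_[p]) 1 1‖
      then 1 else 0 := by
  classical
  rw [fId]
  congr 1
  refine propext ⟨?_, fun hlt => ?_⟩
  · rintro ⟨b, h, hb, hh, rfl⟩
    obtain ⟨y, hy, z, hz, rfl⟩ := Subgroup.mem_sup_of_normal_right.mp hh
    obtain ⟨a, ha⟩ := Matrix.GeneralLinearGroup.mem_center_iff_val_mem_range_scalar.mp hz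
    obtain ⟨h1, h2, h3⟩ := hy
    have ha0 : a ≠ 0 := fun h0 => det_ne_zero z (by
      rw [← ha, h0]
      simp)
    have hb1 : (b : Matrix (Fin 2) (Fin 2) ℚ_[p]) 1 1 ≠ 0 := fun h0 => det_ne_zero b (by
      rw [Matrix.det_fin_two, h0, hb]
      ring)
    have hy11 : ‖(y : Matrix (Fin 2) (Fin 2) ℚ_[p]) 1 1‖ = 1 := by
      refine le_antisymm (h1 1 1) (not_lt.mp fun h4 => h2.not_lt ?_)
      rw [Matrix.det_fin_two]
      refine (norm_sub_le_max' _ _).trans_lt (max_lt ?_ ?_) <;> rw [norm_mul]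
      · exact mul_lt_one_of_nonneg_of_lt_one_right (h1 _ _) (norm_nonneg _) h4
      · exact mul_lt_one_of_nonneg_of_lt_one_right (h1 _ _) (norm_nonneg _) h3
    have key : ∀ i, ((b * (y * z) : G2 p) : Matrix (Fin 2) (Fin 2) ℚ_[p]) 1 i =
        (b : Matrix (Fin 2) (Fin 2) ℚ_[p]) 1 1 *
          (y : Matrix (Fin 2) (Fin 2) ℚ_[p]) 1 i * a := fun i => by
      rw [← mul_assoc, Units.val_mul, Units.val_mul, ← ha]
      fin_cases i <;> simp [Matrix.mul_apply, Fin.sum_univ_two, hb]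
    rw [key, key, norm_mul, norm_mul, norm_mul, norm_mul, hy11, mul_one]
    have hb1' := norm_pos_iff.mpr hb1
    have ha' := norm_pos_iff.mpr ha0
    have : ‖(b : Matrix (Fin 2) (Fin 2) ℚ_[p]) 1 1‖ * ‖(y : Matrix (Fin 2) (Fin 2) ℚ_[p]) 1 0‖ <
        ‖(b : Matrix (Fin 2) (Fin 2) ℚ_[p]) 1 1‖ := mul_lt_of_lt_one_right hb1' h3
    gcongr
  · set c := (g : Matrix (Fin 2) (Fin 2) ℚ_[p]) 1 0
    set d := (g : Matrix (Fin 2) (Fin 2) ℚ_[p]) 1 1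
    have hd0 : d ≠ 0 := norm_pos_iff.mp ((norm_nonneg _).trans_lt hlt)
    have hcd : ‖c / d‖ < 1 := by rwa [norm_div, div_lt_one (norm_pos_iff.mpr hd0)]
    have hlow : ∀ z : ℚ_[p], ((lowerUni p z : G2 p) : Matrix (Fin 2) (Fin 2) ℚ_[p]) =
        !![1, 0; z, 1] := fun z => rfl
    have hinv : lowerUni p (-(c / d)) * lowerUni p (c / d) = 1 := by
      refine Units.ext ?_
      rw [Units.val_mul, hlow, hlow]
      ext i j
      fin_cases i <;> fin_cases j <;> simp [Matrix.mul_apply, Fin.sum_univ_two]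
    refine ⟨g * lowerUni p (-(c / d)), lowerUni p (c / d), ?_, ?_, ?_⟩
    · rw [Units.val_mul, hlow, Matrix.mul_apply, Fin.sum_univ_two]
      change c * 1 + d * (-(c / d)) = 0
      field_simp
      ring
    · refine Subgroup.mem_sup_left ⟨fun i j => ?_, ?_, ?_⟩
      · rw [hlow]
        fin_cases i <;> fin_cases j <;> simp
        simpa using hcd.le
      · rw [hlow]
        simp [Matrix.det_fin_two]
      · rw [hlow]
        simpa using hcd
    · rw [mul_assoc, hinv, mul_one]

theorem fId_mul_right (g h : G2 p) (hh : h ∈ IZ p) : (fId p (g * h) : E) = fId p g := by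
  classical
  rw [fId, fId]
  congr 1
  refine propext ⟨?_, ?_⟩
  · rintro ⟨b, k, hb, hk, e⟩
    exact ⟨b, k * h⁻¹, hb, Subgroup.mul_mem _ hk (Subgroup.inv_mem _ hh), by
      rw [← mul_assoc, ← e, mul_inv_cancel_right]⟩
  · rintro ⟨b, k, hb, hk, e⟩
    exact ⟨b, k * h, hb, Subgroup.mul_mem _ hk hh, by rw [← mul_assoc, ← e]⟩

/-- Only the coset g IZ contributes. The chosen representative is g h with h in IZ, and h cancels:
the polynomial receives h⁻¹ and then g h, while B I Z is stable by IZ on the right. -/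
theorem uniformize_elemFn {sqrtp : E} (hsqrtp : sqrtp ^ 2 = (p : E)) (r : ℕ) (g : G2 p)
    (P : MvPolynomial (Fin 2) E) (z : ℚ_[p]) : uniformize p sqrtp r (elemFn sqrtp r g P) z =
      MvPolynomial.eval ![algebraMap ℚ_[p] E z, 1] (symAct p sqrtp r g P) *
        fId p (lowerUni p z * g) := by
  rw [uniformize, finsum_eq_single _ (QuotientGroup.mk g : G2 p ⧸ IZ p)]
  · obtain ⟨h, hh⟩ := QuotientGroup.mk_out_eq_mul (IZ p) g
    have h1 : (h : G2 p)⁻¹ * g⁻¹ * g = (h : G2 p)⁻¹ := by group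
    rw [hh, elemFn, mul_inv_rev, h1, if_pos (Subgroup.inv_mem _ h.2), ← symAct_mul hsqrtp,
      mul_inv_cancel_right, ← mul_assoc, fId_mul_right _ _ h.2]
  · intro q hq
    rw [elemFn, if_neg, symAct_zero, map_zero, zero_mul]
    intro h
    exact hq (by rw [← QuotientGroup.out_eq' q]; exact QuotientGroup.eq.mpr h)

/-- A `finsum` is additive only for families of finite support, so this is what makes `uniformize`
additive on the lattice. -/
theorem uniformize_support_finite {sqrtp : E} {r : ℕ} {F : G2 p → MvPolynomial (Fin 2) E}
    (hF : F ∈ indLattice p sqrtp r) (z : ℚ_[p]) :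
    (Function.support fun q : G2 p ⧸ IZ p =>
      MvPolynomial.eval ![algebraMap ℚ_[p] E z, 1] (symAct p sqrtp r q.out (F q.out⁻¹)) *
        fId p (lowerUni p z * q.out)).Finite := by
  obtain ⟨-, -, S, hS, h⟩ := hF
  refine (hS.image fun s => (QuotientGroup.mk s⁻¹ : G2 p ⧸ IZ p)).subset fun q hq => ?_
  have hq0 : F q.out⁻¹ ≠ 0 := fun h0 => hq (by simp [h0])
  obtain ⟨s, hs, k, hk, e⟩ := h _ hq0
  refine ⟨s, hs, ?_⟩
  rw [← QuotientGroup.out_eq' q]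
  refine QuotientGroup.eq.mpr ?_
  rw [← inv_inv q.out, e]
  simpa using hk

theorem uniformize_add {sqrtp : E} {r : ℕ} {F F' : G2 p → MvPolynomial (Fin 2) E}
    (hF : F ∈ indLattice p sqrtp r) (hF' : F' ∈ indLattice p sqrtp r) :
    uniformize p sqrtp r (F + F') = uniformize p sqrtp r F + uniformize p sqrtp r F' := by
  ext z
  rw [Pi.add_apply, uniformize, uniformize, uniformize,
    ← finsum_add_distrib (uniformize_support_finite hF z) (uniformize_support_finite hF' z)]
  refine finsum_congr fun q => ?_
  rw [Pi.add_apply, symAct_add, map_add, add_mul]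

theorem uniformize_smul (sqrtp : E) (r : ℕ) (c : E) (F : G2 p → MvPolynomial (Fin 2) E) :
    uniformize p sqrtp r (c • F) = c • uniformize p sqrtp r F := by
  ext z
  rw [Pi.smul_apply, uniformize, uniformize, smul_finsum]
  refine finsum_congr fun q => ?_
  rw [Pi.smul_apply, symAct_smul, MvPolynomial.smul_eval, smul_eq_mul, mul_assoc]

theorem indLattice_zero_mem (sqrtp : E) (r : ℕ) :
    (0 : G2 p → MvPolynomial (Fin 2) E) ∈ indLattice p sqrtp r :=
  ⟨fun _ => ⟨MvPolynomial.isHomogeneous_zero _ _ _, by simp⟩, fun _ _ _ => by simp,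
    ∅, Set.finite_empty, fun _ h => absurd rfl h⟩

theorem indLattice_smul_mem {sqrtp : E} {r : ℕ} {c : E} (hc : ‖c‖ ≤ 1)
    {F : G2 p → MvPolynomial (Fin 2) E} (hF : F ∈ indLattice p sqrtp r) :
    c • F ∈ indLattice p sqrtp r := by
  obtain ⟨h1, h2, S, hS, h3⟩ := hF
  refine ⟨fun g => ⟨?_, fun m => ?_⟩, fun h hh g => ?_, S, hS, fun g hg => h3 g fun h0 => hg ?_⟩
  · rw [Pi.smul_apply, MvPolynomial.smul_eq_C_mul]
    simpa using (MvPolynomial.isHomogeneous_C (Fin 2) c).mul (h1 g).1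
  · rw [Pi.smul_apply, MvPolynomial.coeff_smul, norm_smul]
    exact mul_le_one₀ hc (norm_nonneg _) ((h1 g).2 m)
  · rw [Pi.smul_apply, Pi.smul_apply, h2 h hh, symAct_smul]
  · rw [Pi.smul_apply, h0, smul_zero]

theorem indLattice_add_mem [IsUltrametricDist E] {sqrtp : E} {r : ℕ}
    {F F' : G2 p → MvPolynomial (Fin 2) E} (hF : F ∈ indLattice p sqrtp r)
    (hF' : F' ∈ indLattice p sqrtp r) : F + F' ∈ indLattice p sqrtp r := by
  obtain ⟨h1, h2, S, hS, h3⟩ := hF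
  obtain ⟨k1, k2, T, hT, k3⟩ := hF'
  refine ⟨fun g => ⟨(h1 g).1.add (k1 g).1, (intPoly E).add_mem (h1 g).2 (k1 g).2⟩,
    fun h hh g => ?_, S ∪ T, hS.union hT, fun g hg => ?_⟩
  · rw [Pi.add_apply, Pi.add_apply, h2 h hh, k2 h hh, symAct_add]
  · by_cases hg0 : F g = 0
    · obtain ⟨s, hs, h⟩ := k3 g fun h0 => hg (by rw [Pi.add_apply, hg0, h0, add_zero])
      exact ⟨s, Or.inr hs, h⟩
    · obtain ⟨s, hs, h⟩ := h3 g hg0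
      exact ⟨s, Or.inl hs, h⟩

/-- The functions `|det| ^ {r/2} u (a z + c) ^ i (b z + d) ^ {r - i}` supported on
`|a z + c| < |b z + d|` belong to the image of the lattice. -/
theorem exists_uniformize_eq [IsUltrametricDist E] {sqrtp : E} (hsqrtp : sqrtp ^ 2 = (p : E))
    {r i : ℕ} (hi : i ≤ r) {a b c d : ℚ_[p]} (hdet : a * d - b * c ≠ 0) {u : E} (hu : ‖u‖ ≤ 1) :
    ∃ F ∈ indLattice p sqrtp r, ∀ z : ℚ_[p], uniformize p sqrtp r F z =
      open Classical in if ‖a * z + c‖ < ‖b * z + d‖ then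
        sqrtp ^ (-((r : ℤ) * (a * d - b * c).valuation)) * u *
          algebraMap ℚ_[p] E (a * z + c) ^ i * algebraMap ℚ_[p] E (b * z + d) ^ (r - i)
      else 0 := by
  classical
  let g : G2 p := Matrix.GeneralLinearGroup.mkOfDetNeZero !![a, b; c, d]
    (by rwa [Matrix.det_fin_two_of])
  have hg : (g : Matrix (Fin 2) (Fin 2) ℚ_[p]) = !![a, b; c, d] := rfl
  let P : MvPolynomial (Fin 2) E :=
    MvPolynomial.C u * (MvPolynomial.X 0 ^ i * MvPolynomial.X 1 ^ (r - i))
  have hr : P.IsHomogeneous r := by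
    have h := (MvPolynomial.isHomogeneous_C (Fin 2) u).mul
      (((MvPolynomial.isHomogeneous_X E (0 : Fin 2)).pow i).mul
        ((MvPolynomial.isHomogeneous_X E (1 : Fin 2)).pow (r - i)))
    have e : 0 + (1 * i + 1 * (r - i)) = r := by omega
    rwa [e] at h
  have hP : P ∈ intPoly E := Subring.mul_mem _ (C_mem_intPoly hu)
    (Subring.mul_mem _ (Subring.pow_mem _ (X_mem_intPoly 0) _)
      (Subring.pow_mem _ (X_mem_intPoly 1) _))
  refine ⟨elemFn sqrtp r g P, elemFn_mem hsqrtp r g hr hP, fun z => ?_⟩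
  have h10 : ((lowerUni p z * g : G2 p) : Matrix (Fin 2) (Fin 2) ℚ_[p]) 1 0 = a * z + c := by
    rw [Units.val_mul, hg, Matrix.mul_apply, Fin.sum_univ_two]
    change z * a + 1 * c = _
    ring
  have h11 : ((lowerUni p z * g : G2 p) : Matrix (Fin 2) (Fin 2) ℚ_[p]) 1 1 = b * z + d := by
    rw [Units.val_mul, hg, Matrix.mul_apply, Fin.sum_univ_two]
    change z * b + 1 * d = _
    ring
  rw [uniformize_elemFn hsqrtp, fId_eq_one_or_zero, h10, h11, eval_symAct, hg,
    Matrix.det_fin_two_of]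
  split_ifs
  · simp [P, Fin.sum_univ_two]
    ring
  · simp

end Induction

/-! ### The two charts of D(k): functions on ℤ_p and functions near infinity. -/

section Embedding

variable {p : ℕ} [Fact p.Prime] {E : Type*} [NormedField E] [NormedAlgebra ℚ_[p] E]

/-- An element of norm at most `1` as a `p`-adic integer. -/
def toInt (z : ℚ_[p]) (h : ‖z‖ ≤ 1) : ℤ_[p] := ⟨z, h⟩

@[simp]
theorem coe_toInt (z : ℚ_[p]) (h : ‖z‖ ≤ 1) : (toInt z h : ℚ_[p]) = z := rfl

/-- Extension by zero of a function on `ℤ_p`. -/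
def extZero (ψ : ℤ_[p] → E) (z : ℚ_[p]) : E :=
  open Classical in if h : ‖z‖ ≤ 1 then ψ (toInt z h) else 0

/-- The function `z ↦ z ^ r * ψ (1 / z)` outside `ℤ_p`, extended by zero. -/
def extInfty (r : ℕ) (ψ : ℤ_[p] → E) (z : ℚ_[p]) : E :=
  open Classical in
  if h : 1 < ‖z‖ then
    algebraMap ℚ_[p] E z ^ r * ψ (toInt z⁻¹ (by rw [norm_inv]; exact inv_le_one_of_one_le₀ h.le))
  else 0

theorem extZero_of_le {ψ : ℤ_[p] → E} {z : ℚ_[p]} (h : ‖z‖ ≤ 1) : extZero ψ z = ψ (toInt z h) := by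
  rw [extZero, dif_pos h]

theorem extZero_of_lt {ψ : ℤ_[p] → E} {z : ℚ_[p]} (h : 1 < ‖z‖) : extZero ψ z = 0 := by
  rw [extZero, dif_neg h.not_ge]

theorem extInfty_of_le {r : ℕ} {ψ : ℤ_[p] → E} {z : ℚ_[p]} (h : ‖z‖ ≤ 1) :
    extInfty r ψ z = 0 := by
  rw [extInfty, dif_neg h.not_gt]

theorem norm_inv_le_one {z : ℚ_[p]} (h : 1 < ‖z‖) : ‖z⁻¹‖ ≤ 1 := by
  rw [norm_inv]
  exact inv_le_one_of_one_le₀ h.le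

theorem extInfty_of_lt {r : ℕ} {ψ : ℤ_[p] → E} {z : ℚ_[p]} (h : 1 < ‖z‖) :
    extInfty r ψ z = algebraMap ℚ_[p] E z ^ r * ψ (toInt z⁻¹ (norm_inv_le_one h)) := by
  rw [extInfty, dif_pos h]

theorem restr_extZero (ψ : ℤ_[p] → E) : restr (extZero ψ) = ψ :=
  funext fun z => extZero_of_le z.2

theorem restr_extInfty (r : ℕ) (ψ : ℤ_[p] → E) : restr (extInfty r ψ) = 0 :=
  funext fun z => extInfty_of_le z.2

theorem norm_lt_one_iff_pow_dvd (z : ℤ_[p]) : ‖z‖ < 1 ↔ (p : ℤ_[p]) ^ 1 ∣ z := by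
  rw [pow_one, PadicInt.norm_lt_one_iff_dvd]

theorem coe_inv_of_norm_eq_one {z : ℤ_[p]} (hz : ‖z‖ = 1) :
    ((z.inv : ℤ_[p]) : ℚ_[p]) = (z : ℚ_[p])⁻¹ := by
  refine eq_inv_of_mul_eq_one_left ?_
  rw [← PadicInt.coe_mul, PadicInt.inv_mul hz, PadicInt.coe_one]

/-- For z in ℤ_p, the inverse 1/z is again in ℤ_p only for units, so a function supported on ℤ_p is
seen at infinity only through its values on units. -/
theorem isExtAtInfty_extZero (r : ℕ) (ψ : ℤ_[p] → E) :
    IsExtAtInfty r (extZero ψ) (unitInv r ψ) := by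
  intro z hz
  rcases (PadicInt.norm_le_one z).lt_or_eq with h | h
  · have h' : 1 < ‖(z : ℚ_[p])⁻¹‖ := by
      rw [norm_inv, ← PadicInt.norm_def]
      exact (one_lt_inv₀ (norm_pos_iff.mpr hz)).mpr h
    rw [unitInv, if_neg h.ne, extZero_of_lt h', mul_zero]
  · have h' : ‖(z : ℚ_[p])⁻¹‖ ≤ 1 := by
      rw [norm_inv, ← PadicInt.norm_def, h, inv_one]
    rw [unitInv, if_pos h, extZero_of_le h']
    congr 2
    exact PadicInt.ext (coe_inv_of_norm_eq_one h)

theorem isExtAtInfty_extInfty (r : ℕ) {ψ : ℤ_[p] → E}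
    (hψ : ∀ z, ¬ (p : ℤ_[p]) ^ 1 ∣ z → ψ z = 0) : IsExtAtInfty r (extInfty r ψ) ψ := by
  intro z hz
  rcases (PadicInt.norm_le_one z).lt_or_eq with h | h
  · have h' : 1 < ‖(z : ℚ_[p])⁻¹‖ := by
      rw [norm_inv, ← PadicInt.norm_def]
      exact (one_lt_inv₀ (norm_pos_iff.mpr hz)).mpr h
    rw [extInfty_of_lt h', ← mul_assoc, ← mul_pow, ← map_mul,
      mul_inv_cancel₀ (mt PadicInt.coe_eq_zero.mp hz), map_one, one_pow, one_mul]
    congr 1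
    exact PadicInt.ext (inv_inv _).symm
  · have h' : ‖(z : ℚ_[p])⁻¹‖ ≤ 1 := by
      rw [norm_inv, ← PadicInt.norm_def, h, inv_one]
    rw [extInfty_of_le h', mul_zero]
    exact hψ z fun h1 => h.not_lt ((norm_lt_one_iff_pow_dvd z).mpr h1)

theorem half_pos_of_pos {r : ℕ} (hr : 0 < r) : (0 : ℝ) < (r : ℝ) / 2 := by positivity

theorem half_le_self' (r : ℕ) : (r : ℝ) / 2 ≤ r := by
  have : (0 : ℝ) ≤ r := Nat.cast_nonneg r
  linarith

theorem extZero_mem_DSub [IsUltrametricDist E] {r : ℕ} (hr : 0 < r) {ψ : ℤ_[p] → E} {C : ℝ} (h : CsBound ((r : ℝ) / 2) ψ C) :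
    extZero ψ ∈ DSub p E r :=
  ⟨by
    rw [restr_extZero]
    exact h.isCs (half_pos_of_pos hr).le,
  unitInv r ψ, isExtAtInfty_extZero r ψ,
    (h.unitInv (half_pos_of_pos hr) (half_le_self' r)).isCs (half_pos_of_pos hr).le⟩

theorem dNorm_extZero_le [IsUltrametricDist E] {r : ℕ} (hr : 0 < r) {ψ : ℤ_[p] → E} {C : ℝ} (h : CsBound ((r : ℝ) / 2) ψ C)
    {d : DSpace p E r} (hd : d.toFun = extZero ψ) : dNorm d ≤ ENNReal.ofReal C := by
  rw [dNorm, hd, restr_extZero]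
  exact sup_le (h.csNorm_le (half_pos_of_pos hr).le)
    (iInf₂_le_of_le _ (isExtAtInfty_extZero r ψ)
      ((h.unitInv (half_pos_of_pos hr) (half_le_self' r)).csNorm_le (half_pos_of_pos hr).le))

theorem extInfty_mem_DSub {r : ℕ} (hr : 0 < r) {ψ : ℤ_[p] → E} {C : ℝ} (h : CsBound ((r : ℝ) / 2) ψ C)
    (hψ : ∀ z, ¬ (p : ℤ_[p]) ^ 1 ∣ z → ψ z = 0) : extInfty r ψ ∈ DSub p E r :=
  ⟨by
    rw [restr_extInfty]
    exact (CsBound.zero _ le_rfl).isCs (half_pos_of_pos hr).le,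
  ψ, isExtAtInfty_extInfty r hψ, h.isCs (half_pos_of_pos hr).le⟩

theorem dNorm_extInfty_le {r : ℕ} (hr : 0 < r) {ψ : ℤ_[p] → E} {C : ℝ} (h : CsBound ((r : ℝ) / 2) ψ C)
    (hψ : ∀ z, ¬ (p : ℤ_[p]) ^ 1 ∣ z → ψ z = 0)
    {d : DSpace p E r} (hd : d.toFun = extInfty r ψ) : dNorm d ≤ ENNReal.ofReal C := by
  rw [dNorm, hd, restr_extInfty]
  refine sup_le ?_ (iInf₂_le_of_le _ (isExtAtInfty_extInfty r hψ)
    (h.csNorm_le (half_pos_of_pos hr).le))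
  exact (csNorm_zero _).le.trans bot_le

end Embedding

/-! ### A closed lattice of D(k) lying over Θ, and the monomials on balls it contains. -/

section Lift

variable {p : ℕ} [Fact p.Prime] {E : Type*} [NormedField E] [NormedAlgebra ℚ_[p] E]

variable (p E) in
/-- Extension by zero as a linear map. -/
def extZeroL : (ℤ_[p] → E) →ₗ[E] (ℚ_[p] → E) where
  toFun := extZero
  map_add' f g := by
    ext z
    by_cases h : ‖z‖ ≤ 1
    · simp [extZero_of_le h]
    · simp [extZero_of_lt (not_le.mp h)]
  map_smul' c f := by
    ext z
    by_cases h : ‖z‖ ≤ 1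
    · simp [extZero_of_le h]
    · simp [extZero_of_lt (not_le.mp h)]

variable (p E) in
/-- `extInfty` as a linear map. -/
def extInftyL (r : ℕ) : (ℤ_[p] → E) →ₗ[E] (ℚ_[p] → E) where
  toFun := extInfty r
  map_add' f g := by
    ext z
    by_cases h : ‖z‖ ≤ 1
    · simp [extInfty_of_le h]
    · simp [extInfty_of_lt (not_le.mp h), mul_add]
  map_smul' c f := by
    ext z
    by_cases h : ‖z‖ ≤ 1
    · simp [extInfty_of_le h]
    · simp [extInfty_of_lt (not_le.mp h)]
      ring

/-- The elements of `D(k)` in the image of the compact induction of the integral polynomials. -/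
def thetaImage (sqrtp : E) (r : ℕ) : Set (DSpace p E r) :=
  {u | ∃ F ∈ indLattice p sqrtp r, u.toFun = uniformize p sqrtp r F}

/-- A closed lattice of `D(k)` whose image in `B_{k,𝓛}` is contained in `Θ_{k,𝓛}`. -/
def thetaLift (sqrtp : E) (r : ℕ) (L : E) : Set (DSpace p E r) :=
  closure {d | ∃ u ∈ thetaImage sqrtp r, ∃ l ∈ LSub p E r L, d = u + l}

/-- The quotient map is continuous and kills L(k,𝓛), so a closure taken in D(k) maps into the
closure defining Θ. All approximations can thus be made with functions rather than classes. -/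
theorem toB_mem_latticeTheta {sqrtp : E} {r : ℕ} {L : E} {d : DSpace p E r}
    (hd : d ∈ thetaLift sqrtp r L) : toB L d ∈ latticeTheta p sqrtp r L := by
  have hcont : Continuous (toB L : DSpace p E r → BSpace p E r L) := continuous_quot_mk
  refine map_mem_closure hcont hd ?_
  rintro _ ⟨u, ⟨F, hF, hu⟩, l, hl, rfl⟩
  refine ⟨F, hF, u, hu, ?_⟩
  refine (Submodule.Quotient.eq _).mpr ?_
  rw [sub_add_cancel_left]
  exact Submodule.neg_mem _ (Submodule.le_topologicalClosure _ hl)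

theorem mem_thetaLift_of_add {sqrtp : E} {r : ℕ} {L : E} {u l : DSpace p E r}
    (hu : u ∈ thetaImage sqrtp r) (hl : l ∈ LSub p E r L) : u + l ∈ thetaLift sqrtp r L :=
  subset_closure ⟨u, hu, l, hl, rfl⟩

theorem toFun_add {r : ℕ} (f g : DSpace p E r) : (f + g).toFun = f.toFun + g.toFun := rfl

theorem toFun_sub {r : ℕ} (f g : DSpace p E r) : (f - g).toFun = f.toFun - g.toFun := rfl

theorem toFun_smul {r : ℕ} (c : E) (f : DSpace p E r) : (c • f).toFun = c • f.toFun := rfl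

theorem toFun_zero {r : ℕ} : (0 : DSpace p E r).toFun = 0 := rfl

theorem exists_toFun_eq {r : ℕ} {φ : ℚ_[p] → E} (h : φ ∈ DSub p E r) :
    ∃ d : DSpace p E r, d.toFun = φ := ⟨⟨φ, h⟩, rfl⟩

theorem thetaImage_zero_mem (sqrtp : E) (r : ℕ) : (0 : DSpace p E r) ∈ thetaImage sqrtp r := by
  refine ⟨0, indLattice_zero_mem _ _, ?_⟩
  ext z
  simp [uniformize, toFun_zero, symAct_zero]

theorem thetaImage_smul_mem {sqrtp : E} {r : ℕ} {c : E} (hc : ‖c‖ ≤ 1) {u : DSpace p E r}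
    (hu : u ∈ thetaImage sqrtp r) : c • u ∈ thetaImage sqrtp r := by
  obtain ⟨F, hF, hu⟩ := hu
  exact ⟨c • F, indLattice_smul_mem hc hF, by rw [toFun_smul, hu, uniformize_smul]⟩

theorem thetaLift_zero_mem (sqrtp : E) (r : ℕ) (L : E) :
    (0 : DSpace p E r) ∈ thetaLift sqrtp r L := by
  simpa using mem_thetaLift_of_add (L := L) (thetaImage_zero_mem sqrtp r) (Submodule.zero_mem _)

theorem thetaLift_smul_mem {sqrtp : E} {r : ℕ} {L : E} {c : E} (hc : ‖c‖ ≤ 1) {d : DSpace p E r}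
    (hd : d ∈ thetaLift sqrtp r L) : c • d ∈ thetaLift sqrtp r L := by
  refine map_mem_closure (continuous_const_smul c) hd ?_
  rintro _ ⟨u, hu, l, hl, rfl⟩
  exact ⟨c • u, thetaImage_smul_mem hc hu, c • l, Submodule.smul_mem _ c hl, smul_add _ _ _⟩

theorem exists_LSub_eval {r : ℕ} (L : E) {d : DSpace p E r} {P : Polynomial E}
    (hP : P.natDegree ≤ r) (hd : ∀ z : ℚ_[p], d.toFun z = P.eval (algebraMap ℚ_[p] E z)) :
    d ∈ LSub p E r L :=
  Submodule.subset_span (Or.inl ⟨P, hP, hd⟩)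

theorem norm_sqrtp_zpow_mul {sqrtp : E} (hsqrtp : sqrtp ^ 2 = (p : E)) {r j : ℕ} (hj : j ≤ r)
    (k : ℤ) : ‖sqrtp ^ (-((r : ℤ) * k)) * algebraMap ℚ_[p] E ((p : ℚ_[p]) ^ k) ^ (r - j)‖ =
      (p : ℝ) ^ (-(k * ((r : ℝ) / 2 - j))) := by
  rw [norm_mul, norm_pow, norm_algebraMap', norm_zpow, norm_zpow, norm_sqrtp hsqrtp, Padic.norm_p,
    ← Real.rpow_neg_one, ← Real.rpow_intCast, ← Real.rpow_intCast, ← Real.rpow_natCast,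
    ← Real.rpow_mul prime_pos.le, ← Real.rpow_mul prime_pos.le, ← Real.rpow_mul prime_pos.le,
    ← Real.rpow_add prime_pos]
  push_cast [hj]
  ring_nf

variable [IsUltrametricDist E]

theorem thetaLift_add_mem {sqrtp : E} {r : ℕ} {L : E} {d d' : DSpace p E r}
    (hd : d ∈ thetaLift sqrtp r L) (hd' : d' ∈ thetaLift sqrtp r L) :
    d + d' ∈ thetaLift sqrtp r L := by
  refine map_mem_closure₂ continuous_add hd hd' ?_
  rintro _ ⟨u, ⟨F, hF, hu⟩, l, hl, rfl⟩ _ ⟨u', ⟨F', hF', hu'⟩, l', hl', rfl⟩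
  refine ⟨u + u', ⟨F + F', indLattice_add_mem hF hF', ?_⟩, l + l', Submodule.add_mem _ hl hl',
    by abel⟩
  rw [toFun_add, hu, hu', uniformize_add hF hF']

/-- This treats both charts at once. The map J does not increase norms (`hJn`), so approximation in
C^{r/2} gives approximation in D(k), where the lattice is closed. -/
theorem isCsLattice_preimage {r : ℕ} (sqrtp : E) (L : E)
    (J : (ℤ_[p] → E) →ₗ[E] (ℚ_[p] → E)) (h₀ : ℕ)
    (hJ : ∀ {ψ C}, CsBound ((r : ℝ) / 2) ψ C → (∀ z, ¬ (p : ℤ_[p]) ^ h₀ ∣ z → ψ z = 0) →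
      J ψ ∈ DSub p E r)
    (hJn : ∀ {ψ C}, CsBound ((r : ℝ) / 2) ψ C → (∀ z, ¬ (p : ℤ_[p]) ^ h₀ ∣ z → ψ z = 0) →
      ∀ {d : DSpace p E r}, d.toFun = J ψ → dNorm d ≤ ENNReal.ofReal C) :
    IsCsLattice ((r : ℝ) / 2) h₀ {ψ | (∀ z, ¬ (p : ℤ_[p]) ^ h₀ ∣ z → ψ z = 0) ∧
      ∃ d ∈ thetaLift sqrtp r L, d.toFun = J ψ} where
  zero_mem := ⟨fun _ _ => rfl, 0, thetaLift_zero_mem _ _ _, by rw [map_zero]; rfl⟩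
  add_mem := by
    rintro f g ⟨hf, d, hd, hdf⟩ ⟨hg, e, he, heg⟩
    exact ⟨fun z hz => by rw [Pi.add_apply, hf z hz, hg z hz, add_zero], d + e,
      thetaLift_add_mem hd he, by rw [toFun_add, hdf, heg, map_add]⟩
  smul_mem := by
    rintro f c hc ⟨hf, d, hd, hdf⟩
    exact ⟨fun z hz => by rw [Pi.smul_apply, hf z hz, smul_zero], c • d,
      thetaLift_smul_mem hc hd, by rw [toFun_smul, hdf, map_smul]⟩
  supp := fun hf => hf.1
  closed := by
    intro f C hf hsupp happ
    obtain ⟨d, hd⟩ := exists_toFun_eq (hJ hf hsupp)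
    refine ⟨hsupp, d, ?_, hd⟩
    rw [thetaLift, ← closure_closure]
    refine EMetric.mem_closure_iff.mpr fun ε hε => ?_
    obtain ⟨δ, hδ, hδε⟩ := ENNReal.lt_iff_exists_nnreal_btwn.mp hε
    obtain ⟨g, ⟨hg, e, he, heg⟩, hb⟩ := happ δ (by exact_mod_cast hδ)
    refine ⟨e, he, lt_of_le_of_lt ?_ hδε⟩
    rw [edist_def]
    refine (hJn hb (fun z hz => ?_) ?_).trans ?_
    · rw [Pi.sub_apply, hsupp z hz, hg z hz, sub_zero]
    · rw [toFun_sub, hd, heg, map_sub]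
    · simp

/-- The functions on `ℤ_p` whose extension by zero lies in the lattice `thetaLift`. -/
def latZero (sqrtp : E) (r : ℕ) (L : E) : Set (ℤ_[p] → E) :=
  {ψ | (∀ z, ¬ (p : ℤ_[p]) ^ 0 ∣ z → ψ z = 0) ∧
      ∃ d ∈ thetaLift sqrtp r L, d.toFun = extZeroL p E ψ}

/-- The functions on `p ℤ_p` which, seen as functions near infinity, lie in the lattice
`thetaLift`. -/
def latInfty (sqrtp : E) (r : ℕ) (L : E) : Set (ℤ_[p] → E) :=
  {ψ | (∀ z, ¬ (p : ℤ_[p]) ^ 1 ∣ z → ψ z = 0) ∧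
      ∃ d ∈ thetaLift sqrtp r L, d.toFun = extInftyL p E r ψ}

theorem isCsLattice_latZero {r : ℕ} (hr : 0 < r) (sqrtp L : E) :
    IsCsLattice ((r : ℝ) / 2) 0 (latZero sqrtp r L : Set (ℤ_[p] → E)) :=
  isCsLattice_preimage sqrtp L (extZeroL p E) 0 (fun h _ => extZero_mem_DSub hr h)
    (fun h _ _ hd => dNorm_extZero_le hr h hd)

theorem isCsLattice_latInfty {r : ℕ} (hr : 0 < r) (sqrtp L : E) :
    IsCsLattice ((r : ℝ) / 2) 1 (latInfty sqrtp r L : Set (ℤ_[p] → E)) :=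
  isCsLattice_preimage sqrtp L (extInftyL p E r) 1 (fun h hs => extInfty_mem_DSub hr h hs)
    (fun h hs _ hd => dNorm_extInfty_le hr h hs hd)

theorem norm_lt_zpow_iff_dvd (x : ℤ_[p]) (h : ℕ) :
    ‖(x : ℚ_[p])‖ < (p : ℝ) ^ (1 - (h : ℤ)) ↔ (p : ℤ_[p]) ^ h ∣ x := by
  rw [← Ideal.mem_span_singleton, ← PadicInt.norm_le_pow_iff_mem_span_pow,
    PadicInt.norm_le_pow_iff_norm_lt_pow_add_one, ← PadicInt.norm_def]
  ring_nf

theorem norm_le_one_of_lt_zpow {x : ℚ_[p]} {h : ℕ} (hx : ‖x‖ < (p : ℝ) ^ (1 - (h : ℤ))) :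
    ‖x‖ ≤ 1 := by
  have h1 : ‖x‖ ≤ (p : ℝ) ^ (-(h : ℤ)) := by
    rw [Padic.norm_le_pow_iff_norm_lt_pow_add_one]
    convert hx using 2
    ring
  exact h1.trans (zpow_le_one_of_nonpos₀ one_lt_prime.le (by simp))

theorem norm_prime_zpow (k : ℤ) : ‖(p : ℚ_[p]) ^ k‖ = (p : ℝ) ^ (-k) := by
  rw [norm_zpow, Padic.norm_p, inv_zpow, zpow_neg]

theorem valuation_prime_zpow (k : ℤ) : ((p : ℚ_[p]) ^ k).valuation = k := by
  rw [Padic.valuation_zpow, Padic.valuation_p, mul_one]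

theorem prime_zpow_ne_zero (k : ℤ) : (p : ℚ_[p]) ^ k ≠ 0 :=
  zpow_ne_zero k (by exact_mod_cast (Fact.out : p.Prime).ne_zero)

theorem valuation_neg' {x : ℚ_[p]} (hx : x ≠ 0) : (-x).valuation = x.valuation := by
  have h : ‖-x‖ = ‖x‖ := norm_neg x
  rw [Padic.norm_eq_zpow_neg_valuation hx,
    Padic.norm_eq_zpow_neg_valuation (neg_ne_zero.mpr hx)] at h
  have := (zpow_right_inj₀ prime_pos one_lt_prime.ne').mp h
  omega

/-- A scalar of the size allowed by the normalization of the monomials is an integral multiple of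
the normalizing scalar. -/
theorem exists_eq_mul_of_norm_le {sqrtp : E} (hsqrtp : sqrtp ^ 2 = (p : E)) {r j : ℕ} (hj : j ≤ r)
    {k : ℤ} {c : E} (hc : ‖c‖ ≤ (p : ℝ) ^ (-(k * ((r : ℝ) / 2 - j)))) :
    ∃ u : E, ‖u‖ ≤ 1 ∧
      sqrtp ^ (-((r : ℤ) * k)) * u * algebraMap ℚ_[p] E ((p : ℚ_[p]) ^ k) ^ (r - j) = c := by
  set T := sqrtp ^ (-((r : ℤ) * k)) * algebraMap ℚ_[p] E ((p : ℚ_[p]) ^ k) ^ (r - j) with hT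
  have hTn := norm_sqrtp_zpow_mul hsqrtp hj k
  rw [← hT] at hTn
  have hTpos : 0 < ‖T‖ := hTn ▸ Real.rpow_pos_of_pos prime_pos _
  have hT0 : T ≠ 0 := norm_pos_iff.mp hTpos
  refine ⟨c / T, ?_, ?_⟩
  · rw [norm_div, div_le_one hTpos, hTn]
    exact hc
  · calc _ = T * (c / T) := by rw [hT]; ring
      _ = c := mul_div_cancel₀ c hT0

/-- The matrix with rows (1, 0) and (-α, p^{h-1}) yields (z-α)^j p^{(h-1)(r-j)} on |z-α| < p^{1-h},
which is the ball α+p^h ℤ_p. The strict inequality explains the shift from h to h-1. With the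
determinant twist the scalar has valuation (h-1)(r/2-j). -/
theorem smul_ballMono_mem_latZero {sqrtp : E} (hsqrtp : sqrtp ^ 2 = (p : E)) {r j : ℕ}
    (hr : 0 < r) (hj : j ≤ r) (L : E) (α : ℤ_[p]) {h : ℕ} {c : E}
    (hc : ‖c‖ ≤ (p : ℝ) ^ (-(((h : ℝ) - 1) * ((r : ℝ) / 2 - j)))) :
    c • ballMono E j α h ∈ latZero sqrtp r L := by
  classical
  refine ⟨fun z hz => absurd (by simp) hz, ?_⟩
  obtain ⟨u, hu, huc⟩ := exists_eq_mul_of_norm_le (k := (h : ℤ) - 1) hsqrtp hj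
    (by push_cast; exact hc)
  obtain ⟨F, hF, hFz⟩ := exists_uniformize_eq (p := p) hsqrtp hj (a := 1) (b := 0)
    (c := -(α : ℚ_[p])) (d := (p : ℚ_[p]) ^ ((h : ℤ) - 1))
    (by simpa using prime_zpow_ne_zero ((h : ℤ) - 1)) hu
  obtain ⟨d, hd⟩ := exists_toFun_eq (extZero_mem_DSub hr
    ((CsBound.ballMono (E := E) (half_pos_of_pos hr) j α h).smul c))
  refine ⟨d, ?_, hd⟩
  rw [← add_zero d]
  refine mem_thetaLift_of_add ⟨F, hF, ?_⟩ (Submodule.zero_mem _)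
  rw [hd]
  ext z
  rw [hFz, one_mul, zero_mul, zero_add, ← sub_eq_add_neg, norm_prime_zpow, neg_sub, zero_mul,
    sub_zero, one_mul, valuation_prime_zpow]
  rcases le_or_gt ‖z‖ 1 with hz | hz
  · have := norm_lt_zpow_iff_dvd (toInt z hz - α) h
    rw [PadicInt.coe_sub, coe_toInt] at this
    rw [extZero_of_le hz, Pi.smul_apply, ballMono_apply]
    by_cases hdvd : (p : ℤ_[p]) ^ h ∣ toInt z hz - α
    · rw [if_pos hdvd, if_pos (this.mpr hdvd), ← huc, emb_apply, PadicInt.coe_sub, coe_toInt, smul_eq_mul]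
      ring
    · rw [if_neg hdvd, if_neg (mt this.mp hdvd), smul_zero]
  · rw [extZero_of_lt hz, if_neg]
    intro hlt
    have h1 := norm_le_one_of_lt_zpow hlt
    refine hz.not_ge ?_
    have : z = (z - α) + α := by ring
    rw [this]
    exact (IsUltrametricDist.norm_add_le_max _ _).trans (max_le h1 (PadicInt.norm_le_one α))

/-- The matrix with rows (-α, p^{h-1}) and (1, 0) is supported on |1-αz| < |p^{h-1}z|. For |z| > 1
this means that 1/z lies in α+p^h ℤ_p. No z in ℤ_p satisfies it, since p divides α and h ≥ 1. -/
theorem smul_ballMono_mem_latInfty {sqrtp : E} (hsqrtp : sqrtp ^ 2 = (p : E)) {r j : ℕ}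
    (hr : 0 < r) (hj : j ≤ r) (L : E) {α : ℤ_[p]} {h : ℕ} {c : E} (hh : 1 ≤ h)
    (hα : (p : ℤ_[p]) ^ 1 ∣ α)
    (hc : ‖c‖ ≤ (p : ℝ) ^ (-(((h : ℝ) - 1) * ((r : ℝ) / 2 - j)))) :
    c • ballMono E j α h ∈ latInfty sqrtp r L := by
  classical
  have hsupp : ∀ z, ¬ (p : ℤ_[p]) ^ 1 ∣ z → (c • ballMono E j α h) z = 0 := fun z hz => by
    rw [Pi.smul_apply, ballMono_supp hh hα z hz, smul_zero]
  refine ⟨hsupp, ?_⟩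
  obtain ⟨u, hu, huc⟩ := exists_eq_mul_of_norm_le (k := (h : ℤ) - 1) hsqrtp hj
    (by push_cast; exact hc)
  obtain ⟨F, hF, hFz⟩ := exists_uniformize_eq (p := p) hsqrtp hj (a := -(α : ℚ_[p]))
    (b := (p : ℚ_[p]) ^ ((h : ℤ) - 1)) (c := 1) (d := 0)
    (by simpa using prime_zpow_ne_zero ((h : ℤ) - 1)) hu
  obtain ⟨d, hd⟩ := exists_toFun_eq (extInfty_mem_DSub hr
    ((CsBound.ballMono (E := E) (half_pos_of_pos hr) j α h).smul c) hsupp)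
  refine ⟨d, ?_, hd⟩
  rw [← add_zero d]
  refine mem_thetaLift_of_add ⟨F, hF, ?_⟩ (Submodule.zero_mem _)
  rw [hd]
  ext z
  have hα1 : ‖(α : ℚ_[p])‖ < 1 := by
    rw [← PadicInt.norm_def]
    exact (norm_lt_one_iff_pow_dvd α).mpr hα
  rw [hFz, mul_zero, mul_one, zero_sub, add_zero, valuation_neg' (prime_zpow_ne_zero _),
    valuation_prime_zpow, norm_mul, norm_prime_zpow, neg_sub]
  rcases le_or_gt ‖z‖ 1 with hz | hz
  · rw [extInfty_of_le hz, if_neg]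
    have h1 : ‖-(α : ℚ_[p]) * z‖ < 1 := by
      rw [norm_mul, norm_neg]
      exact mul_lt_one_of_nonneg_of_lt_one_left (norm_nonneg _) hα1 hz
    have h2 : ‖-(α : ℚ_[p]) * z + 1‖ = 1 := by
      rw [IsUltrametricDist.norm_add_eq_max_of_norm_ne_norm (by rw [norm_one]; exact h1.ne),
        norm_one]
      exact max_eq_right h1.le
    rw [h2, not_lt]
    exact mul_le_one₀ (zpow_le_one_of_nonpos₀ one_lt_prime.le (by omega)) (norm_nonneg _) hz
  · have hz0 : z ≠ 0 := norm_pos_iff.mp (one_pos.trans hz)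
    have hzE : algebraMap ℚ_[p] E z ≠ 0 := (map_ne_zero _).mpr hz0
    have hzpos : 0 < ‖z‖ := one_pos.trans hz
    have e1 : -(α : ℚ_[p]) * z + 1 = (z⁻¹ - α) * z := by field_simp; ring
    have := norm_lt_zpow_iff_dvd (toInt z⁻¹ (norm_inv_le_one hz) - α) h
    rw [PadicInt.coe_sub, coe_toInt] at this
    rw [extInfty_of_lt hz, Pi.smul_apply, ballMono_apply, e1, norm_mul]
    replace this := (mul_lt_mul_iff_left₀ hzpos).trans this
    by_cases hdvd : (p : ℤ_[p]) ^ h ∣ toInt z⁻¹ (norm_inv_le_one hz) - α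
    · rw [if_pos hdvd, if_pos (this.mpr hdvd), ← huc, emb_apply, PadicInt.coe_sub, coe_toInt, smul_eq_mul,
        map_mul, map_mul, mul_pow, mul_pow]
      have : algebraMap ℚ_[p] E z ^ r = algebraMap ℚ_[p] E z ^ (r - j) * algebraMap ℚ_[p] E z ^ j := by
        rw [← pow_add, Nat.sub_add_cancel hj]
      rw [this]
      ring
    · rw [if_neg hdvd, if_neg (mt this.mp hdvd), smul_zero, mul_zero]

/-- In the coordinate w = 1/z at infinity, z^j becomes w^{r-j}; both charts then show a monomial on
a ball. -/
theorem pow_mem_DSub {r j : ℕ} (hr : 0 < r) (hj : j ≤ r) :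
    (fun z => algebraMap ℚ_[p] E z ^ j) ∈ DSub p E r := by
  have h1 := extZero_mem_DSub hr (CsBound.ballMono (p := p) (E := E) (half_pos_of_pos hr) j 0 0)
  have h2 := extInfty_mem_DSub hr
    (CsBound.ballMono (p := p) (E := E) (half_pos_of_pos hr) (r - j) 0 1)
    (ballMono_supp le_rfl (dvd_zero _))
  convert Submodule.add_mem _ h1 h2 using 1
  ext z
  rw [Pi.add_apply]
  rcases le_or_gt ‖z‖ 1 with hz | hz
  · rw [extInfty_of_le hz, add_zero, extZero_of_le hz, ballMono_of_dvd (by simp), sub_zero,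
      emb_apply, coe_toInt]
  · have hz0 : z ≠ 0 := norm_pos_iff.mp (one_pos.trans hz)
    have hzE : algebraMap ℚ_[p] E z ≠ 0 := (map_ne_zero _).mpr hz0
    rw [extZero_of_lt hz, zero_add, extInfty_of_lt hz, ballMono_of_dvd, sub_zero, emb_apply,
      coe_toInt, map_inv₀, inv_pow]
    · rw [eq_mul_inv_iff_mul_eq₀ (pow_ne_zero _ hzE), ← pow_add, Nat.add_sub_cancel' hj]
    · rw [sub_zero, ← norm_lt_one_iff_pow_dvd, PadicInt.norm_def,
        coe_toInt, norm_inv]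
      exact inv_lt_one_of_one_lt₀ hz

theorem eval_mem_DSub {r : ℕ} (hr : 0 < r) {P : Polynomial E} (hP : P.natDegree ≤ r) :
    (fun z => P.eval (algebraMap ℚ_[p] E z)) ∈ DSub p E r := by
  have : (fun z => P.eval (algebraMap ℚ_[p] E z)) =
      ∑ j ∈ range (r + 1), P.coeff j • fun z => algebraMap ℚ_[p] E z ^ j := by
    ext z
    simp [Polynomial.eval_eq_sum_range' (Nat.lt_succ_iff.mpr hP)]
  rw [this]
  exact Submodule.sum_mem _ fun j hj => Submodule.smul_mem _ _
    (pow_mem_DSub hr (Nat.lt_succ_iff.mp (mem_range.mp hj)))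

/-- Modulo the polynomials of degree at most `r`, a monomial on a ball is the opposite of the same
monomial on the complement; this improves the normalization for large degrees. -/
theorem smul_ballMono_mem_latZero' {sqrtp : E} (hsqrtp : sqrtp ^ 2 = (p : E)) {r j : ℕ}
    (hr : 0 < r) (hj : j ≤ r) (L : E) (α : ℤ_[p]) {h : ℕ} {c : E}
    (hc : ‖c‖ ≤ (p : ℝ) ^ (-((h : ℝ) * ((r : ℝ) / 2 - j)))) :
    c • ballMono E j α h ∈ latZero sqrtp r L := by
  classical
  refine ⟨fun z hz => absurd (by simp) hz, ?_⟩
  -- The scalar is taken for -c, because the function on the ball minus the global polynomial is -c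
  -- (z-α)^j on the complement.
  rw [← norm_neg] at hc
  obtain ⟨u, hu, huc⟩ := exists_eq_mul_of_norm_le (k := (h : ℤ)) hsqrtp hj (by push_cast; exact hc)
  -- The support condition is |p^h| < |z-α|, which is exactly the complement of the ball; the power
  -- of z-α is now the exponent of Y, hence i = r-j.
  obtain ⟨F, hF, hFz⟩ := exists_uniformize_eq (p := p) hsqrtp (i := r - j) (Nat.sub_le r j)
    (a := 0) (b := 1) (c := (p : ℚ_[p]) ^ (h : ℤ)) (d := -(α : ℚ_[p]))
    (by simpa using prime_zpow_ne_zero (p := p) (h : ℤ)) hu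
  obtain ⟨d, hd⟩ := exists_toFun_eq (extZero_mem_DSub hr
    ((CsBound.ballMono (E := E) (half_pos_of_pos hr) j α h).smul c))
  let P : Polynomial E := Polynomial.C c * (Polynomial.X - Polynomial.C (emb p E α)) ^ j
  have hP : P.natDegree ≤ r := by
    refine (Polynomial.natDegree_C_mul_le _ _).trans ?_
    rw [Polynomial.natDegree_pow, Polynomial.natDegree_X_sub_C, mul_one]
    exact hj
  obtain ⟨l, hl⟩ := exists_toFun_eq (eval_mem_DSub (p := p) hr hP)
  refine ⟨d, ?_, hd⟩
  rw [← sub_add_cancel d l]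
  refine mem_thetaLift_of_add ⟨F, hF, ?_⟩ (exists_LSub_eval L hP fun z => by rw [hl])
  rw [toFun_sub, hd, hl]
  ext z
  have hPz : P.eval (algebraMap ℚ_[p] E z) = c * algebraMap ℚ_[p] E (z - α) ^ j := by
    simp [P, emb_apply]
  rw [hFz, zero_mul, zero_add, one_mul, zero_mul, zero_sub, one_mul,
    valuation_neg' (prime_zpow_ne_zero _), valuation_prime_zpow, Nat.sub_sub_self hj,
    ← sub_eq_add_neg, norm_prime_zpow, Pi.sub_apply, hPz]
  have hlt : ‖z - α‖ < (p : ℝ) ^ (1 - (h : ℤ)) ↔ ¬ (p : ℝ) ^ (-(h : ℤ)) < ‖z - α‖ := by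
    rw [not_lt, Padic.norm_le_pow_iff_norm_lt_pow_add_one]
    ring_nf
  rcases le_or_gt ‖z‖ 1 with hz | hz
  · have := norm_lt_zpow_iff_dvd (toInt z hz - α) h
    rw [PadicInt.coe_sub, coe_toInt] at this
    rw [extZero_of_le hz, Pi.smul_apply, ballMono_apply]
    by_cases hdvd : (p : ℤ_[p]) ^ h ∣ toInt z hz - α
    · rw [if_pos hdvd, if_neg (hlt.mp (this.mpr hdvd)), emb_apply, PadicInt.coe_sub, coe_toInt, smul_eq_mul]
      exact sub_self _
    · rw [if_neg hdvd, if_pos (not_not.mp (mt hlt.mpr (mt this.mp hdvd))), huc, smul_zero]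
      ring
  · rw [extZero_of_lt hz, if_pos, huc]
    · ring
    · by_contra h1
      have h2 := norm_le_one_of_lt_zpow (hlt.mpr h1)
      refine hz.not_ge ?_
      have : z = (z - α) + α := by ring
      rw [this]
      exact (IsUltrametricDist.norm_add_le_max _ _).trans (max_le h2 (PadicInt.norm_le_one α))

end Lift

/-! ### From strict inequalities to π times the lattice. -/

section Strict

variable {p : ℕ} [Fact p.Prime] {E : Type*} [NormedField E] [NormedAlgebra ℚ_[p] E]

theorem IsUniformizer.norm_pos (p : ℕ) [Fact p.Prime] {E : Type*} [NormedField E]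
    [NormedAlgebra ℚ_[p] E] {π : E} (hπ : IsUniformizer π) : 0 < ‖π‖ := by
  have h1 : ‖(p : E)‖ < 1 := by
    rw [norm_prime_field (p := p)]
    exact inv_lt_one_of_one_lt₀ one_lt_prime
  exact (norm_pos_iff.mpr (prime_ne_zero_field (p := p))).trans_le (hπ.2 _ h1)

/-- A bound for the norm that is strict can be improved by a uniformizer. -/
theorem IsUniformizer.norm_inv_mul_le {π : E} (hπ : IsUniformizer π) {sqrtp : E}
    (hsqrtp : sqrtp ^ 2 = (p : E)) {c : E} {e : ℝ} (m : ℤ) (he : e = -((m : ℝ) / 2))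
    (hc : ‖c‖ < (p : ℝ) ^ e) : ‖π⁻¹ * c‖ ≤ (p : ℝ) ^ e := by
  have hπ0 := hπ.norm_pos p
  have ht : ‖sqrtp ^ m‖ = (p : ℝ) ^ e := by
    rw [norm_zpow, norm_sqrtp hsqrtp, ← Real.rpow_intCast, ← Real.rpow_mul prime_pos.le, he]
    ring_nf
  have hpos : 0 < (p : ℝ) ^ e := Real.rpow_pos_of_pos prime_pos _
  -- The bound p^e has a half-integral exponent, so it is attained by a power of √p. The quotient
  -- then has norm less than 1, hence at most ‖π‖.
  have h1 : ‖c / sqrtp ^ m‖ ≤ ‖π‖ := hπ.2 _ (by rwa [norm_div, ht, div_lt_one hpos])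
  rw [norm_div, ht, div_le_iff₀ hpos] at h1
  rw [norm_mul, norm_inv, inv_mul_le_iff₀ hπ0]
  exact h1

/-- The product of a lattice and of `π`. -/
def scaleLat (π : E) (K : Set (ℤ_[p] → E)) : Set (ℤ_[p] → E) := {f | π⁻¹ • f ∈ K}

theorem IsCsLattice.scaleLat {π : E} (hπ : π ≠ 0) {s : ℝ} {h₀ : ℕ} {K : Set (ℤ_[p] → E)}
    (hK : IsCsLattice s h₀ K) : IsCsLattice s h₀ (scaleLat π K) where
  zero_mem := by
    change π⁻¹ • 0 ∈ K
    rw [smul_zero]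
    exact hK.zero_mem
  add_mem := by
    intro f g hf hg
    change π⁻¹ • (f + g) ∈ K
    rw [smul_add]
    exact hK.add_mem hf hg
  smul_mem := by
    intro f c hc hf
    change π⁻¹ • c • f ∈ K
    rw [smul_comm]
    exact hK.smul_mem hc hf
  supp := by
    intro f hf z hz
    have := hK.supp hf z hz
    rw [Pi.smul_apply, smul_eq_mul] at this
    exact (mul_eq_zero.mp this).resolve_left (inv_ne_zero hπ)
  closed := by
    intro f C hf hs happ
    refine hK.closed (hf.smul π⁻¹) (fun z hz => by rw [Pi.smul_apply, hs z hz, smul_zero])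
      fun ε hε => ?_
    have hπ' : 0 < ‖π‖ := norm_pos_iff.mpr hπ
    obtain ⟨g, hg, hb⟩ := happ (‖π‖ * ε) (by positivity)
    refine ⟨π⁻¹ • g, hg, ?_⟩
    rw [← smul_sub]
    refine (hb.smul π⁻¹).mono (le_of_eq ?_)
    rw [norm_inv, inv_mul_cancel_left₀ hπ'.ne']

variable (p) in
/-- The condition on the scalar `c` under which `c` times the monomial of degree `j` on a ball of
radius `p ^ (-h)` lies in `π` times the lattice. -/
def IsSmall (r j h : ℕ) (c : E) : Prop :=
  (j ≤ r ∧ ‖c‖ < (p : ℝ) ^ (-(((h : ℝ) - 1) * ((r : ℝ) / 2 - j)))) ∨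
    ‖c‖ < (p : ℝ) ^ (-((h : ℝ) * ((r : ℝ) / 2 - j)))

variable [IsUltrametricDist E] {sqrtp π : E} {r : ℕ}

/-- The first alternative is the direct normalization of a monomial. The second uses the complement
of the ball when j ≤ r, and repeated subdivision when j > r. -/
theorem IsSmall.smul_mem (hsqrtp : sqrtp ^ 2 = (p : E)) (hπ : IsUniformizer π) (hr : 0 < r)
    {j h : ℕ} {c : E} (hc : IsSmall p r j h c) (L : E) (α : ℤ_[p]) :
    c • ballMono E j α h ∈ scaleLat π (latZero sqrtp r L) := by
  change π⁻¹ • c • ballMono E j α h ∈ latZero sqrtp r L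
  rw [smul_smul]
  have hcase2 : ‖c‖ < (p : ℝ) ^ (-((h : ℝ) * ((r : ℝ) / 2 - j))) →
      ‖π⁻¹ * c‖ ≤ (p : ℝ) ^ (-((h : ℝ) * ((r : ℝ) / 2 - j))) :=
    hπ.norm_inv_mul_le hsqrtp ((h : ℤ) * ((r : ℤ) - 2 * j)) (by push_cast; ring)
  rcases hc with ⟨hj, hc⟩ | hc
  · refine smul_ballMono_mem_latZero hsqrtp hr hj L α ?_
    exact hπ.norm_inv_mul_le hsqrtp (((h : ℤ) - 1) * ((r : ℤ) - 2 * j)) (by push_cast; ring) hc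
  · rcases le_or_gt j r with hj | hj
    · exact smul_ballMono_mem_latZero' hsqrtp hr hj L α (hcase2 hc)
    · refine (isCsLattice_latZero hr sqrtp L).smul_ballMono_mem (half_pos_of_pos hr)
        (half_le_self' r) (fun j hj α h c _ _ hc => smul_ballMono_mem_latZero hsqrtp hr hj L α hc)
        hj (Nat.zero_le _) (by simp) (hcase2 hc)

theorem smul_ballMono_mem_scaleLat_latInfty (hsqrtp : sqrtp ^ 2 = (p : E)) (hπ : IsUniformizer π)
    (hr : 0 < r) {j h : ℕ} {c : E} (hj : r < j) (hh : 1 ≤ h) {α : ℤ_[p]}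
    (hα : (p : ℤ_[p]) ^ 1 ∣ α) (hc : ‖c‖ < (p : ℝ) ^ (-((h : ℝ) * ((r : ℝ) / 2 - j)))) (L : E) :
    c • ballMono E j α h ∈ scaleLat π (latInfty sqrtp r L) := by
  change π⁻¹ • c • ballMono E j α h ∈ latInfty sqrtp r L
  rw [smul_smul]
  refine (isCsLattice_latInfty hr sqrtp L).smul_ballMono_mem (half_pos_of_pos hr)
    (half_le_self' r)
    (fun j hj α h c hh hα hc => smul_ballMono_mem_latInfty hsqrtp hr hj L hh hα hc) hj hh hα ?_
  exact hπ.norm_inv_mul_le hsqrtp ((h : ℤ) * ((r : ℤ) - 2 * j)) (by push_cast; ring) hc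

/-- This glues the estimates on ℤ_p and near infinity. It also shows that γ lies in D(k), as the sum
of f and π times elements of D(k). -/
theorem exists_toB_sub_eq_smul (hπ : IsUniformizer π) {L : E} {f : DSpace p E r} {γ : ℚ_[p] → E}
    {ψ ψ' : ℤ_[p] → E} (hψ : ψ ∈ scaleLat π (latZero sqrtp r L))
    (hψ' : ψ' ∈ scaleLat π (latInfty sqrtp r L))
    (hγ : ∀ z, γ z = f.toFun z + extZero ψ z + extInfty r ψ' z) :
    ∃ g : DSpace p E r, g.toFun = γ ∧
      ∃ θ ∈ latticeTheta p sqrtp r L, toB L g - toB L f = π • θ := by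
  have hπ0 : π ≠ 0 := norm_pos_iff.mp (hπ.norm_pos p)
  obtain ⟨-, d, hd, hdψ⟩ := hψ
  obtain ⟨-, d', hd', hdψ'⟩ := hψ'
  refine ⟨f + π • (d + d'), ?_, toB L (d + d'),
    toB_mem_latticeTheta (thetaLift_add_mem hd hd'), ?_⟩
  · ext z
    rw [hγ, toFun_add, toFun_smul, toFun_add, hdψ, hdψ']
    simp only [map_smul, smul_add, smul_smul, mul_inv_cancel₀ hπ0, one_smul, Pi.add_apply]
    rw [add_assoc]
    rfl
  · change Submodule.Quotient.mk _ - Submodule.Quotient.mk _ = π • Submodule.Quotient.mk _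
    rw [← Submodule.Quotient.mk_sub, ← Submodule.Quotient.mk_smul, add_sub_cancel_left]

variable [CompleteSpace E]

theorem tsum_mem_scaleLat_latZero (hsqrtp : sqrtp ^ 2 = (p : E)) (hπ : IsUniformizer π)
    (hr : 0 < r) (L : E) {ι : Type*} {j h : ι → ℕ} {α : ι → ℤ_[p]} {c : ι → E}
    (hc : ∀ i, IsSmall p r (j i) (h i) (c i))
    (hlim : Tendsto (fun i => ‖c i‖ * (p : ℝ) ^ ((h i : ℝ) * ((r : ℝ) / 2 - j i))) cofinite (𝓝 0)) :
    (fun z : ℤ_[p] => ∑' i, c i * ballMono E (j i) (α i) (h i) z) ∈ scaleLat π (latZero sqrtp r L) :=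
  ((isCsLattice_latZero (p := p) hr sqrtp L).scaleLat (norm_pos_iff.mp (hπ.norm_pos p))).tsum_mem
    (half_pos_of_pos hr) (f := fun i => c i • ballMono E (j i) (α i) (h i))
    (fun i => (CsBound.ballMono (half_pos_of_pos hr) (j i) (α i) (h i)).smul (c i)) hlim
    fun i => (hc i).smul_mem hsqrtp hπ hr L (α i)

theorem tsum_mem_scaleLat_latInfty (hsqrtp : sqrtp ^ 2 = (p : E)) (hπ : IsUniformizer π)
    (hr : 0 < r) (L : E) {ι : Type*} {j : ι → ℕ} {c : ι → E} (hj : ∀ i, r < j i)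
    (hc : ∀ i, ‖c i‖ < (p : ℝ) ^ ((j i : ℝ) - (r : ℝ) / 2))
    (hlim : Tendsto (fun i => ‖c i‖ * (p : ℝ) ^ ((r : ℝ) / 2 - j i)) cofinite (𝓝 0)) :
    (fun z : ℤ_[p] => ∑' i, c i * ballMono E (j i) 0 1 z) ∈ scaleLat π (latInfty sqrtp r L) :=
  ((isCsLattice_latInfty (p := p) hr sqrtp L).scaleLat (norm_pos_iff.mp (hπ.norm_pos p))).tsum_mem
    (half_pos_of_pos hr) (f := fun i => c i • ballMono E (j i) 0 1)
    (fun i => (CsBound.ballMono (half_pos_of_pos hr) (j i) 0 1).smul (c i)) (by simpa using hlim)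
    fun i => smul_ballMono_mem_scaleLat_latInfty hsqrtp hπ hr (hj i) le_rfl (dvd_zero _)
      (by simpa using hc i) L

end Strict

/-! ### The p-adic logarithm series on principal units. -/

section PadicLog

variable {p : ℕ} [Fact p.Prime]

variable (p) in
/-- The coefficients of the power series of `log (1 + t)`. -/
def logCoeff (m : ℕ) : ℚ_[p] := if m = 0 then 0 else (-1) ^ (m + 1) / m

theorem norm_natCast_inv_le {m : ℕ} (hm : m ≠ 0) : ‖(m : ℚ_[p])‖⁻¹ ≤ (p : ℝ) ^ (Nat.log p m) := by
  have h : ‖(m : ℚ_[p])‖ = (p : ℝ) ^ (-(padicValNat p m : ℤ)) := by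
    rw [Padic.norm_eq_zpow_neg_valuation (by exact_mod_cast hm), Padic.valuation_natCast]
  rw [h, zpow_neg, inv_inv, zpow_natCast]
  exact pow_le_pow_right₀ one_lt_prime.le (padicValNat_le_nat_log m)

theorem norm_logCoeff_le {m j : ℕ} (hmj : m ≤ j) : ‖logCoeff p m‖ ≤ (p : ℝ) ^ (Nat.log p j) := by
  rw [logCoeff]
  split_ifs with hm
  · rw [norm_zero]
    positivity
  · rw [norm_div, norm_pow, norm_neg, norm_one, one_pow, one_div]
    exact (norm_natCast_inv_le hm).trans
      (pow_le_pow_right₀ one_lt_prime.le (Nat.log_mono_right hmj))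

theorem norm_logCoeff_le_self (m : ℕ) : ‖logCoeff p m‖ ≤ m := by
  rw [logCoeff]
  split_ifs with hm
  · simp [hm]
  · rw [norm_div, norm_pow, norm_neg, norm_one, one_pow, one_div]
    refine (norm_natCast_inv_le hm).trans ?_
    exact_mod_cast Nat.pow_log_le_self p hm

theorem norm_le_inv_of_lt_one {t : ℚ_[p]} (ht : ‖t‖ < 1) : ‖t‖ ≤ (p : ℝ)⁻¹ := by
  have := (Padic.norm_lt_pow_iff_norm_le_pow_sub_one t 0).mp (by simpa using ht)
  simpa using this

theorem summable_nat_mul_pow {t : ℚ_[p]} (ht : ‖t‖ < 1) :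
    Summable fun m : ℕ => (m : ℝ) * ‖t‖ ^ m := by
  simpa using summable_pow_mul_geometric_of_norm_lt_one (R := ℝ) 1 (r := ‖t‖) (by simpa using ht)

theorem summable_logCoeff {t : ℚ_[p]} (ht : ‖t‖ < 1) :
    Summable fun m : ℕ => logCoeff p m * t ^ m := by
  refine Summable.of_norm_bounded (summable_nat_mul_pow ht) fun m => ?_
  rw [norm_mul, norm_pow]
  gcongr
  exact norm_logCoeff_le_self m

theorem hasSum_logCoeff {t : ℚ_[p]} (ht : ‖t‖ < 1) :
    HasSum (fun m : ℕ => logCoeff p m * t ^ m) (logSeries p (1 + t)) := by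
  have h := (summable_logCoeff ht).hasSum
  convert h using 1
  rw [(summable_logCoeff ht).tsum_eq_zero_add, logSeries]
  simp only [logCoeff, if_true, zero_mul, zero_add, Nat.add_eq_zero_iff, one_ne_zero, and_false,
    if_false, add_sub_cancel_left]
  refine tsum_congr fun m => ?_
  rw [pow_succ (-1 : ℚ_[p]) (m + 1), pow_succ (-1 : ℚ_[p]) m]
  push_cast
  ring

/-- By Pascal's rule C(p^N-1, m+1) = C(p^N, m+1) - C(p^N-1, m). The first term equals p^N C(p^N-1,
m)/(m+1), which tends to 0. -/
theorem tendsto_choose_prime_pow_sub_one (m : ℕ) :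
    Tendsto (fun N : ℕ => (((p ^ N - 1).choose m : ℕ) : ℚ_[p])) atTop (𝓝 ((-1) ^ m)) := by
  induction m with
  | zero => simp
  | succ m ih =>
    have hpow : Tendsto (fun N : ℕ => (p : ℚ_[p]) ^ N) atTop (𝓝 0) :=
      tendsto_pow_atTop_nhds_zero_of_norm_lt_one Padic.norm_p_lt_one
    have hm : ((m + 1 : ℕ) : ℚ_[p]) ≠ 0 := by exact_mod_cast Nat.succ_ne_zero m
    have h : ∀ N : ℕ, (((p ^ N - 1).choose (m + 1) : ℕ) : ℚ_[p]) =
        (p : ℚ_[p]) ^ N * ((p ^ N - 1).choose m : ℕ) / ((m + 1 : ℕ) : ℚ_[p]) -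
          ((p ^ N - 1).choose m : ℕ) := fun N => by
      have hpos : 0 < p ^ N := pow_pos (Fact.out : p.Prime).pos N
      obtain ⟨q, hq⟩ : ∃ q, p ^ N = q + 1 := ⟨p ^ N - 1, by omega⟩
      have h1 := Nat.add_one_mul_choose_eq q m
      have h2 : (q + 1).choose (m + 1) = q.choose m + q.choose (m + 1) := Nat.choose_succ_succ q m
      have h3 : (p : ℚ_[p]) ^ N = (q : ℚ_[p]) + 1 := by exact_mod_cast hq
      rw [hq, Nat.add_sub_cancel, h3, eq_sub_iff_add_eq, eq_div_iff hm]
      rw [h2] at h1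
      have h4 : ((q : ℚ_[p]) + 1) * (q.choose m : ℕ) =
        ((q.choose m : ℕ) + (q.choose (m + 1) : ℕ)) * ((m + 1 : ℕ) : ℚ_[p]) := by
        exact_mod_cast h1
      rw [h4]
      ring
    have h5 := (((hpow.mul ih).div_const ((m + 1 : ℕ) : ℚ_[p])).sub ih)
    rw [zero_mul, zero_div, zero_sub] at h5
    rw [pow_succ, mul_neg_one]
    exact h5.congr fun N => (h N).symm

/-- `log u` is the limit of `(u ^ {p ^ N} - 1) / p ^ N`. -/
theorem tendsto_logSeries {t : ℚ_[p]} (ht : ‖t‖ < 1) :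
    Tendsto (fun N : ℕ => ((1 + t) ^ (p ^ N) - 1) / (p : ℚ_[p]) ^ N) atTop
      (𝓝 (logSeries p (1 + t))) := by
  have hterm : ∀ N : ℕ, ((1 + t) ^ (p ^ N) - 1) / (p : ℚ_[p]) ^ N =
      ∑' m : ℕ, ((p ^ N - 1).choose m : ℕ) * t ^ (m + 1) / ((m + 1 : ℕ) : ℚ_[p]) := fun N => by
    have hpos : 0 < p ^ N := pow_pos (Fact.out : p.Prime).pos N
    obtain ⟨q, hq⟩ : ∃ q, p ^ N = q + 1 := ⟨p ^ N - 1, by omega⟩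
    have h3 : (p : ℚ_[p]) ^ N = (q : ℚ_[p]) + 1 := by exact_mod_cast hq
    have hq0 : (q : ℚ_[p]) + 1 ≠ 0 := by exact_mod_cast Nat.succ_ne_zero q
    rw [hq, Nat.add_sub_cancel, h3, tsum_eq_sum (s := range (q + 1)) fun m hm => by
      rw [Nat.choose_eq_zero_of_lt (by simpa using hm)]; simp]
    rw [add_comm (1 : ℚ_[p]) t, add_pow, sum_range_succ', div_eq_iff hq0, sum_mul]
    simp only [one_pow, mul_one, pow_zero, Nat.choose_zero_right, Nat.cast_one, add_sub_cancel_right]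
    refine sum_congr rfl fun m _ => ?_
    have hm : ((m + 1 : ℕ) : ℚ_[p]) ≠ 0 := by exact_mod_cast Nat.succ_ne_zero m
    have h1 : ((q : ℚ_[p]) + 1) * (q.choose m : ℕ) =
        ((q + 1).choose (m + 1) : ℕ) * ((m + 1 : ℕ) : ℚ_[p]) := by
      exact_mod_cast Nat.add_one_mul_choose_eq q m
    rw [div_mul_eq_mul_div, eq_div_iff hm]
    linear_combination (-(t ^ (m + 1))) * h1
  simp only [hterm]
  have hlog : logSeries p (1 + t) = ∑' m : ℕ, (-1) ^ m * t ^ (m + 1) / ((m + 1 : ℕ) : ℚ_[p]) := by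
    simp [logSeries]
  rw [hlog]
  -- Binomial coefficients are integral and |1/(m+1)| ≤ m+1, so (m+1)‖t‖^{m+1} dominates uniformly
  -- in N.
  refine tendsto_tsum_of_dominated_convergence
    ((summable_nat_add_iff 1).mpr (summable_nat_mul_pow ht))
    (fun m => ((tendsto_choose_prime_pow_sub_one m).mul_const _).div_const _)
    (Eventually.of_forall fun N m => ?_)
  rw [norm_div, norm_mul, norm_pow, div_eq_mul_inv]
  calc _ ≤ 1 * ‖t‖ ^ (m + 1) * ((m + 1 : ℕ) : ℝ) := by
        gcongr
        · exact norm_natCast_le_one' _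
        · refine (norm_natCast_inv_le (Nat.succ_ne_zero m)).trans ?_
          exact_mod_cast Nat.pow_log_le_self p (Nat.succ_ne_zero m)
    _ = _ := by ring

theorem norm_one_add_mul_sub_one_lt {u v : ℚ_[p]} (hu : ‖u - 1‖ < 1) (hv : ‖v - 1‖ < 1) :
    ‖u * v - 1‖ < 1 := by
  have : u * v - 1 = (u - 1) * (v - 1) + ((u - 1) + (v - 1)) := by ring
  rw [this]
  refine (IsUltrametricDist.norm_add_le_max _ _).trans_lt (max_lt ?_ ?_)
  · rw [norm_mul]
    exact mul_lt_one_of_nonneg_of_lt_one_left (norm_nonneg _) hu hv.le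
  · exact (IsUltrametricDist.norm_add_le_max _ _).trans_lt (max_lt hu hv)

/-- With a = u^{p^N} and b = v^{p^N}, one has ab-1 = (a-1)+(b-1)+(a-1)(b-1). After division by p^N
the last term is a product of two convergent quotients times p^N, so it vanishes in the limit. -/
theorem logSeries_mul {u v : ℚ_[p]} (hu : ‖u - 1‖ < 1) (hv : ‖v - 1‖ < 1) :
    logSeries p (u * v) = logSeries p u + logSeries p v := by
  have key : ∀ w : ℚ_[p], ‖w - 1‖ < 1 →
      Tendsto (fun N : ℕ => (w ^ (p ^ N) - 1) / (p : ℚ_[p]) ^ N) atTop (𝓝 (logSeries p w)) :=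
    fun w hw => by simpa using tendsto_logSeries hw
  have hpow : Tendsto (fun N : ℕ => (p : ℚ_[p]) ^ N) atTop (𝓝 0) :=
    tendsto_pow_atTop_nhds_zero_of_norm_lt_one Padic.norm_p_lt_one
  have h := ((key u hu).add (key v hv)).add (((key u hu).mul (key v hv)).mul hpow)
  rw [mul_zero, add_zero] at h
  refine tendsto_nhds_unique (key _ (norm_one_add_mul_sub_one_lt hu hv)) (h.congr fun N => ?_)
  have hp0 : (p : ℚ_[p]) ^ N ≠ 0 :=
    pow_ne_zero _ (by exact_mod_cast (Fact.out : p.Prime).ne_zero)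
  rw [mul_pow]
  field_simp
  ring

theorem logSeries_one : logSeries p 1 = 0 := by
  have := logSeries_mul (p := p) (u := 1) (v := 1) (by simp) (by simp)
  rw [mul_one] at this
  exact left_eq_add.mp this

theorem norm_pow_sub_one_lt {u : ℚ_[p]} (hu : ‖u - 1‖ < 1) (m : ℕ) : ‖u ^ m - 1‖ < 1 := by
  induction m with
  | zero => simp
  | succ m ih => rw [pow_succ]; exact norm_one_add_mul_sub_one_lt ih hu

theorem logSeries_pow {u : ℚ_[p]} (hu : ‖u - 1‖ < 1) (m : ℕ) :
    logSeries p (u ^ m) = m * logSeries p u := by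
  induction m with
  | zero => simp [logSeries_one]
  | succ m ih =>
    rw [pow_succ, logSeries_mul (norm_pow_sub_one_lt hu m) hu, ih]
    push_cast
    ring

/-- Bernoulli's inequality gives 1+4v ≤ 5^v ≤ p^v ≤ j for v = ⌊log_p j⌋. The denominators of the
logarithm thus cost at most (j-1)/4 in degree j, which every later estimate can absorb. -/
theorem nat_log_lt_self' (hp : 5 ≤ p) {j : ℕ} (hj : 1 ≤ j) : 4 * Nat.log p j + 1 ≤ j := by
  have h1 : 1 + Nat.log p j * 4 ≤ (1 + 4) ^ Nat.log p j := by
    exact_mod_cast one_add_mul_le_pow (R := ℤ) (a := 4) (by norm_num) (Nat.log p j)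
  have h2 : (1 + 4) ^ Nat.log p j ≤ p ^ Nat.log p j := Nat.pow_le_pow_left (by omega) _
  have h3 := Nat.pow_log_le_self p (Nat.one_le_iff_ne_zero.mp hj)
  omega

/-- `log (1 + t)` is congruent to `t` modulo `p ^ 2`. -/
theorem norm_logSeries_sub_le (hp : 5 ≤ p) {t : ℚ_[p]} (ht : ‖t‖ < 1) :
    ‖logSeries p (1 + t) - t‖ ≤ ((p : ℝ)⁻¹) ^ 2 := by
  have hs := summable_logCoeff ht
  rw [← (hasSum_logCoeff ht).tsum_eq, hs.tsum_eq_zero_add,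
    ((summable_nat_add_iff 1).mpr hs).tsum_eq_zero_add]
  have : logCoeff p 0 * t ^ 0 + (logCoeff p (0 + 1) * t ^ (0 + 1) +
      ∑' m : ℕ, logCoeff p (m + 1 + 1) * t ^ (m + 1 + 1)) - t =
      ∑' m : ℕ, logCoeff p (m + 1 + 1) * t ^ (m + 1 + 1) := by
    simp [logCoeff]
  rw [this]
  refine IsUltrametricDist.norm_tsum_le_of_forall_le_of_nonneg (by positivity) fun m => ?_
  rw [norm_mul, norm_pow]
  have hv := nat_log_lt_self' hp (j := m + 1 + 1) (by omega)
  set v := Nat.log p (m + 1 + 1)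
  have hp0 := prime_pos (p := p)
  calc _ ≤ (p : ℝ) ^ v * ((p : ℝ)⁻¹) ^ (m + 1 + 1) := by
        gcongr
        · exact norm_logCoeff_le le_rfl
        · exact norm_le_inv_of_lt_one ht
    _ = ((p : ℝ)⁻¹) ^ (m + 1 + 1 - v) := by
        have h1 : m + 1 + 1 = v + (m + 1 + 1 - v) := by omega
        conv_lhs => rw [h1]
        rw [pow_add, ← mul_assoc, ← mul_pow, mul_inv_cancel₀ hp0.ne', one_pow, one_mul]
    _ ≤ _ := pow_le_pow_of_le_one (by positivity) (inv_le_one_of_one_le₀ one_lt_prime.le)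
        (by omega)

theorem norm_logSeries_le (hp : 5 ≤ p) {t : ℚ_[p]} (ht : ‖t‖ < 1) :
    ‖logSeries p (1 + t)‖ ≤ (p : ℝ)⁻¹ := by
  have h : logSeries p (1 + t) = (logSeries p (1 + t) - t) + t := by ring
  rw [h]
  refine (IsUltrametricDist.norm_add_le_max _ _).trans (max_le ?_ (norm_le_inv_of_lt_one ht))
  refine (norm_logSeries_sub_le hp ht).trans ?_
  have : (p : ℝ)⁻¹ ≤ 1 := inv_le_one_of_one_le₀ one_lt_prime.le
  have h0 : (0 : ℝ) ≤ (p : ℝ)⁻¹ := by positivity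
  nlinarith

end PadicLog

/-! ### The branch lg of the logarithm with lg p = 0, and its local expansions. -/

section Branch

variable {p : ℕ} [Fact p.Prime]

/-- Hensel's lemma for X^{p-1}-1, whose derivative is a unit at w, gives the Teichmüller
representative of w. -/
theorem exists_root_of_unity {w : ℚ_[p]} (hw : ‖w‖ = 1) :
    ∃ ζ : ℚ_[p], ζ ^ (p - 1) = 1 ∧ ‖w / ζ - 1‖ < 1 := by
  let a : ℤ_[p] := ⟨w, hw.le⟩
  have ha : ‖a‖ = 1 := hw
  have hpp := (Fact.out : p.Prime).two_le
  let F : Polynomial ℤ_[p] := Polynomial.X ^ (p - 1) - 1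
  have hF : ∀ x : ℤ_[p], F.aeval x = x ^ (p - 1) - 1 := fun x => by simp [F]
  have hF' : ∀ x : ℤ_[p], F.derivative.aeval x = ((p - 1 : ℕ) : ℤ_[p]) * x ^ (p - 2) := fun x => by
    simp [F, Polynomial.derivative_X_pow, Nat.sub_sub]
  have hd : ‖F.derivative.aeval a‖ = 1 := by
    rw [hF', norm_mul, norm_pow, ha, one_pow, mul_one]
    rw [PadicInt.norm_natCast_eq_one_iff]
    exact ((Fact.out : p.Prime).coprime_iff_not_dvd).mpr
      (Nat.not_dvd_of_pos_of_lt (by omega) (by omega))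
  have h1 : ‖F.aeval a‖ < 1 := by
    rw [hF, ← PadicInt.mem_nonunits, ← IsLocalRing.mem_maximalIdeal, ← PadicInt.ker_toZMod,
      RingHom.mem_ker, map_sub, map_pow, map_one, sub_eq_zero]
    refine ZMod.pow_card_sub_one_eq_one fun h0 => ?_
    rw [← RingHom.mem_ker, PadicInt.ker_toZMod, IsLocalRing.mem_maximalIdeal,
      PadicInt.mem_nonunits] at h0
    exact h0.ne ha
  obtain ⟨z, hz, hza, -⟩ := hensels_lemma (F := F) (a := a) (by rw [hd, one_pow]; exact h1)
  rw [hd] at hza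
  have hz1 : ‖z‖ = 1 := by
    have : z = (z - a) + a := by ring
    rw [this, IsUltrametricDist.norm_add_eq_max_of_norm_ne_norm (by rw [ha]; exact hza.ne), ha]
    exact max_eq_right hza.le
  have hz0 : (z : ℚ_[p]) ≠ 0 := by
    rw [← norm_pos_iff, ← PadicInt.norm_def, hz1]
    exact one_pos
  rw [hF, sub_eq_zero] at hz
  refine ⟨z, by exact_mod_cast congr_arg (fun x : ℤ_[p] => (x : ℚ_[p])) hz, ?_⟩
  have h2 : w / z - 1 = -((z - a : ℤ_[p]) : ℚ_[p]) / z := by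
    rw [PadicInt.coe_sub]
    field_simp
    change w - z = -((z : ℚ_[p]) - w)
    ring
  rw [h2, norm_div, norm_neg, ← PadicInt.norm_def, ← PadicInt.norm_def, hz1, div_one]
  exact hza

theorem principalUnit_spec {z : ℚ_[p]} (hz : z ≠ 0) : ‖principalUnit p z - 1‖ < 1 ∧
    ∃ ζ : ℚ_[p], ζ ^ (p - 1) = 1 ∧ z = (p : ℚ_[p]) ^ z.valuation * ζ * principalUnit p z := by
  have h : ∃ u : ℚ_[p], ‖u - 1‖ < 1 ∧
      ∃ ζ : ℚ_[p], ζ ^ (p - 1) = 1 ∧ z = (p : ℚ_[p]) ^ z.valuation * ζ * u := by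
    have hp0 := prime_zpow_ne_zero (p := p) z.valuation
    have hw : ‖z / (p : ℚ_[p]) ^ z.valuation‖ = 1 := by
      rw [norm_div, norm_prime_zpow, Padic.norm_eq_zpow_neg_valuation hz]
      exact div_self (zpow_ne_zero _ prime_pos.ne')
    obtain ⟨ζ, hζ, h⟩ := exists_root_of_unity hw
    have hpp := (Fact.out : p.Prime).two_le
    have hζ0 : ζ ≠ 0 := by
      rintro rfl
      rw [zero_pow (by omega)] at hζ
      exact zero_ne_one hζ
    refine ⟨_, h, ζ, hζ, ?_⟩
    field_simp
  rw [principalUnit, dif_pos h]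
  exact h.choose_spec

variable (p) in
/-- The logarithm of the principal unit part, that is `log_𝓛` for `𝓛 = 0`. -/
def lg (z : ℚ_[p]) : ℚ_[p] := logSeries p (principalUnit p z)

/-- The power p-1 kills the root of unity, so (p-1) lg z has a formula free of the choices made in
`principalUnit`; additivity of lg follows from it. -/
theorem sub_one_mul_lg {z : ℚ_[p]} (hz : z ≠ 0) :
    ‖(z / (p : ℚ_[p]) ^ z.valuation) ^ (p - 1) - 1‖ < 1 ∧
    ((p - 1 : ℕ) : ℚ_[p]) * lg p z = logSeries p ((z / (p : ℚ_[p]) ^ z.valuation) ^ (p - 1)) := by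
  obtain ⟨hu, ζ, hζ, h⟩ := principalUnit_spec hz
  have hp0 := prime_zpow_ne_zero (p := p) z.valuation
  have h1 : (z / (p : ℚ_[p]) ^ z.valuation) ^ (p - 1) = principalUnit p z ^ (p - 1) := by
    have : z / (p : ℚ_[p]) ^ z.valuation = ζ * principalUnit p z := by
      rw [div_eq_iff hp0]
      linear_combination h
    rw [this, mul_pow, hζ, one_mul]
  rw [h1]
  exact ⟨norm_pow_sub_one_lt hu _, by rw [logSeries_pow hu, lg]⟩

theorem prime_sub_one_ne_zero : ((p - 1 : ℕ) : ℚ_[p]) ≠ 0 := by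
  have := (Fact.out : p.Prime).two_le
  exact_mod_cast (by omega : p - 1 ≠ 0)

theorem lg_mul {z w : ℚ_[p]} (hz : z ≠ 0) (hw : w ≠ 0) : lg p (z * w) = lg p z + lg p w := by
  refine mul_left_cancel₀ prime_sub_one_ne_zero ?_
  rw [mul_add, (sub_one_mul_lg hz).2, (sub_one_mul_lg hw).2, (sub_one_mul_lg (mul_ne_zero hz hw)).2,
    ← logSeries_mul (sub_one_mul_lg hz).1 (sub_one_mul_lg hw).1, Padic.valuation_mul hz hw,
    zpow_add₀ (by exact_mod_cast (Fact.out : p.Prime).ne_zero), mul_div_mul_comm, mul_pow]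

theorem valuation_eq_of_norm_eq {z w : ℚ_[p]} (hz : z ≠ 0) (hw : w ≠ 0) (h : ‖z‖ = ‖w‖) :
    z.valuation = w.valuation := by
  rw [Padic.norm_eq_zpow_neg_valuation hz, Padic.norm_eq_zpow_neg_valuation hw] at h
  have := (zpow_right_inj₀ prime_pos one_lt_prime.ne').mp h
  omega

theorem norm_add_eq_left {z t : ℚ_[p]} (h : ‖t‖ < ‖z‖) : ‖z + t‖ = ‖z‖ := by
  rw [IsUltrametricDist.norm_add_eq_max_of_norm_ne_norm h.ne']
  exact max_eq_left h.le

theorem lg_one_add {t : ℚ_[p]} (ht : ‖t‖ < 1) : lg p (1 + t) = logSeries p (1 + t) := by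
  have h1 : ‖1 + t‖ = 1 := by
    rw [norm_add_eq_left (by simpa using ht), norm_one]
  have h0 : 1 + t ≠ 0 := norm_pos_iff.mp (by rw [h1]; exact one_pos)
  have hv : (1 + t).valuation = 0 := by
    rw [valuation_eq_of_norm_eq h0 one_ne_zero (by rw [h1, norm_one]), Padic.valuation_one]
  refine mul_left_cancel₀ prime_sub_one_ne_zero ?_
  rw [(sub_one_mul_lg h0).2, hv, zpow_zero, div_one, logSeries_pow (by simpa using ht)]

theorem norm_lg_le (hp : 5 ≤ p) {z : ℚ_[p]} (hz : z ≠ 0) : ‖lg p z‖ ≤ (p : ℝ)⁻¹ := by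
  have h := norm_logSeries_le hp (principalUnit_spec hz).1
  rwa [add_sub_cancel] at h

theorem lg_add {β t : ℚ_[p]} (hβ : β ≠ 0) (ht : ‖t‖ < ‖β‖) :
    lg p (β + t) = lg p β + logSeries p (1 + t / β) := by
  have ht' : ‖t / β‖ < 1 := by rwa [norm_div, div_lt_one (norm_pos_iff.mpr hβ)]
  have h1 : (1 + t / β) ≠ 0 := by
    rw [← norm_pos_iff, norm_add_eq_left (by simpa using ht'), norm_one]
    exact one_pos
  have h2 : β + t = β * (1 + t / β) := by field_simp
  rw [h2, lg_mul hβ h1, lg_one_add ht']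

variable (p) in
/-- The coefficients of the power series of `(1 + t) ^ n * log (1 + t)`. -/
def powLogCoeff (n j : ℕ) : ℚ_[p] :=
  ∑ i ∈ range (n + 1), if i ≤ j then (n.choose i : ℚ_[p]) * logCoeff p (j - i) else 0

theorem norm_powLogCoeff_le (n j : ℕ) : ‖powLogCoeff p n j‖ ≤ (p : ℝ) ^ (Nat.log p j) := by
  refine IsUltrametricDist.norm_sum_le_of_forall_le_of_nonneg (by positivity) fun i _ => ?_
  split_ifs
  · rw [norm_mul]
    calc _ ≤ 1 * (p : ℝ) ^ (Nat.log p j) := by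
          gcongr
          · exact norm_natCast_le_one' _
          · exact norm_logCoeff_le (Nat.sub_le _ _)
      _ = _ := one_mul _
  · rw [norm_zero]
    positivity

theorem hasSum_powLogCoeff (n : ℕ) {t : ℚ_[p]} (ht : ‖t‖ < 1) :
    HasSum (fun j : ℕ => powLogCoeff p n j * t ^ j) ((1 + t) ^ n * logSeries p (1 + t)) := by
  have hterm : ∀ i ∈ range (n + 1), HasSum (fun j : ℕ =>
      (if i ≤ j then (n.choose i : ℚ_[p]) * logCoeff p (j - i) else 0) * t ^ j)
      ((n.choose i : ℚ_[p]) * t ^ i * logSeries p (1 + t)) := fun i _ => by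
    rw [← (add_left_injective i).hasSum_iff (fun j hj => ?_)]
    · have h1 := (hasSum_logCoeff ht).mul_left ((n.choose i : ℚ_[p]) * t ^ i)
      refine (iff_of_eq (congr_arg (HasSum · _) (funext fun m => ?_))).mpr h1
      simp only [Function.comp_apply, Nat.le_add_left, if_true, Nat.add_sub_cancel, pow_add]
      ring
    · have : ¬ i ≤ j := fun h => hj ⟨j - i, Nat.sub_add_cancel h⟩
      rw [if_neg this, zero_mul]
  convert hasSum_sum hterm using 1
  · ext j
    rw [powLogCoeff, sum_mul]
  · rw [add_comm, add_pow, sum_mul]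
    refine sum_congr rfl fun i _ => ?_
    rw [one_pow]
    ring

theorem hasSum_pow_mul_lg_sub (n : ℕ) {β t : ℚ_[p]} (hβ : β ≠ 0) (ht : ‖t‖ < ‖β‖) :
    HasSum (fun j : ℕ => powLogCoeff p n j * β ^ ((n : ℤ) - j) * t ^ j)
      ((β + t) ^ n * (lg p (β + t) - lg p β)) := by
  have ht' : ‖t / β‖ < 1 := by rwa [norm_div, div_lt_one (norm_pos_iff.mpr hβ)]
  have h2 : β + t = β * (1 + t / β) := by field_simp
  rw [lg_add hβ ht, add_sub_cancel_left]
  have h3 : (β + t) ^ n = β ^ n * (1 + t / β) ^ n := by rw [h2, mul_pow]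
  have h4 : (fun j : ℕ => powLogCoeff p n j * β ^ ((n : ℤ) - j) * t ^ j) =
      fun j => β ^ n * (powLogCoeff p n j * (t / β) ^ j) := by
    ext j
    rw [zpow_sub₀ hβ, zpow_natCast, zpow_natCast, div_pow]
    field_simp
  rw [h3, h4, mul_assoc]
  exact (hasSum_powLogCoeff n ht').mul_left (β ^ n)

end Branch

/-! ### The logarithmic singularities (z-α)^n lg(z-α) near α. -/

section Pieces

variable {p : ℕ} [Fact p.Prime]

theorem tendsto_zero_of_le_rpow {ι : Type*} {a : ι → ℝ} {k : ι → ℕ} {C : ℝ} (h0 : ∀ i, 0 ≤ a i)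
    (h : ∀ i, a i ≤ (p : ℝ) ^ (C - (k i : ℝ) / 2)) (hk : ∀ B, {i | k i < B}.Finite) :
    Tendsto a cofinite (𝓝 0) := by
  have h1 : Tendsto k cofinite atTop := tendsto_atTop.mpr fun B => by
    simpa [Filter.eventually_cofinite] using hk B
  have hlt : (p : ℝ) ^ (-(1 / 2) : ℝ) < 1 :=
    Real.rpow_lt_one_of_one_lt_of_neg one_lt_prime (by norm_num)
  have h2 := ((tendsto_pow_atTop_nhds_zero_of_lt_one (Real.rpow_nonneg prime_pos.le _) hlt).comp
    h1).const_mul ((p : ℝ) ^ C)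
  rw [mul_zero] at h2
  refine squeeze_zero h0 (fun i => (h i).trans (le_of_eq ?_)) h2
  rw [Function.comp_apply, ← Real.rpow_natCast, ← Real.rpow_mul prime_pos.le,
    ← Real.rpow_add prime_pos]
  ring_nf

variable {E : Type*} [NormedField E] [NormedAlgebra ℚ_[p] E]

theorem IsSmall.of_le_left {r j h : ℕ} {c : E} {e : ℝ} (hj : j ≤ r) (hc : ‖c‖ ≤ (p : ℝ) ^ e)
    (he : e < -(((h : ℝ) - 1) * ((r : ℝ) / 2 - j))) : IsSmall p r j h c :=
  Or.inl ⟨hj, hc.trans_lt (Real.rpow_lt_rpow_of_exponent_lt one_lt_prime he)⟩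

theorem IsSmall.of_le_right {r j h : ℕ} {c : E} {e : ℝ} (hc : ‖c‖ ≤ (p : ℝ) ^ e)
    (he : e < -((h : ℝ) * ((r : ℝ) / 2 - j))) : IsSmall p r j h c :=
  Or.inr (hc.trans_lt (Real.rpow_lt_rpow_of_exponent_lt one_lt_prime he))

variable (E) in
/-- The singular part of `(z - α) ^ n * log (z - α)`, for the logarithm with `log p = 0`. -/
def singLog (n : ℕ) (α z : ℤ_[p]) : E :=
  open Classical in
  if (p : ℤ_[p]) ∣ z - α then emb p E (z - α) ^ n * algebraMap ℚ_[p] E (lg p (z - α : ℤ_[p]))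
  else 0

variable (E) in
/-- The part of `(z - α) ^ n * log_𝓛 (z - α)` that comes from the valuation of `z - α`. -/
def singVal (n : ℕ) (α z : ℤ_[p]) : E :=
  open Classical in
  if (p : ℤ_[p]) ∣ z - α then emb p E (z - α) ^ n * ((z - α).valuation : E) else 0

theorem norm_natCast_eq_one_of_lt {b : ℕ} (hb0 : b ≠ 0) (hb : b < p) : ‖(b : ℚ_[p])‖ = 1 := by
  rw [← PadicInt.coe_natCast, ← PadicInt.norm_def, PadicInt.norm_natCast_eq_one_iff]
  exact ((Fact.out : p.Prime).coprime_iff_not_dvd).mpr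
    (Nat.not_dvd_of_pos_of_lt (by omega) hb)

theorem norm_of_dvd_sub_prime_pow_mul {h b : ℕ} (hb0 : b ≠ 0) (hb : b < p) {y : ℤ_[p]}
    (hy : (p : ℤ_[p]) ^ (h + 2) ∣ y - (p : ℤ_[p]) ^ (h + 1) * (b : ℤ_[p])) :
    ‖y‖ = (p : ℝ) ^ (-((h + 1 : ℕ) : ℝ)) ∧
      ‖y - (p : ℤ_[p]) ^ (h + 1) * (b : ℤ_[p])‖ < (p : ℝ) ^ (-((h + 1 : ℕ) : ℝ)) := by
  have h1 : ‖(p : ℤ_[p]) ^ (h + 1) * (b : ℤ_[p])‖ = (p : ℝ) ^ (-((h + 1 : ℕ) : ℝ)) := by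
    rw [norm_mul, PadicInt.norm_def (z := (b : ℤ_[p])), PadicInt.coe_natCast,
      norm_natCast_eq_one_of_lt hb0 hb, mul_one, norm_pow, PadicInt.norm_p, inv_pow,
      Real.rpow_neg prime_pos.le, Real.rpow_natCast]
  have h2 : ‖y - (p : ℤ_[p]) ^ (h + 1) * (b : ℤ_[p])‖ < (p : ℝ) ^ (-((h + 1 : ℕ) : ℝ)) := by
    refine ((norm_le_rpow_iff_dvd _ _).mpr hy).trans_lt
      (Real.rpow_lt_rpow_of_exponent_lt one_lt_prime ?_)
    push_cast
    linarith
  refine ⟨?_, h2⟩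
  have h3 : y = (p : ℤ_[p]) ^ (h + 1) * (b : ℤ_[p]) +
      (y - (p : ℤ_[p]) ^ (h + 1) * (b : ℤ_[p])) := by ring
  rw [← h1] at h2
  rw [h3, IsUltrametricDist.norm_add_eq_max_of_norm_ne_norm h2.ne', max_eq_left h2.le, h1]

/-- The balls p^{h+1}b + p^{h+2}ℤ_p with b a nonzero digit partition pℤ_p without 0, and lg is given
by a power series on each of them. -/
theorem exists_leading_digit {y : ℤ_[p]} (hy0 : y ≠ 0) (hy : (p : ℤ_[p]) ∣ y) :
    ∃ h b : ℕ, b ≠ 0 ∧ b < p ∧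
      (p : ℤ_[p]) ^ (h + 2) ∣ y - (p : ℤ_[p]) ^ (h + 1) * (b : ℤ_[p]) := by
  have hu := PadicInt.unitCoeff_spec hy0
  have hv : y.valuation ≠ 0 := by
    intro h0
    rw [h0, pow_zero, mul_one] at hu
    have h1 := PadicInt.norm_units (PadicInt.unitCoeff hy0)
    rw [← hu] at h1
    exact h1.not_lt (by rwa [PadicInt.norm_lt_one_iff_dvd])
  obtain ⟨h, hh⟩ := Nat.exists_eq_succ_of_ne_zero hv
  obtain ⟨b, hb, hbd⟩ := exists_digit (p := p) ((PadicInt.unitCoeff hy0 : ℤ_[p]ˣ) : ℤ_[p])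
  refine ⟨h, b, ?_, hb, ?_⟩
  · rintro rfl
    rw [Nat.cast_zero, sub_zero, ← PadicInt.norm_lt_one_iff_dvd] at hbd
    exact hbd.ne (PadicInt.norm_units _)
  · rw [hh] at hu
    conv_rhs => rw [hu]
    rw [mul_comm _ ((p : ℤ_[p]) ^ _), Nat.succ_eq_add_one, ← mul_sub, pow_succ _ (h + 1)]
    exact mul_dvd_mul_left _ hbd

theorem digit_unique_of_dvd {h b h' b' : ℕ} (hb0 : b ≠ 0) (hb : b < p) (hb0' : b' ≠ 0)
    (hb' : b' < p) {y : ℤ_[p]}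
    (hy : (p : ℤ_[p]) ^ (h + 2) ∣ y - (p : ℤ_[p]) ^ (h + 1) * (b : ℤ_[p]))
    (hy' : (p : ℤ_[p]) ^ (h' + 2) ∣ y - (p : ℤ_[p]) ^ (h' + 1) * (b' : ℤ_[p])) :
    h = h' ∧ b = b' := by
  have h1 := (norm_of_dvd_sub_prime_pow_mul hb0 hb hy).1
  rw [(norm_of_dvd_sub_prime_pow_mul hb0' hb' hy').1, Real.rpow_neg prime_pos.le,
    Real.rpow_neg prime_pos.le, inv_inj, Real.rpow_natCast, Real.rpow_natCast] at h1
  have h2 := (pow_right_inj₀ prime_pos one_lt_prime.ne').mp h1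
  obtain rfl : h = h' := by omega
  refine ⟨rfl, ?_⟩
  have hp0 : (p : ℤ_[p]) ^ (h + 1) ≠ 0 :=
    pow_ne_zero _ (by exact_mod_cast (Fact.out : p.Prime).ne_zero)
  have h3 := dvd_sub hy' hy
  rw [sub_sub_sub_cancel_left, ← mul_sub, pow_succ _ (h + 1), mul_dvd_mul_iff_left hp0] at h3
  exact (digit_unique hb' hb (t := (b : ℤ_[p])) h3 (by simp)).symm

variable [IsUltrametricDist E] [CompleteSpace E] {sqrtp π : E} {r : ℕ}

theorem norm_powLogCoeff_add_le (hp : 5 ≤ p) (n j : ℕ) {b : ℚ_[p]} (hb : b ≠ 0) :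
    ‖powLogCoeff p n j + (n.choose j : ℚ_[p]) * lg p b‖ ≤ (p : ℝ) ^ (Nat.log p j) := by
  refine (IsUltrametricDist.norm_add_le_max _ _).trans (max_le (norm_powLogCoeff_le n j) ?_)
  rw [norm_mul]
  calc _ ≤ 1 * (p : ℝ)⁻¹ := by
        gcongr
        · exact norm_natCast_le_one' _
        · exact norm_lg_le hp hb
    _ ≤ 1 := by
        rw [one_mul]
        exact inv_le_one_of_one_le₀ one_lt_prime.le
    _ ≤ _ := one_le_pow₀ one_lt_prime.le

theorem hasSum_choose_mul_zpow (n : ℕ) (β t : ℚ_[p]) :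
    HasSum (fun j : ℕ => (n.choose j : ℚ_[p]) * β ^ ((n : ℤ) - j) * t ^ j) ((β + t) ^ n) := by
  have h2 : (β + t) ^ n =
      ∑ j ∈ range (n + 1), (n.choose j : ℚ_[p]) * β ^ ((n : ℤ) - j) * t ^ j := by
    rw [add_comm, add_pow]
    refine sum_congr rfl fun j hj => ?_
    have : (n : ℤ) - j = ((n - j : ℕ) : ℤ) := by
      have := Nat.lt_succ_iff.mp (mem_range.mp hj)
      omega
    rw [this, zpow_natCast]
    ring
  rw [h2]
  refine hasSum_sum_of_ne_finset_zero fun j hj => ?_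
  have h0 : n.choose j = 0 := Nat.choose_eq_zero_of_lt (by simpa using hj)
  simp [h0]

theorem hasSum_pow_mul_lg (n : ℕ) {β t : ℚ_[p]} (hβ : β ≠ 0) (ht : ‖t‖ < ‖β‖) :
    HasSum (fun j : ℕ => (powLogCoeff p n j + (n.choose j : ℚ_[p]) * lg p β) *
      β ^ ((n : ℤ) - j) * t ^ j) ((β + t) ^ n * lg p (β + t)) := by
  have h3 := (hasSum_pow_mul_lg_sub n hβ ht).add
    ((hasSum_choose_mul_zpow n β t).mul_right (lg p β))
  have h4 : (β + t) ^ n * (lg p (β + t) - lg p β) + (β + t) ^ n * lg p β =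
      (β + t) ^ n * lg p (β + t) := by ring
  rw [h4] at h3
  refine (iff_of_eq (congr_arg (HasSum · _) (funext fun j => ?_))).mpr h3
  ring

/-- On a ball of centre β = p^{h+1}b and level h+2, the coefficient of degree j has size at most
p^{1+log_p j-(h+1)(n-j)}. For j ≤ r the logarithm term is 0, as j < p, and the direct criterion
reduces to 1 < (h+1)(n-r/2). For j > r the second criterion reduces to 1+log_p j <
(h+1)(n-r/2)+(j-r/2). Both follow from n > r/2+1. -/
theorem singLog_mem (hp : 5 ≤ p) (hsqrtp : sqrtp ^ 2 = (p : E)) (hπ : IsUniformizer π)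
    {n : ℕ} (hn : (r : ℝ) / 2 + 1 < n) (hnr : n ≤ r) (hrp : r < p) (L : E) {c : E}
    (hc : ‖c‖ ≤ p) (α : ℤ_[p]) :
    c • singLog E n α ∈ scaleLat π (latZero sqrtp r L) := by
  classical
  have hr : 0 < r := by
    rcases Nat.eq_zero_or_pos r with h | h
    · have h0 : n = 0 := by omega
      rw [h, h0] at hn
      norm_num at hn
    · exact h
  have hn0 : n ≠ 0 := by
    rintro rfl
    have : (0 : ℝ) ≤ r := Nat.cast_nonneg r
    norm_num at hn
    linarith
  let β : ℕ × Fin p × ℕ → ℤ_[p] := fun i => (p : ℤ_[p]) ^ (i.1 + 1) * ((i.2.1 : ℕ) : ℤ_[p])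
  -- The digit 0 is in the index type but corresponds to no ball of the partition, so its
  -- coefficient is set to 0.
  let coef : ℕ × Fin p × ℕ → E := fun i => if (i.2.1 : ℕ) = 0 then 0 else
    c * algebraMap ℚ_[p] E ((powLogCoeff p n i.2.2 +
      (n.choose i.2.2 : ℚ_[p]) * lg p (β i)) * (β i : ℚ_[p]) ^ ((n : ℤ) - i.2.2))
  have hβ0 : ∀ i, (i.2.1 : ℕ) ≠ 0 → ‖(β i : ℚ_[p])‖ = (p : ℝ) ^ (-((i.1 : ℝ) + 1)) := fun i hi => by
    have := (norm_of_dvd_sub_prime_pow_mul (h := i.1) hi i.2.1.2 (y := β i) (by simp [β])).1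
    rw [← PadicInt.norm_def, this]
    push_cast
    rfl
  have hβne : ∀ i, (i.2.1 : ℕ) ≠ 0 → (β i : ℚ_[p]) ≠ 0 := fun i hi => by
    rw [← norm_pos_iff, hβ0 i hi]
    exact Real.rpow_pos_of_pos prime_pos _
  have hcoef : ∀ i, ‖coef i‖ ≤
      (p : ℝ) ^ (1 + (Nat.log p i.2.2 : ℝ) - ((i.1 : ℝ) + 1) * (n - i.2.2)) := fun i => by
    simp only [coef]
    split_ifs with hi
    · rw [norm_zero]
      exact Real.rpow_nonneg prime_pos.le _
    · rw [norm_mul, norm_algebraMap', norm_mul, norm_zpow, hβ0 i hi]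
      calc _ ≤ (p : ℝ) ^ (1 : ℝ) * ((p : ℝ) ^ ((Nat.log p i.2.2 : ℕ) : ℝ) *
            ((p : ℝ) ^ (-((i.1 : ℝ) + 1))) ^ ((n : ℤ) - i.2.2)) := by
            gcongr
            · rwa [Real.rpow_one]
            · rw [Real.rpow_natCast]
              exact norm_powLogCoeff_add_le hp n _ (hβne i hi)
        _ = _ := by
            rw [← Real.rpow_intCast, ← Real.rpow_mul prime_pos.le, ← Real.rpow_add prime_pos,
              ← Real.rpow_add prime_pos]
            push_cast
            ring_nf
  have hlog : ∀ j : ℕ, (4 : ℝ) * Nat.log p j ≤ j ∧ (1 ≤ j → (4 : ℝ) * Nat.log p j + 1 ≤ j) :=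
    fun j => by
      have h1 : 1 ≤ j → 4 * Nat.log p j + 1 ≤ j := nat_log_lt_self' hp
      refine ⟨?_, fun h => by exact_mod_cast h1 h⟩
      rcases Nat.eq_zero_or_pos j with rfl | h
      · simp
      · have := h1 h
        exact_mod_cast (by omega : 4 * Nat.log p j ≤ j)
  have hmem := tsum_mem_scaleLat_latZero (ι := ℕ × Fin p × ℕ) hsqrtp hπ hr L
    (j := fun i => i.2.2) (h := fun i => i.1 + 2) (α := fun i => α + β i) (c := coef)
    (fun i => ?_) ?_
  · convert hmem using 1
    ext z
    rw [Pi.smul_apply, singLog, smul_eq_mul]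
    have hsub : ∀ i, z - (α + β i) = (z - α) - β i := fun i => by ring
    by_cases hex : ∃ i : ℕ × Fin p, (i.2 : ℕ) ≠ 0 ∧
        (p : ℤ_[p]) ^ (i.1 + 2) ∣ (z - α) - (p : ℤ_[p]) ^ (i.1 + 1) * ((i.2 : ℕ) : ℤ_[p])
    · obtain ⟨⟨h, b⟩, hb0, hdvd⟩ := hex
      have hinj : Function.Injective (fun j : ℕ => (h, b, j)) := fun j j' hj => by
        simpa using hj
      obtain ⟨hn1, hn2⟩ := norm_of_dvd_sub_prime_pow_mul hb0 b.2 hdvd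
      have hpdvd : (p : ℤ_[p]) ∣ z - α := by
        rw [← PadicInt.norm_lt_one_iff_dvd, hn1]
        exact Real.rpow_lt_one_of_one_lt_of_neg one_lt_prime (by push_cast; linarith)
      rw [if_pos hpdvd]
      refine (HasSum.tsum_eq ?_).symm
      rw [← hinj.hasSum_iff]
      · have hlt : ‖((z - α - β (h, b, 0) : ℤ_[p]) : ℚ_[p])‖ < ‖(β (h, b, 0) : ℚ_[p])‖ := by
          rw [hβ0 (h, b, 0) hb0, ← PadicInt.norm_def]
          simpa using hn2
        have h1 := ((hasSum_pow_mul_lg n (hβne (h, b, 0) hb0) hlt).map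
          (algebraMap ℚ_[p] E) (continuous_algebraMap _ _)).mul_left c
        have e1 : (β (h, b, 0) : ℚ_[p]) + ((z - α - β (h, b, 0) : ℤ_[p]) : ℚ_[p]) =
            ((z - α : ℤ_[p]) : ℚ_[p]) := by
          rw [← PadicInt.coe_add, add_sub_cancel]
        rw [e1, map_mul, map_pow, ← emb_apply] at h1
        refine (iff_of_eq (congr_arg (HasSum · _) (funext fun j => ?_))).mpr h1
        simp only [Function.comp_apply, coef, hb0, if_false]
        rw [ballMono_of_dvd (by rw [hsub]; exact hdvd), hsub, emb_apply, map_mul _ _ (_ ^ j),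
          map_pow, mul_assoc]
      · rintro ⟨h', b', j⟩ hni
        by_cases hb' : (b' : ℕ) = 0
        · rw [show coef _ = 0 from if_pos hb', zero_mul]
        · rw [ballMono_of_not_dvd, mul_zero]
          intro hd
          rw [hsub] at hd
          obtain ⟨rfl, hbb⟩ := digit_unique_of_dvd hb0 b.2 hb' b'.2 hdvd hd
          exact hni ⟨j, by rw [← Fin.ext hbb]⟩
    · have h0 : ∀ i, coef i * ballMono E i.2.2 (α + β i) (i.1 + 2) z = 0 := fun i => by
        by_cases hb' : (i.2.1 : ℕ) = 0
        · rw [show coef _ = 0 from if_pos hb', zero_mul]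
        · rw [ballMono_of_not_dvd, mul_zero]
          intro hd
          rw [hsub] at hd
          exact hex ⟨(i.1, i.2.1), hb', hd⟩
      simp only [h0, tsum_zero]
      split_ifs with hpd
      -- The centre lies in no ball of the partition; there the function vanishes because n ≠ 0.
      · rcases eq_or_ne (z - α) 0 with hz | hz
        · rw [hz, map_zero, zero_pow hn0, zero_mul, mul_zero]
        · obtain ⟨h, b, hb0, hb, hd⟩ := exists_leading_digit hz hpd
          exact absurd ⟨(h, ⟨b, hb⟩), hb0, hd⟩ hex
      · rw [mul_zero]
  · obtain ⟨h, b, j⟩ := i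
    obtain ⟨hl1, hl2⟩ := hlog j
    have hh : (0 : ℝ) ≤ h := Nat.cast_nonneg h
    rcases le_or_gt j r with hj | hj
    · refine IsSmall.of_le_left hj (hcoef _) ?_
      have : Nat.log p j = 0 := Nat.log_of_lt (hj.trans_lt hrp)
      simp only [this]
      push_cast
      nlinarith
    · refine IsSmall.of_le_right (hcoef _) ?_
      have hj' : (r : ℝ) + 1 ≤ j := by exact_mod_cast hj
      have := hl2 (by omega)
      push_cast
      nlinarith
  · refine tendsto_zero_of_le_rpow (p := p) (k := fun i => i.1 + i.2.2) (C := (r : ℝ) + 1)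
      (fun i => by positivity) (fun i => ?_) fun B => ?_
    · obtain ⟨h, b, j⟩ := i
      obtain ⟨hl1, hl2⟩ := hlog j
      have hh : (0 : ℝ) ≤ h := Nat.cast_nonneg h
      have hr0 : (0 : ℝ) ≤ r := Nat.cast_nonneg r
      have hj0 : (0 : ℝ) ≤ j := Nat.cast_nonneg j
      calc _ ≤ _ := mul_le_mul_of_nonneg_right (hcoef _) (Real.rpow_nonneg prime_pos.le _)
        _ ≤ _ := by
          rw [← Real.rpow_add prime_pos]
          refine Real.rpow_le_rpow_of_exponent_le one_lt_prime.le ?_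
          push_cast
          nlinarith
    · refine ((Set.finite_Iio B).prod (Set.finite_univ.prod (Set.finite_Iio B))).subset ?_
      rintro ⟨h, b, j⟩ hi
      simp only [Set.mem_ofPred_eq] at hi
      simp only [Set.mem_prod, Set.mem_Iio, Set.mem_univ, true_and]
      omega

end Pieces

/-! ### Congruences for the λ_i and for the Taylor coefficients of the regular part. -/

section Coefficients

variable {p : ℕ} [Fact p.Prime]

theorem norm_add_le_of_le_of_le {x y : ℚ_[p]} {c : ℝ} (hx : ‖x‖ ≤ c) (hy : ‖y‖ ≤ c) :
    ‖x + y‖ ≤ c := (IsUltrametricDist.norm_add_le_max _ _).trans (max_le hx hy)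

theorem norm_coe_le_inv_of_dvd {x : ℤ_[p]} (hx : (p : ℤ_[p]) ∣ x) : ‖(x : ℚ_[p])‖ ≤ (p : ℝ)⁻¹ := by
  rw [← PadicInt.norm_def]
  have := (norm_le_rpow_iff_dvd x 1).mpr (by rwa [pow_one])
  rwa [Nat.cast_one, Real.rpow_neg_one] at this

theorem norm_sub_eq_one_of_not_dvd {a i : ℕ} (h : ¬ (p : ℤ_[p]) ∣ (a : ℤ_[p]) - i) :
    ‖(a : ℚ_[p]) - i‖ = 1 := by
  rw [← PadicInt.norm_lt_one_iff_dvd, not_lt] at h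
  have h1 := le_antisymm (PadicInt.norm_le_one _) h
  rwa [PadicInt.norm_def, PadicInt.coe_sub, PadicInt.coe_natCast, PadicInt.coe_natCast] at h1

theorem not_dvd_sub_of_lt {a i : ℕ} (ha : a < p) (hi : i < p) (h : a ≠ i) :
    ¬ (p : ℤ_[p]) ∣ (a : ℤ_[p]) - i := fun hd =>
  h (digit_unique ha hi (t := (a : ℤ_[p])) (by simp) hd)

variable {n : ℕ} {lam : ℕ → ℤ_[p]}

theorem sum_mul_eval_eq_zero
    (hlam : ∀ j ≤ n, ∑ i ∈ insert p (range (n + 1)), lam i * (i : ℤ_[p]) ^ j = 0)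
    {Q : Polynomial ℤ_[p]} (hQ : Q.natDegree ≤ n) :
    ∑ i ∈ insert p (range (n + 1)), lam i * Q.eval (i : ℤ_[p]) = 0 := by
  simp_rw [Polynomial.eval_eq_sum_range' (Nat.lt_succ_of_le hQ), mul_sum]
  rw [sum_comm]
  refine sum_eq_zero fun j hj => ?_
  rw [← mul_zero (Q.coeff j), ← hlam j (Nat.lt_succ_iff.mp (mem_range.mp hj)), mul_sum]
  exact sum_congr rfl fun i _ => by ring

theorem sum_mul_sub_pow_eq_zero
    (hlam : ∀ j ≤ n, ∑ i ∈ insert p (range (n + 1)), lam i * (i : ℤ_[p]) ^ j = 0)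
    (a : ℤ_[p]) {m : ℕ} (hm : m ≤ n) :
    ∑ i ∈ insert p (range (n + 1)), lam i * (a - i) ^ m = 0 := by
  have h := sum_mul_eval_eq_zero hlam (Q := (Polynomial.C a - Polynomial.X) ^ m)
    ((Polynomial.natDegree_pow_le_of_le (m := 1) m (by compute_degree)).trans (by omega))
  simpa using h

/-- The polynomial is the product of X-j over 0 ≤ j ≤ n, j ≠ k. It has degree n and isolates k and p
among the nodes. Its value at k is a unit because n < p. If k ≠ 0, the factor X makes its value at p
divisible by p. -/
theorem exists_eval_relation (hnp : n < p) (hlam_p : lam p = -1)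
    (hlam : ∀ j ≤ n, ∑ i ∈ insert p (range (n + 1)), lam i * (i : ℤ_[p]) ^ j = 0)
    {k : ℕ} (hk : k ≤ n) : ∃ Q : Polynomial ℤ_[p],
      lam k * Q.eval (k : ℤ_[p]) = Q.eval (p : ℤ_[p]) ∧ ¬ (p : ℤ_[p]) ∣ Q.eval (k : ℤ_[p]) ∧
      (k ≠ 0 → (p : ℤ_[p]) ∣ Q.eval (p : ℤ_[p])) := by
  have hkr : k ∈ range (n + 1) := mem_range.mpr (by omega)
  refine ⟨∏ j ∈ (range (n + 1)).erase k, (Polynomial.X - Polynomial.C (j : ℤ_[p])), ?_, ?_, ?_⟩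
  · have h := sum_mul_eval_eq_zero hlam
      (Q := ∏ j ∈ (range (n + 1)).erase k, (Polynomial.X - Polynomial.C (j : ℤ_[p])))
      (by rw [Polynomial.natDegree_prod_of_monic _ _ fun j _ => Polynomial.monic_X_sub_C _]
          simp only [Polynomial.natDegree_X_sub_C]
          simp [card_erase_of_mem hkr])
    rw [sum_insert (by simp; omega), hlam_p, sum_eq_single_of_mem k hkr fun i hi hik => by
      rw [Polynomial.eval_prod, prod_eq_zero (mem_erase.mpr ⟨hik, hi⟩) (by simp), mul_zero]] at h
    linear_combination h
  · rw [Polynomial.eval_prod, (PadicInt.prime_p (p := p)).dvd_finsetProd_iff]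
    rintro ⟨j, hj, hd⟩
    obtain ⟨hjk, hj⟩ := mem_erase.mp hj
    have := mem_range.mp hj
    refine not_dvd_sub_of_lt (p := p) (a := k) (i := j) (by omega) (by omega) hjk.symm ?_
    simpa using hd
  · intro hk0
    rw [Polynomial.eval_prod]
    refine Dvd.dvd.trans ?_ (dvd_prod_of_mem _ (mem_erase.mpr ⟨hk0.symm, mem_range.mpr n.succ_pos⟩))
    simp

theorem prime_dvd_coeff (hnp : n < p) (hlam_p : lam p = -1)
    (hlam : ∀ j ≤ n, ∑ i ∈ insert p (range (n + 1)), lam i * (i : ℤ_[p]) ^ j = 0)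
    {k : ℕ} (hk0 : k ≠ 0) (hk : k ≤ n) : (p : ℤ_[p]) ∣ lam k := by
  obtain ⟨Q, h1, h2, h3⟩ := exists_eval_relation hnp hlam_p hlam hk
  exact ((PadicInt.prime_p (p := p)).dvd_or_dvd (h1 ▸ h3 hk0)).resolve_right h2

theorem prime_dvd_coeff_zero_sub_one (hnp : n < p) (hlam_p : lam p = -1)
    (hlam : ∀ j ≤ n, ∑ i ∈ insert p (range (n + 1)), lam i * (i : ℤ_[p]) ^ j = 0) :
    (p : ℤ_[p]) ∣ lam 0 - 1 := by
  obtain ⟨Q, h1, h2, -⟩ := exists_eval_relation hnp hlam_p hlam n.zero_le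
  refine ((PadicInt.prime_p (p := p)).dvd_or_dvd ?_).resolve_right h2
  rw [sub_mul, one_mul, h1]
  simpa using Q.sub_dvd_eval_sub (p : ℤ_[p]) ((0 : ℕ) : ℤ_[p])

variable (p n lam) in
/-- The coefficients of the Taylor expansion on `a + pℤ_p` of the sum of the
`λ_i (z - i) ^ n * log (z - i)`, for `i` not congruent to `a`, minus `p * z ^ n / a`. -/
def regCoeff (a j : ℕ) : ℚ_[p] :=
  open Classical in
  ∑ i ∈ (insert p (range (n + 1))).filter (fun i : ℕ => ¬ (p : ℤ_[p]) ∣ (a : ℤ_[p]) - i),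
    (lam i : ℚ_[p]) * ((powLogCoeff p n j + (n.choose j : ℚ_[p]) * lg p ((a : ℚ_[p]) - i)) *
      ((a : ℚ_[p]) - i) ^ ((n : ℤ) - j)) -
  if a = 0 then 0 else p * (a : ℚ_[p])⁻¹ * ((n.choose j : ℚ_[p]) * (a : ℚ_[p]) ^ ((n : ℤ) - j))

theorem norm_regCoeff_le (hp : 5 ≤ p) {a : ℕ} (ha : a < p) (j : ℕ) :
    ‖regCoeff p n lam a j‖ ≤ (p : ℝ) ^ (Nat.log p j) := by
  classical
  refine (norm_sub_le_max' _ _).trans (max_le ?_ ?_)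
  · refine IsUltrametricDist.norm_sum_le_of_forall_le_of_nonneg (by positivity) fun i hi => ?_
    have h1 := norm_sub_eq_one_of_not_dvd (mem_filter.mp hi).2
    rw [norm_mul, norm_mul, norm_zpow, h1, one_zpow, mul_one]
    calc _ ≤ 1 * (p : ℝ) ^ (Nat.log p j) := by
          gcongr
          · exact PadicInt.norm_le_one (lam i)
          · exact norm_powLogCoeff_add_le hp n j (norm_pos_iff.mp (by rw [h1]; exact one_pos))
      _ = _ := one_mul _
  · split_ifs with h
    · rw [norm_zero]
      positivity
    · rw [norm_mul, norm_mul, norm_mul, norm_inv, norm_zpow, norm_natCast_eq_one_of_lt h ha,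
        one_zpow, mul_one, inv_one, mul_one, Padic.norm_p]
      calc _ ≤ (1 : ℝ) * 1 := by
            gcongr
            · exact inv_le_one_of_one_le₀ one_lt_prime.le
            · exact norm_natCast_le_one' _
        _ ≤ _ := by
            rw [one_mul]
            exact one_le_pow₀ one_lt_prime.le

/-- As λ_0 ≡ 1 and lg takes values in pℤ_p, modulo p² the nodes 0 and p contribute (lg a - lg(a-p))
a^m. This is log(1+p/(a-p)) a^m ≡ (p/a) a^m, the source of the term p^{1+x} a⁻¹ z^n of f. -/
theorem norm_log_part_le (hp : 5 ≤ p) (hnp : n < p) (hlam_p : lam p = -1)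
    (hlam : ∀ j ≤ n, ∑ i ∈ insert p (range (n + 1)), lam i * (i : ℤ_[p]) ^ j = 0)
    {a : ℕ} (ha0 : a ≠ 0) (ha : a < p) (m : ℕ) :
    ‖-(lg p ((a : ℚ_[p]) - p) * ((a : ℚ_[p]) - p) ^ m) +
      (lam 0 : ℚ_[p]) * lg p (a : ℚ_[p]) * (a : ℚ_[p]) ^ m -
      p * (a : ℚ_[p])⁻¹ * (a : ℚ_[p]) ^ m‖ ≤ ((p : ℝ)⁻¹) ^ 2 := by
  have ha1 := norm_natCast_eq_one_of_lt ha0 ha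
  have hane : (a : ℚ_[p]) ≠ 0 := norm_pos_iff.mp (by rw [ha1]; exact one_pos)
  have hpn : ‖(p : ℚ_[p])‖ = (p : ℝ)⁻¹ := Padic.norm_p
  have hp1 : (p : ℝ)⁻¹ < 1 := inv_lt_one_of_one_lt₀ one_lt_prime
  have hu1 : ‖(a : ℚ_[p]) - p‖ = 1 := by
    rw [sub_eq_add_neg, norm_add_eq_left, ha1]
    rw [norm_neg, ha1, hpn]
    exact hp1
  have hune : (a : ℚ_[p]) - p ≠ 0 := norm_pos_iff.mp (by rw [hu1]; exact one_pos)
  have hlga := lg_add (t := (p : ℚ_[p])) hune (by rw [hu1, hpn]; exact hp1)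
  rw [sub_add_cancel] at hlga
  have ht : ‖(p : ℚ_[p]) / ((a : ℚ_[p]) - p)‖ < 1 := by
    rw [norm_div, hu1, hpn, div_one]
    exact hp1
  have hls := norm_logSeries_sub_le hp ht
  have hpow : ‖(a : ℚ_[p]) ^ m - ((a : ℚ_[p]) - p) ^ m‖ ≤ (p : ℝ)⁻¹ := by
    have h := norm_coe_le_inv_of_dvd (p := p) (x := (a : ℤ_[p]) ^ m - ((a : ℤ_[p]) - p) ^ m)
      (by simpa using sub_dvd_pow_sub_pow (a : ℤ_[p]) ((a : ℤ_[p]) - p) m)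
    simpa using h
  have h0 : ‖(lam 0 : ℚ_[p]) - 1‖ ≤ (p : ℝ)⁻¹ := by
    simpa using norm_coe_le_inv_of_dvd (prime_dvd_coeff_zero_sub_one hnp hlam_p hlam)
  have key : -(lg p ((a : ℚ_[p]) - p) * ((a : ℚ_[p]) - p) ^ m) +
      (lam 0 : ℚ_[p]) * lg p (a : ℚ_[p]) * (a : ℚ_[p]) ^ m - p * (a : ℚ_[p])⁻¹ * (a : ℚ_[p]) ^ m =
      ((lam 0 : ℚ_[p]) - 1) * lg p (a : ℚ_[p]) * (a : ℚ_[p]) ^ m +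
      lg p ((a : ℚ_[p]) - p) * ((a : ℚ_[p]) ^ m - ((a : ℚ_[p]) - p) ^ m) +
      (logSeries p (1 + (p : ℚ_[p]) / ((a : ℚ_[p]) - p)) - (p : ℚ_[p]) / ((a : ℚ_[p]) - p)) *
        (a : ℚ_[p]) ^ m + (p : ℚ_[p]) * p * ((a : ℚ_[p]) - p)⁻¹ * (a : ℚ_[p])⁻¹ *
        (a : ℚ_[p]) ^ m := by
    have e : (p : ℚ_[p]) * p * ((a : ℚ_[p]) - p)⁻¹ * (a : ℚ_[p])⁻¹ =
        (p : ℚ_[p]) / ((a : ℚ_[p]) - p) - p * (a : ℚ_[p])⁻¹ := by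
      field_simp
      ring
    rw [e, hlga]
    ring
  rw [key]
  refine norm_add_le_of_le_of_le (norm_add_le_of_le_of_le (norm_add_le_of_le_of_le ?_ ?_) ?_) ?_
  · rw [norm_mul, norm_mul, norm_pow, ha1, one_pow, mul_one, sq]
    exact mul_le_mul h0 (norm_lg_le hp hane) (norm_nonneg _) (by positivity)
  · rw [norm_mul, sq]
    exact mul_le_mul (norm_lg_le hp hune) hpow (norm_nonneg _) (by positivity)
  · rwa [norm_mul, norm_pow, ha1, one_pow, mul_one]
  · rw [norm_mul, norm_mul, norm_mul, norm_mul, norm_pow, norm_inv, norm_inv, ha1, hu1, hpn]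
    simp [sq]

/-- With m = n-j, two sums occur. The sum of λ_i (a-i)^m over i not congruent to a is minus the sum
over i ≡ a, by the relations on λ, hence divisible by p^m. In the sum of λ_i lg(a-i)(a-i)^m, the
nodes 1, ..., n give multiples of p², one factor p from λ_i and one from lg; the nodes 0 and p are
handled by `norm_log_part_le`. -/
theorem norm_regCoeff_le_inv_pow (hp : 5 ≤ p) (hnp : n < p) (hlam_p : lam p = -1)
    (hlam : ∀ j ≤ n, ∑ i ∈ insert p (range (n + 1)), lam i * (i : ℤ_[p]) ^ j = 0)
    {a : ℕ} (ha : a < p) {j k : ℕ} (hk : k ≤ 2) (hj : j + k ≤ n) :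
    ‖regCoeff p n lam a j‖ ≤ ((p : ℝ)⁻¹) ^ k := by
  classical
  obtain ⟨m, hm⟩ : ∃ m, n = j + m := ⟨n - j, by omega⟩
  have hz : (n : ℤ) - j = (m : ℕ) := by omega
  have hpn : ‖(p : ℚ_[p])‖ = (p : ℝ)⁻¹ := Padic.norm_p
  have hp0 : (0 : ℝ) ≤ (p : ℝ)⁻¹ := inv_nonneg.mpr prime_pos.le
  have hp1 : (p : ℝ)⁻¹ ≤ 1 := inv_le_one_of_one_le₀ one_lt_prime.le
  set T := (insert p (range (n + 1))).filter (fun i : ℕ => ¬ (p : ℤ_[p]) ∣ (a : ℤ_[p]) - i) with hT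
  have hsplit : regCoeff p n lam a j =
      powLogCoeff p n j * ∑ i ∈ T, (lam i : ℚ_[p]) * ((a : ℚ_[p]) - i) ^ m +
      (n.choose j : ℚ_[p]) * (∑ i ∈ T, (lam i : ℚ_[p]) * lg p ((a : ℚ_[p]) - i) *
        ((a : ℚ_[p]) - i) ^ m - if a = 0 then 0 else p * (a : ℚ_[p])⁻¹ * (a : ℚ_[p]) ^ m) := by
    rw [regCoeff, mul_sub, ← add_sub_assoc, mul_sum, mul_sum, ← sum_add_distrib, hz]
    congr 1
    · refine sum_congr rfl fun i _ => ?_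
      rw [zpow_natCast]
      ring
    · rw [zpow_natCast]
      split_ifs
      · rw [mul_zero]
      · ring
  have hA : ‖∑ i ∈ T, (lam i : ℚ_[p]) * ((a : ℚ_[p]) - i) ^ m‖ ≤ ((p : ℝ)⁻¹) ^ m := by
    have h1 := congrArg (fun x : ℤ_[p] => (x : ℚ_[p]))
      (sum_mul_sub_pow_eq_zero hlam (a : ℤ_[p]) (m := m) (by omega))
    simp only [PadicInt.coe_sum, PadicInt.coe_mul, PadicInt.coe_pow, PadicInt.coe_sub,
      PadicInt.coe_natCast, PadicInt.coe_zero] at h1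
    rw [← sum_filter_not_add_sum_filter _ (fun i : ℕ => (p : ℤ_[p]) ∣ (a : ℤ_[p]) - i)] at h1
    rw [eq_neg_of_add_eq_zero_left h1, norm_neg]
    refine IsUltrametricDist.norm_sum_le_of_forall_le_of_nonneg (by positivity) fun i hi => ?_
    rw [norm_mul, norm_pow, ← one_mul ((p : ℝ)⁻¹ ^ m)]
    gcongr
    · exact PadicInt.norm_le_one (lam i)
    · simpa using norm_coe_le_inv_of_dvd (mem_filter.mp hi).2
  have hB : ‖∑ i ∈ T, (lam i : ℚ_[p]) * lg p ((a : ℚ_[p]) - i) *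
        ((a : ℚ_[p]) - i) ^ m - (if a = 0 then 0 else p * (a : ℚ_[p])⁻¹ * (a : ℚ_[p]) ^ m)‖ ≤
      ((p : ℝ)⁻¹) ^ 2 := by
    rw [hT, sum_filter, sum_insert (by simp; omega), sum_range_succ']
    have hmid : ‖∑ i ∈ range n, (if ¬ (p : ℤ_[p]) ∣ (a : ℤ_[p]) - ((i + 1 : ℕ) : ℤ_[p]) then
        (lam (i + 1) : ℚ_[p]) * lg p ((a : ℚ_[p]) - ((i + 1 : ℕ) : ℚ_[p])) *
        ((a : ℚ_[p]) - ((i + 1 : ℕ) : ℚ_[p])) ^ m else 0)‖ ≤ ((p : ℝ)⁻¹) ^ 2 := by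
      refine IsUltrametricDist.norm_sum_le_of_forall_le_of_nonneg (by positivity) fun i hi => ?_
      split_ifs with h
      · rw [norm_zero]
        positivity
      · have h1 := norm_sub_eq_one_of_not_dvd h
        rw [norm_mul, norm_mul, norm_pow, h1, one_pow, mul_one, sq]
        refine mul_le_mul ?_ (norm_lg_le hp (norm_pos_iff.mp (by rw [h1]; exact one_pos)))
          (norm_nonneg _) hp0
        exact norm_coe_le_inv_of_dvd
          (prime_dvd_coeff hnp hlam_p hlam i.succ_ne_zero (by have := mem_range.mp hi; omega))
    by_cases h0 : a = 0
    · subst h0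
      simpa using hmid
    · have hd : ¬ (p : ℤ_[p]) ∣ (a : ℤ_[p]) := by
        simpa using not_dvd_sub_of_lt (p := p) ha (Fact.out : p.Prime).pos h0
      have hd' : ¬ (p : ℤ_[p]) ∣ (a : ℤ_[p]) - p := by rwa [dvd_sub_self_right]
      rw [if_pos hd', if_pos (by simpa using hd), if_neg h0, hlam_p]
      have h1 := norm_add_le_of_le_of_le hmid (norm_log_part_le hp hnp hlam_p hlam h0 ha m)
      convert h1 using 2
      push_cast
      ring
  rw [hsplit]
  refine norm_add_le_of_le_of_le ?_ ?_
  · rw [norm_mul, ← one_mul ((p : ℝ)⁻¹ ^ k)]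
    refine mul_le_mul ?_ (hA.trans (pow_le_pow_of_le_one hp0 hp1 (by omega))) (norm_nonneg _)
      zero_le_one
    have := norm_powLogCoeff_le (p := p) n j
    rwa [Nat.log_of_lt (by omega), pow_zero] at this
  · rw [norm_mul, ← one_mul ((p : ℝ)⁻¹ ^ k)]
    exact mul_le_mul (norm_natCast_le_one' _) (hB.trans (pow_le_pow_of_le_one hp0 hp1 hk))
      (norm_nonneg _) zero_le_one

end Coefficients

/-! ### The part of g away from the singularities. -/

section Regular

variable {p : ℕ} [Fact p.Prime] {n : ℕ} {lam : ℕ → ℤ_[p]}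

theorem four_mul_log_le (hp : 5 ≤ p) (j : ℕ) : (4 : ℝ) * Nat.log p j ≤ j := by
  rcases Nat.eq_zero_or_pos j with rfl | h
  · simp
  · have : 4 * Nat.log p j + 1 ≤ j := nat_log_lt_self' hp h
    exact_mod_cast (by omega : 4 * Nat.log p j ≤ j)

theorem four_mul_log_lt (hp : 5 ≤ p) {j : ℕ} (hj : 1 ≤ j) : (4 : ℝ) * Nat.log p j + 1 ≤ j := by
  exact_mod_cast nat_log_lt_self' hp hj

theorem dvd_sub_iff_of_dvd_sub {z a : ℤ_[p]} (h : (p : ℤ_[p]) ∣ z - a) (i : ℤ_[p]) :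
    (p : ℤ_[p]) ∣ z - i ↔ (p : ℤ_[p]) ∣ a - i := by
  rw [← sub_add_sub_cancel z a i]
  exact dvd_add_right h

open Classical in
theorem hasSum_regCoeff {a : ℕ} {z : ℤ_[p]} (hz : (p : ℤ_[p]) ∣ z - a) :
    HasSum (fun j : ℕ => regCoeff p n lam a j * ((z - a : ℤ_[p]) : ℚ_[p]) ^ j)
      (∑ i ∈ insert p (range (n + 1)), (lam i : ℚ_[p]) * (if (p : ℤ_[p]) ∣ z - (i : ℕ) then 0 else
        ((z - (i : ℕ) : ℤ_[p]) : ℚ_[p]) ^ n * lg p (z - (i : ℕ) : ℤ_[p])) -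
      if a = 0 then 0 else p * (a : ℚ_[p])⁻¹ * (z : ℚ_[p]) ^ n) := by
  set t : ℚ_[p] := ((z - a : ℤ_[p]) : ℚ_[p]) with ht
  have htlt : ‖t‖ < 1 := by
    rwa [ht, ← PadicInt.norm_def, PadicInt.norm_lt_one_iff_dvd]
  have hi : ∀ i ∈ (insert p (range (n + 1))).filter
      (fun i : ℕ => ¬ (p : ℤ_[p]) ∣ (a : ℤ_[p]) - i),
      HasSum (fun j : ℕ => (lam i : ℚ_[p]) * ((powLogCoeff p n j + (n.choose j : ℚ_[p]) *
        lg p ((a : ℚ_[p]) - i)) * ((a : ℚ_[p]) - i) ^ ((n : ℤ) - j)) * t ^ j)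
      ((lam i : ℚ_[p]) * (((z - (i : ℕ) : ℤ_[p]) : ℚ_[p]) ^ n * lg p (z - (i : ℕ) : ℤ_[p]))) := by
    intro i hi
    have h1 := norm_sub_eq_one_of_not_dvd (mem_filter.mp hi).2
    have h2 := (hasSum_pow_mul_lg n (norm_pos_iff.mp (by rw [h1]; exact one_pos))
      (htlt.trans_eq h1.symm)).mul_left (lam i : ℚ_[p])
    have e1 : (a : ℚ_[p]) - i + t = ((z - (i : ℕ) : ℤ_[p]) : ℚ_[p]) := by
      rw [ht]
      push_cast
      ring
    rw [e1] at h2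
    simpa only [mul_assoc] using h2
  have hsub : HasSum (fun j : ℕ => (if a = 0 then 0 else p * (a : ℚ_[p])⁻¹ *
      ((n.choose j : ℚ_[p]) * (a : ℚ_[p]) ^ ((n : ℤ) - j))) * t ^ j)
      (if a = 0 then 0 else p * (a : ℚ_[p])⁻¹ * (z : ℚ_[p]) ^ n) := by
    split_ifs
    · simpa using hasSum_zero
    · have h2 := (hasSum_choose_mul_zpow n (a : ℚ_[p]) t).mul_left (p * (a : ℚ_[p])⁻¹)
      have e1 : (a : ℚ_[p]) + t = (z : ℚ_[p]) := by
        rw [ht]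
        push_cast
        ring
      rw [e1] at h2
      simpa only [mul_assoc] using h2
  have h := (hasSum_sum hi).sub hsub
  have e2 : ∑ i ∈ insert p (range (n + 1)), (lam i : ℚ_[p]) * (if (p : ℤ_[p]) ∣ z - (i : ℕ) then 0
      else ((z - (i : ℕ) : ℤ_[p]) : ℚ_[p]) ^ n * lg p (z - (i : ℕ) : ℤ_[p])) =
      ∑ i ∈ (insert p (range (n + 1))).filter (fun i : ℕ => ¬ (p : ℤ_[p]) ∣ (a : ℤ_[p]) - i),
      (lam i : ℚ_[p]) * (((z - (i : ℕ) : ℤ_[p]) : ℚ_[p]) ^ n * lg p (z - (i : ℕ) : ℤ_[p])) := by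
    rw [sum_filter]
    refine sum_congr rfl fun i _ => ?_
    rw [dvd_sub_iff_of_dvd_sub hz]
    split_ifs <;> simp_all
  rw [e2]
  refine (iff_of_eq (congr_arg (HasSum · _) (funext fun j => ?_))).mpr h
  rw [regCoeff, sub_mul, sum_mul]

variable {E : Type*} [NormedField E] [NormedAlgebra ℚ_[p] E] [IsUltrametricDist E] [CompleteSpace E]
  {sqrtp π : E} {r : ℕ}

/-- At level h = 1 the direct criterion asks for norm less than 1, and the other for norm less than
p^{j-r/2}. For j ≤ n-2 the divisibility by p² beats |c| ≤ p. For j = n-1 the divisibility by p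
leaves norm at most 1, and n-1 > r/2. For n ≤ j ≤ r the bound p suffices as j-r/2 > 1, and for j > r
the growth of the denominators is slow enough. -/
theorem tsum_regCoeff_mem (hp : 5 ≤ p) (hsqrtp : sqrtp ^ 2 = (p : E)) (hπ : IsUniformizer π)
    (hr : 0 < r) (hn : (r : ℝ) / 2 + 1 < n) (hnr : n ≤ r) (hrp : r < p) (L : E)
    (hlam_p : lam p = -1)
    (hlam : ∀ j ≤ n, ∑ i ∈ insert p (range (n + 1)), lam i * (i : ℤ_[p]) ^ j = 0)
    {c : E} (hc : ‖c‖ ≤ p) {a : ℕ} (ha : a < p) :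
    (fun z : ℤ_[p] => ∑' j : ℕ, c * algebraMap ℚ_[p] E (regCoeff p n lam a j) *
      ballMono E j (a : ℤ_[p]) 1 z) ∈ scaleLat π (latZero sqrtp r L) := by
  have hgen : ∀ j, ‖c * algebraMap ℚ_[p] E (regCoeff p n lam a j)‖ ≤
      (p : ℝ) ^ (1 + (Nat.log p j : ℝ)) := fun j => by
    rw [norm_mul, norm_algebraMap', Real.rpow_add prime_pos, Real.rpow_one, Real.rpow_natCast]
    gcongr
    exact norm_regCoeff_le hp ha j
  have hsmall : ∀ j k : ℕ, k ≤ 2 → j + k ≤ n →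
      ‖c * algebraMap ℚ_[p] E (regCoeff p n lam a j)‖ ≤ (p : ℝ) ^ (1 - (k : ℝ)) :=
    fun j k hk hj => by
      rw [norm_mul, norm_algebraMap', Real.rpow_sub prime_pos, Real.rpow_one, Real.rpow_natCast,
        div_eq_mul_inv, ← inv_pow]
      gcongr
      exact norm_regCoeff_le_inv_pow hp (hnr.trans_lt hrp) hlam_p hlam ha hk hj
  refine tsum_mem_scaleLat_latZero hsqrtp hπ hr L (j := fun j => j) (h := fun _ => 1)
    (α := fun _ => (a : ℤ_[p])) (fun j => ?_) ?_
  · rcases lt_or_ge r j with hj | hj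
    · refine IsSmall.of_le_right (hgen j) ?_
      have h1 := four_mul_log_lt hp (j := j) (by omega)
      have h2 : (r : ℝ) + 1 ≤ j := by exact_mod_cast hj
      have h3 : (1 : ℝ) ≤ r := by exact_mod_cast hr
      push_cast
      linarith
    rcases le_or_gt n j with hj' | hj'
    · refine IsSmall.of_le_right (hgen j) ?_
      rw [Nat.log_of_lt (hj.trans_lt hrp)]
      have h2 : (n : ℝ) ≤ j := by exact_mod_cast hj'
      push_cast
      linarith
    rcases (Nat.succ_le_of_lt hj').eq_or_lt with hj'' | hj''
    · refine IsSmall.of_le_right (hsmall j 1 (by norm_num) (by omega)) ?_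
      have h2 : (j : ℝ) + 1 = n := by exact_mod_cast hj''
      push_cast
      linarith
    · refine IsSmall.of_le_left hj (hsmall j 2 le_rfl (by omega)) ?_
      norm_num
  · refine tendsto_zero_of_le_rpow (p := p) (k := fun j => j) (C := (r : ℝ) + 1)
      (fun i => by positivity) (fun j => ?_) fun B => Set.finite_Iio B
    calc _ ≤ _ := mul_le_mul_of_nonneg_right (hgen j) (Real.rpow_nonneg prime_pos.le _)
      _ ≤ _ := by
        rw [← Real.rpow_add prime_pos]
        refine Real.rpow_le_rpow_of_exponent_le one_lt_prime.le ?_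
        have h1 := four_mul_log_le hp j
        have h2 : (0 : ℝ) ≤ r := Nat.cast_nonneg r
        have h3 : (0 : ℝ) ≤ j := Nat.cast_nonneg j
        push_cast
        linarith

variable (E) in
/-- The restriction of `(z - i) ^ n * log (z - i)` to the complement of `i + pℤ_p`. -/
def regLog (n i : ℕ) (z : ℤ_[p]) : E :=
  open Classical in
  if (p : ℤ_[p]) ∣ z - (i : ℕ) then 0
  else emb p E (z - (i : ℕ)) ^ n * algebraMap ℚ_[p] E (lg p (z - (i : ℕ) : ℤ_[p]))

theorem ballMono_zero_natCast {a b : ℕ} (ha : a < p) (hb : b < p) {z : ℤ_[p]}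
    (hz : (p : ℤ_[p]) ∣ z - a) : ballMono E 0 (b : ℤ_[p]) 1 z = if b = a then 1 else 0 := by
  split_ifs with h
  · rw [h, ballMono_of_dvd (by rwa [pow_one]), pow_zero]
  · refine ballMono_of_not_dvd fun hd => h ?_
    exact digit_unique hb ha (by rwa [pow_one] at hd) hz

theorem regLog_sub_mem (hp : 5 ≤ p) (hsqrtp : sqrtp ^ 2 = (p : E)) (hπ : IsUniformizer π)
    (hr : 0 < r) (hn : (r : ℝ) / 2 + 1 < n) (hnr : n ≤ r) (hrp : r < p) (L : E)
    (hlam_p : lam p = -1)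
    (hlam : ∀ j ≤ n, ∑ i ∈ insert p (range (n + 1)), lam i * (i : ℤ_[p]) ^ j = 0)
    {c : E} (hc : ‖c‖ ≤ p) :
    (fun z : ℤ_[p] => c * ∑ i ∈ insert p (range (n + 1)), emb p E (lam i) * regLog E n i z -
      p * c * ∑ a ∈ Icc 1 (p - 1), (a : E)⁻¹ * emb p E z ^ n * ballMono E 0 (a : ℤ_[p]) 1 z) ∈
      scaleLat π (latZero sqrtp r L) := by
  classical
  have h := ((isCsLattice_latZero (p := p) hr sqrtp L).scaleLat
    (norm_pos_iff.mp (hπ.norm_pos p))).sum_mem (range p) fun a ha =>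
    tsum_regCoeff_mem hp hsqrtp hπ hr hn hnr hrp L hlam_p hlam hc (mem_range.mp ha)
  convert h using 1
  ext z
  obtain ⟨a, ha, hz⟩ := exists_digit z
  rw [Finset.sum_apply, sum_eq_single_of_mem a (mem_range.mpr ha)]
  · refine (HasSum.tsum_eq ?_).symm
    have h1 := ((hasSum_regCoeff (n := n) (lam := lam) hz).map
      (algebraMap ℚ_[p] E) (continuous_algebraMap _ _)).mul_left c
    have e1 : c * algebraMap ℚ_[p] E (∑ i ∈ insert p (range (n + 1)), (lam i : ℚ_[p]) *
        (if (p : ℤ_[p]) ∣ z - (i : ℕ) then 0 else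
        ((z - (i : ℕ) : ℤ_[p]) : ℚ_[p]) ^ n * lg p (z - (i : ℕ) : ℤ_[p])) -
        if a = 0 then 0 else p * (a : ℚ_[p])⁻¹ * (z : ℚ_[p]) ^ n) =
        c * ∑ i ∈ insert p (range (n + 1)), emb p E (lam i) * regLog E n i z -
        p * c * ∑ a ∈ Icc 1 (p - 1), (a : E)⁻¹ * emb p E z ^ n * ballMono E 0 (a : ℤ_[p]) 1 z := by
      rw [map_sub, map_sum, mul_sub]
      congr 1
      · congr 1
        refine sum_congr rfl fun i _ => ?_
        rw [regLog, map_mul, emb_apply]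
        split_ifs
        · rw [map_zero]
        · rw [map_mul, map_pow, emb_apply]
      · have e2 : ∀ b ∈ Icc 1 (p - 1), (b : E)⁻¹ * emb p E z ^ n * ballMono E 0 (b : ℤ_[p]) 1 z =
            if b = a then (b : E)⁻¹ * emb p E z ^ n else 0 := fun b hb => by
          have := mem_Icc.mp hb
          rw [ballMono_zero_natCast ha (by omega) hz]
          split_ifs <;> simp
        rw [sum_congr rfl e2, sum_ite_eq']
        by_cases h0 : a = 0
        · rw [if_pos h0, if_neg (by simp [h0]), map_zero, mul_zero, mul_zero]
        · rw [if_neg h0, if_pos (by rw [mem_Icc]; omega), map_mul, map_mul, map_pow, map_inv₀,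
            map_natCast, map_natCast, emb_apply]
          ring
    rw [e1] at h1
    refine (iff_of_eq (congr_arg (HasSum · _) (funext fun j => ?_))).mpr h1
    rw [ballMono_of_dvd (by rwa [pow_one]), emb_apply, Function.comp_apply, map_mul, map_pow,
      mul_assoc]
  · intro b hb hba
    have h0 : ∀ j, ballMono E j (b : ℤ_[p]) 1 z = 0 := fun j =>
      ballMono_of_not_dvd fun hd =>
        hba (digit_unique (mem_range.mp hb) ha (by rwa [pow_one] at hd) hz)
    simp [h0]

end Regular

/-! ### The part of g carrying the valuation and 𝓛. -/

section Singular

variable {p : ℕ} [Fact p.Prime] {E : Type*} [NormedField E] [NormedAlgebra ℚ_[p] E]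

/-- The valuation of z-α is the number of balls α+p^h ℤ_p, h ≥ 1, that contain z. At z = α every
term is 0, since n ≠ 0. -/
theorem hasSum_ballMono {n : ℕ} (hn : n ≠ 0) (α z : ℤ_[p]) :
    HasSum (fun h : ℕ => ballMono E n α (h + 1) z) (singVal E n α z) := by
  classical
  rw [singVal]
  rcases eq_or_ne (z - α) 0 with h0 | h0
  · have : ∀ h : ℕ, ballMono E n α (h + 1) z = 0 := fun h => by
      rw [ballMono_of_dvd (by rw [h0]; exact dvd_zero _), h0, map_zero, zero_pow hn]
    simpa [this, h0, hn] using hasSum_zero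
  have hiff : ∀ h : ℕ, (p : ℤ_[p]) ^ h ∣ z - α ↔ h ≤ (z - α).valuation := fun h => by
    rw [← norm_le_rpow_iff_dvd, Real.rpow_neg prime_pos.le, Real.rpow_natCast,
      ← zpow_natCast, ← zpow_neg, PadicInt.norm_le_pow_iff_le_valuation _ h0]
  have hsum : HasSum (fun h : ℕ => ballMono E n α (h + 1) z)
      (∑ h ∈ range (z - α).valuation, ballMono E n α (h + 1) z) :=
    hasSum_sum_of_ne_finset_zero fun h hh => ballMono_of_not_dvd fun hd => hh <| by
      have := (hiff _).mp hd
      exact mem_range.mpr (by omega)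
  convert hsum using 1
  rw [sum_congr rfl fun h hh => ballMono_of_dvd
    ((hiff (h + 1)).mpr (Nat.succ_le_of_lt (mem_range.mp hh))), sum_const, card_range,
    nsmul_eq_mul, mul_comm]
  split_ifs with hd
  · rfl
  · have : ¬ 1 ≤ (z - α).valuation := by rwa [← hiff, pow_one]
    rw [Nat.lt_one_iff.mp (not_le.mp this), Nat.cast_zero, zero_mul]

variable [IsUltrametricDist E] [CompleteSpace E] {sqrtp π : E} {r n : ℕ}

/-- The allowed size of c is p^{n-r/2}, just at the limit for level 1. At levels h ≥ 2 the criterion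
allows p^{h(n-r/2)}, so those terms are negligible. -/
theorem singVal_sub_mem (hsqrtp : sqrtp ^ 2 = (p : E)) (hπ : IsUniformizer π)
    (hr : 0 < r) (hn : (r : ℝ) / 2 + 1 < n) (L : E) {c : E}
    (hc : ‖c‖ ≤ (p : ℝ) ^ ((n : ℝ) - r / 2)) (α : ℤ_[p]) :
    c • (singVal E n α - ballMono E n α 1) ∈ scaleLat π (latZero sqrtp r L) := by
  have hn0 : n ≠ 0 := by
    rintro rfl
    have : (0 : ℝ) ≤ r := Nat.cast_nonneg r
    norm_num at hn
    linarith
  have h := tsum_mem_scaleLat_latZero hsqrtp hπ hr L (j := fun _ : ℕ => n) (h := fun h => h + 2)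
    (α := fun _ => α) (c := fun _ => c) (fun h => ?_) ?_
  · convert h using 1
    ext z
    have h1 := (hasSum_nat_add_iff' 1).mpr ((hasSum_ballMono (E := E) hn0 α z).mul_left c)
    rw [h1.tsum_eq]
    simp [mul_sub]
  · refine IsSmall.of_le_right hc ?_
    have : (0 : ℝ) ≤ h := Nat.cast_nonneg h
    push_cast
    nlinarith
  · refine tendsto_zero_of_le_rpow (p := p) (k := fun j => j) (C := 0)
      (fun i => by positivity) (fun h => ?_) fun B => Set.finite_Iio B
    calc _ ≤ _ := mul_le_mul_of_nonneg_right hc (Real.rpow_nonneg prime_pos.le _)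
      _ ≤ _ := by
        rw [← Real.rpow_add prime_pos]
        refine Real.rpow_le_rpow_of_exponent_le one_lt_prime.le ?_
        have : (0 : ℝ) ≤ h := Nat.cast_nonneg h
        push_cast
        nlinarith

theorem ballMono_sub_ballMono_prime (n : ℕ) (z : ℤ_[p]) :
    ballMono E n 0 1 z - ballMono E n (p : ℤ_[p]) 1 z =
      -∑ j ∈ range n, (n.choose j : E) * (-(p : E)) ^ (n - j) * ballMono E j 0 1 z := by
  by_cases hz : (p : ℤ_[p]) ^ 1 ∣ z - 0
  · have hz' : (p : ℤ_[p]) ^ 1 ∣ z - p := by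
      rw [sub_zero] at hz
      rw [pow_one] at hz ⊢
      exact dvd_sub hz dvd_rfl
    rw [ballMono_of_dvd hz', ballMono_expand hz, sum_range_succ, zero_sub, map_neg, map_natCast]
    simp
  · have hz' : ¬ (p : ℤ_[p]) ^ 1 ∣ z - p := fun hd => hz <| by
      rw [sub_zero]
      rw [pow_one] at hd ⊢
      exact (dvd_sub_self_right).mp hd
    simp [ballMono_of_not_dvd hz, ballMono_of_not_dvd hz']

variable {lam : ℕ → ℤ_[p]}

/-- The bound at level 1 is attained, so a factor p in the coefficient is enough. This removes the
nodes 1, ..., n and replaces λ_0 by 1, leaving z^n-(z-p)^n on pℤ_p. In its binomial expansion the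
terms with j < r/2 have norm at most p^{j-r/2} < 1 and are negligible by the direct criterion. -/
theorem sum_singVal_sub_mem (hsqrtp : sqrtp ^ 2 = (p : E)) (hπ : IsUniformizer π)
    (hr : 0 < r) (hn : (r : ℝ) / 2 + 1 < n) (hnr : n ≤ r) (hrp : r < p) (L : E)
    (hlam_p : lam p = -1)
    (hlam : ∀ j ≤ n, ∑ i ∈ insert p (range (n + 1)), lam i * (i : ℤ_[p]) ^ j = 0)
    {c : E} (hc : ‖c‖ ≤ (p : ℝ) ^ ((n : ℝ) - r / 2)) :
    (fun z : ℤ_[p] => c * ∑ i ∈ insert p (range (n + 1)), emb p E (lam i) * singVal E n (i : ℕ) z -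
      ∑ j ∈ Ico ⌈(r : ℝ) / 2⌉₊ n, -(c * ((n.choose j : E) * (-(p : E)) ^ (n - j))) *
        ballMono E j 0 1 z) ∈ scaleLat π (latZero sqrtp r L) := by
  have hK := (isCsLattice_latZero (p := p) hr sqrtp L).scaleLat (norm_pos_iff.mp (hπ.norm_pos p))
  have hmul : ∀ x : ℤ_[p], ‖c * emb p E x‖ ≤ (p : ℝ) ^ ((n : ℝ) - r / 2) := fun x => by
    rw [norm_mul, norm_emb]
    exact (mul_le_of_le_one_right (norm_nonneg _) (PadicInt.norm_le_one x)).trans hc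
  have hmul' : ∀ x : ℤ_[p], (p : ℤ_[p]) ∣ x → ∀ α : ℤ_[p],
      (c * emb p E x) • ballMono E n α 1 ∈ scaleLat π (latZero sqrtp r L) := fun x hx α => by
    refine (IsSmall.of_le_right (p := p) (e := (n : ℝ) - r / 2 - 1) ?_ ?_).smul_mem hsqrtp hπ hr L α
    · rw [norm_mul, norm_emb, Real.rpow_sub prime_pos, Real.rpow_one, div_eq_mul_inv,
        PadicInt.norm_def]
      gcongr
      exact norm_coe_le_inv_of_dvd hx
    · push_cast
      linarith
  have h1 := hK.sum_mem (insert p (range (n + 1))) fun i _ =>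
    singVal_sub_mem hsqrtp hπ hr hn L (hmul (lam i)) ((i : ℕ) : ℤ_[p])
  have h2 := hK.sum_mem (range n) fun i hi => hmul' (lam (i + 1)) (prime_dvd_coeff
    (hnr.trans_lt hrp) hlam_p hlam i.succ_ne_zero (by have := mem_range.mp hi; omega))
    ((i + 1 : ℕ) : ℤ_[p])
  have h3 := hmul' _ (prime_dvd_coeff_zero_sub_one (hnr.trans_lt hrp) hlam_p hlam) 0
  have h4 : ∑ j ∈ range ⌈(r : ℝ) / 2⌉₊, (-(c * ((n.choose j : E) * (-(p : E)) ^ (n - j)))) •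
      ballMono E j (0 : ℤ_[p]) 1 ∈ scaleLat π (latZero sqrtp r L) := by
    refine hK.sum_mem _ fun j hj => ?_
    have hj' : (j : ℝ) < r / 2 := Nat.lt_ceil.mp (mem_range.mp hj)
    have hjn : j ≤ n := by
      have : (j : ℝ) < n := by linarith
      exact_mod_cast this.le
    refine (IsSmall.of_le_left (p := p) (hjn.trans hnr) (e := (j : ℝ) - r / 2) ?_ ?_).smul_mem
      hsqrtp hπ hr L 0
    · have e : (j : ℝ) - r / 2 = ((n : ℝ) - r / 2) - ((n - j : ℕ) : ℝ) := by
        rw [Nat.cast_sub hjn]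
        ring
      rw [norm_neg, norm_mul, norm_mul, norm_pow, norm_neg, norm_prime_field (p := p), e,
        Real.rpow_sub prime_pos, Real.rpow_natCast, div_eq_mul_inv, inv_pow]
      refine mul_le_mul hc ?_ (by positivity) (Real.rpow_nonneg prime_pos.le _)
      exact mul_le_of_le_one_left (by positivity) (norm_natCast_le_one' _)
    · push_cast
      linarith
  have hceil : ⌈(r : ℝ) / 2⌉₊ ≤ n := Nat.ceil_le.mpr (by linarith)
  convert hK.add_mem (hK.add_mem (hK.add_mem h1 h2) h3) h4 using 1
  ext z
  have hpn : p ∉ range (n + 1) := by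
    rw [mem_range]
    omega
  have e1 := ballMono_sub_ballMono_prime (E := E) n z
  rw [← sum_range_add_sum_Ico _ hceil] at e1
  simp only [Pi.add_apply, Finset.sum_apply, Pi.smul_apply, Pi.sub_apply, smul_eq_mul, mul_sub,
    sum_sub_distrib]
  rw [sum_insert hpn (f := fun i => c * emb p E (lam i) * ballMono E n ((i : ℕ) : ℤ_[p]) 1 z),
    sum_range_succ' (fun i => c * emb p E (lam i) * ballMono E n ((i : ℕ) : ℤ_[p]) 1 z), hlam_p,
    mul_sum]
  simp only [map_neg, map_one, map_sub, Nat.cast_zero, neg_mul, sum_neg_distrib, mul_assoc,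
    ← mul_sum]
  simp only [mul_assoc] at e1
  linear_combination c * e1

end Singular

/-! ### The expansion of g at infinity. -/

section Infinity

variable {p : ℕ} [Fact p.Prime] {n : ℕ} {lam : ℕ → ℤ_[p]}

theorem sum_mul_coe_pow_eq_zero
    (hlam : ∀ j ≤ n, ∑ i ∈ insert p (range (n + 1)), lam i * (i : ℤ_[p]) ^ j = 0)
    {j : ℕ} (hj : j ≤ n) :
    ∑ i ∈ insert p (range (n + 1)), (lam i : ℚ_[p]) * (-(i : ℚ_[p])) ^ j = 0 := by
  have h := congrArg (fun x : ℤ_[p] => (-1 : ℚ_[p]) ^ j * (x : ℚ_[p])) (hlam j hj)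
  simp only [PadicInt.coe_sum, PadicInt.coe_mul, PadicInt.coe_pow, PadicInt.coe_natCast,
    PadicInt.coe_zero, mul_zero, mul_sum] at h
  rw [← h]
  refine sum_congr rfl fun i _ => ?_
  rw [neg_pow]
  ring

theorem sum_mul_coe_sub_pow_eq_zero
    (hlam : ∀ j ≤ n, ∑ i ∈ insert p (range (n + 1)), lam i * (i : ℤ_[p]) ^ j = 0)
    (z : ℚ_[p]) :
    ∑ i ∈ insert p (range (n + 1)), (lam i : ℚ_[p]) * (z - i) ^ n = 0 := by
  simp_rw [sub_eq_neg_add, add_pow, mul_sum]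
  rw [sum_comm]
  refine sum_eq_zero fun j hj => ?_
  rw [← mul_zero (z ^ (n - j) * (n.choose j : ℚ_[p])),
    ← sum_mul_coe_pow_eq_zero hlam (Nat.lt_succ_iff.mp (mem_range.mp hj)), mul_sum]
  exact sum_congr rfl fun i _ => by ring

variable (p n lam) in
/-- The coefficients of the expansion at infinity of the sum of the
`λ_i (z - i) ^ n * log (z - i)`. -/
def inftyCoeff (m : ℕ) : ℚ_[p] :=
  powLogCoeff p n (m + (n + 1)) *
    ∑ i ∈ insert p (range (n + 1)), (lam i : ℚ_[p]) * (-(i : ℚ_[p])) ^ (m + (n + 1))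

theorem norm_inftyCoeff_le (m : ℕ) :
    ‖inftyCoeff p n lam m‖ ≤ (p : ℝ) ^ (Nat.log p (m + (n + 1))) := by
  rw [inftyCoeff, norm_mul]
  refine (mul_le_of_le_one_right (norm_nonneg _) ?_).trans (norm_powLogCoeff_le _ _)
  refine IsUltrametricDist.norm_sum_le_of_forall_le_of_nonneg zero_le_one fun i _ => ?_
  rw [norm_mul, norm_pow, norm_neg]
  exact mul_le_one₀ (PadicInt.norm_le_one (lam i)) (by positivity)
    (pow_le_one₀ (norm_nonneg _) (norm_natCast_le_one' _))

theorem norm_natCast_lt {z : ℚ_[p]} (hz : 1 < ‖z‖) (i : ℕ) : ‖-(i : ℚ_[p])‖ < ‖z‖ := by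
  rw [norm_neg]
  exact (norm_natCast_le_one' _).trans_lt hz

/-- Since the sum of λ_i (z-i)^n is 0, lg(z-i) may be replaced by lg(z-i)-lg z, a power series in
i/z. The coefficient of z^{n-j} contains the sum of λ_i (-i)^j, which vanishes for j ≤ n, so the
expansion starts at z^{-1}. -/
theorem hasSum_inftyCoeff
    (hlam : ∀ j ≤ n, ∑ i ∈ insert p (range (n + 1)), lam i * (i : ℤ_[p]) ^ j = 0)
    {z : ℚ_[p]} (hz : 1 < ‖z‖) :
    HasSum (fun m : ℕ => inftyCoeff p n lam m * z⁻¹ ^ (m + 1))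
      (∑ i ∈ insert p (range (n + 1)), (lam i : ℚ_[p]) * (z - i) ^ n * lg p (z - i)) := by
  have hz0 : z ≠ 0 := norm_pos_iff.mp (one_pos.trans hz)
  have h1 := hasSum_sum (s := insert p (range (n + 1))) fun i _ =>
    (hasSum_pow_mul_lg_sub n hz0 (norm_natCast_lt hz i)).mul_left (lam i : ℚ_[p])
  have e1 : ∑ i ∈ insert p (range (n + 1)), (lam i : ℚ_[p]) *
      ((z + -(i : ℚ_[p])) ^ n * (lg p (z + -(i : ℚ_[p])) - lg p z)) =
      ∑ i ∈ insert p (range (n + 1)), (lam i : ℚ_[p]) * (z - i) ^ n * lg p (z - i) := by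
    simp_rw [← sub_eq_add_neg, mul_sub, ← mul_assoc]
    rw [sum_sub_distrib, ← sum_mul, sum_mul_coe_sub_pow_eq_zero hlam, zero_mul, sub_zero]
  rw [e1] at h1
  have e2 : ∀ j : ℕ, ∑ i ∈ insert p (range (n + 1)), (lam i : ℚ_[p]) *
      (powLogCoeff p n j * z ^ ((n : ℤ) - j) * (-(i : ℚ_[p])) ^ j) =
      powLogCoeff p n j * z ^ ((n : ℤ) - j) *
        ∑ i ∈ insert p (range (n + 1)), (lam i : ℚ_[p]) * (-(i : ℚ_[p])) ^ j := fun j => by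
    rw [mul_sum]
    exact sum_congr rfl fun i _ => by ring
  simp_rw [e2] at h1
  have h2 := (hasSum_nat_add_iff' (n + 1)).mpr h1
  have h3 : ∑ j ∈ range (n + 1), powLogCoeff p n j * z ^ ((n : ℤ) - j) *
      ∑ i ∈ insert p (range (n + 1)), (lam i : ℚ_[p]) * (-(i : ℚ_[p])) ^ j = 0 :=
    sum_eq_zero fun j hj => by
      rw [sum_mul_coe_pow_eq_zero hlam (Nat.lt_succ_iff.mp (mem_range.mp hj)), mul_zero]
  rw [h3, sub_zero] at h2
  refine (iff_of_eq (congr_arg (HasSum · _) (funext fun m => ?_))).mpr h2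
  have e3 : (n : ℤ) - ((m + (n + 1) : ℕ) : ℤ) = -((m + 1 : ℕ) : ℤ) := by
    push_cast
    ring
  rw [inftyCoeff, e3, zpow_neg, zpow_natCast, inv_pow]
  ring

variable {E : Type*} [NormedField E] [NormedAlgebra ℚ_[p] E] [IsUltrametricDist E] [CompleteSpace E]
  {sqrtp π : E} {r : ℕ}

/-- For |z| > 1 all the z-i have the valuation of z, so 𝓛 multiplies the sum of λ_i (z-i)^n, which
is 0. -/
theorem sum_mul_logL
    (hlam : ∀ j ≤ n, ∑ i ∈ insert p (range (n + 1)), lam i * (i : ℤ_[p]) ^ j = 0)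
    (L : E) {z : ℚ_[p]} (hz : 1 < ‖z‖) :
    ∑ i ∈ insert p (range (n + 1)), algebraMap ℚ_[p] E (lam i : ℚ_[p]) *
      algebraMap ℚ_[p] E (z - (i : ℚ_[p])) ^ n * logL p L (z - (i : ℚ_[p])) =
    algebraMap ℚ_[p] E (∑ i ∈ insert p (range (n + 1)),
      (lam i : ℚ_[p]) * (z - i) ^ n * lg p (z - i)) := by
  have hz0 : z ≠ 0 := norm_pos_iff.mp (one_pos.trans hz)
  have hval : ∀ i : ℕ, (z - (i : ℚ_[p])).valuation = z.valuation := fun i => by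
    have h1 := norm_add_eq_left (norm_natCast_lt hz i)
    rw [← sub_eq_add_neg] at h1
    exact valuation_eq_of_norm_eq (norm_pos_iff.mp (by rw [h1]; exact one_pos.trans hz)) hz0 h1
  have h0 := congrArg (algebraMap ℚ_[p] E) (sum_mul_coe_sub_pow_eq_zero hlam z)
  rw [map_sum, map_zero] at h0
  have h1 : ∀ i : ℕ, algebraMap ℚ_[p] E (lam i : ℚ_[p]) *
      algebraMap ℚ_[p] E (z - (i : ℚ_[p])) ^ n * logL p L (z - (i : ℚ_[p])) =
      algebraMap ℚ_[p] E ((lam i : ℚ_[p]) * (z - i) ^ n) * ((z.valuation : E) * L) +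
      algebraMap ℚ_[p] E ((lam i : ℚ_[p]) * (z - i) ^ n * lg p (z - i)) := fun i => by
    simp only [logL, hval, lg, map_mul, map_pow]
    ring
  rw [sum_congr rfl fun i _ => h1 i, sum_add_distrib, ← sum_mul, h0, zero_mul, zero_add, map_sum]

theorem extInfty_tsum_inftyCoeff
    (hlam : ∀ j ≤ n, ∑ i ∈ insert p (range (n + 1)), lam i * (i : ℤ_[p]) ^ j = 0)
    (r : ℕ) (L c : E) {z : ℚ_[p]} (hz : 1 < ‖z‖) :
    extInfty r (fun w => ∑' m : ℕ, c * algebraMap ℚ_[p] E (inftyCoeff p n lam m) *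
      ballMono E (r + 1 + m) 0 1 w) z =
    c * ∑ i ∈ insert p (range (n + 1)), algebraMap ℚ_[p] E (lam i : ℚ_[p]) *
      algebraMap ℚ_[p] E (z - (i : ℚ_[p])) ^ n * logL p L (z - (i : ℚ_[p])) := by
  have hz0 : z ≠ 0 := norm_pos_iff.mp (one_pos.trans hz)
  rw [extInfty_of_lt hz, sum_mul_logL hlam L hz, ← tsum_mul_left]
  refine HasSum.tsum_eq ?_
  have h1 := ((hasSum_inftyCoeff hlam hz).map
    (algebraMap ℚ_[p] E) (continuous_algebraMap _ _)).mul_left c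
  refine (iff_of_eq (congr_arg (HasSum · _) (funext fun m => ?_))).mpr h1
  have hd : (p : ℤ_[p]) ^ 1 ∣ toInt z⁻¹ (norm_inv_le_one hz) - 0 := by
    rw [sub_zero, ← norm_lt_one_iff_pow_dvd, PadicInt.norm_def, coe_toInt, norm_inv]
    exact inv_lt_one_of_one_lt₀ hz
  have hzE : algebraMap ℚ_[p] E z ≠ 0 := (map_ne_zero _).mpr hz0
  rw [ballMono_of_dvd hd, sub_zero, emb_apply, coe_toInt, Function.comp_apply, map_mul, map_pow,
    map_inv₀, add_assoc, pow_add _ r, inv_pow _ r, add_comm 1 m]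
  field_simp

/-- In the coordinate 1/z the degrees are r+1+m, so the criterion at level 1 allows norms below
p^{r/2+1+m}, while the coefficients grow at most like p^{1+(r+m)/4}. -/
theorem tsum_inftyCoeff_mem (hp : 5 ≤ p) (hsqrtp : sqrtp ^ 2 = (p : E)) (hπ : IsUniformizer π)
    (hr : 0 < r) (hnr : n ≤ r) (L : E) {c : E} (hc : ‖c‖ ≤ p) :
    (fun w : ℤ_[p] => ∑' m : ℕ, c * algebraMap ℚ_[p] E (inftyCoeff p n lam m) *
      ballMono E (r + 1 + m) 0 1 w) ∈ scaleLat π (latInfty sqrtp r L) := by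
  have hgen : ∀ m, ‖c * algebraMap ℚ_[p] E (inftyCoeff p n lam m)‖ ≤
      (p : ℝ) ^ (1 + ((r : ℝ) + m) / 4) := fun m => by
    have h1 : ‖c * algebraMap ℚ_[p] E (inftyCoeff p n lam m)‖ ≤
        (p : ℝ) ^ (1 + (Nat.log p (m + (n + 1)) : ℝ)) := by
      rw [norm_mul, norm_algebraMap', Real.rpow_add prime_pos, Real.rpow_one, Real.rpow_natCast]
      gcongr
      exact norm_inftyCoeff_le m
    refine h1.trans (Real.rpow_le_rpow_of_exponent_le one_lt_prime.le ?_)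
    have h2 := four_mul_log_lt hp (j := m + (n + 1)) (by omega)
    have h3 : (n : ℝ) ≤ r := by exact_mod_cast hnr
    push_cast at h2
    linarith
  have hr1 : (1 : ℝ) ≤ r := by exact_mod_cast hr
  refine tsum_mem_scaleLat_latInfty hsqrtp hπ hr L (fun m => by omega) (fun m => ?_) ?_
  · refine (hgen m).trans_lt (Real.rpow_lt_rpow_of_exponent_lt one_lt_prime ?_)
    have : (0 : ℝ) ≤ m := Nat.cast_nonneg m
    push_cast
    linarith
  · refine tendsto_zero_of_le_rpow (p := p) (k := fun j => j) (C := 0)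
      (fun i => by positivity) (fun m => ?_) fun B => Set.finite_Iio B
    calc _ ≤ _ := mul_le_mul_of_nonneg_right (hgen m) (Real.rpow_nonneg prime_pos.le _)
      _ ≤ _ := by
        rw [← Real.rpow_add prime_pos]
        refine Real.rpow_le_rpow_of_exponent_le one_lt_prime.le ?_
        have : (0 : ℝ) ≤ m := Nat.cast_nonneg m
        push_cast
        linarith

end Infinity

/-! ### Assembly of the pieces. -/

section Main

variable {p : ℕ} [Fact p.Prime] {E : Type*} [NormedField E] [NormedAlgebra ℚ_[p] E]

theorem mul_logL_eq (n : ℕ) (L : E) (z : ℤ_[p]) (i : ℕ) :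
    algebraMap ℚ_[p] E ((z : ℚ_[p]) - i) ^ n * logL p L ((z : ℚ_[p]) - i) =
      singLog E n (i : ℤ_[p]) z + L * singVal E n (i : ℤ_[p]) z + regLog E n i z := by
  have e1 : (z : ℚ_[p]) - i = ((z - (i : ℕ) : ℤ_[p]) : ℚ_[p]) := by push_cast; rfl
  have e2 : logL p L ((z : ℚ_[p]) - i) = ((z - (i : ℕ) : ℤ_[p]).valuation : E) * L +
      algebraMap ℚ_[p] E (lg p ((z - (i : ℕ) : ℤ_[p]) : ℚ_[p])) := by
    rw [e1, logL, lg, PadicInt.valuation_coe, Int.cast_natCast]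
  rw [e2, e1, ← emb_apply, singLog, singVal, regLog]
  by_cases hd : (p : ℤ_[p]) ∣ z - (i : ℕ)
  · rw [if_pos hd, if_pos hd, if_pos hd]
    ring
  · rw [if_neg hd, if_neg hd, if_neg hd]
    have h0 : z - (i : ℕ) ≠ 0 := fun h => hd (h ▸ dvd_zero _)
    have h1 : (z - (i : ℕ) : ℤ_[p]).valuation = 0 := by
      by_contra h
      refine hd ?_
      have := (PadicInt.norm_le_pow_iff_le_valuation _ h0 1).mpr (Nat.one_le_iff_ne_zero.mpr h)
      have h2 := (norm_le_rpow_iff_dvd (z - (i : ℕ) : ℤ_[p]) 1).mp (by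
        rwa [Real.rpow_neg prime_pos.le, Real.rpow_natCast, ← zpow_natCast, ← zpow_neg])
      rwa [pow_one] at h2
    rw [h1, Nat.cast_zero]
    ring

theorem indBall_eq_ballMono (a : ℕ) {z : ℚ_[p]} (hz : ‖z‖ ≤ 1) :
    indBall p E (a : ℚ_[p]) z = ballMono E 0 (a : ℤ_[p]) 1 (toInt z hz) := by
  have h : ‖z - a‖ < 1 ↔ (p : ℤ_[p]) ^ 1 ∣ toInt z hz - (a : ℤ_[p]) := by
    rw [← norm_lt_one_iff_pow_dvd, PadicInt.norm_def, PadicInt.coe_sub, coe_toInt,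
      PadicInt.coe_natCast]
  rw [indBall]
  split_ifs with h'
  · rw [ballMono_of_dvd (h.mp h'), pow_zero]
  · rw [ballMono_of_not_dvd (mt h.mpr h')]

variable [IsUltrametricDist E]

theorem indBall_of_lt (a : ℕ) {z : ℚ_[p]} (hz : 1 < ‖z‖) : indBall p E (a : ℚ_[p]) z = 0 := by
  rw [indBall, if_neg]
  rw [sub_eq_add_neg, norm_add_eq_left (norm_natCast_lt hz a)]
  exact hz.not_gt

variable (p) in
/-- The restriction to `ℤ_p` of the locally polynomial function of the theorem. -/
def locPoly (r n : ℕ) (c L : E) (z : ℤ_[p]) : E :=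
  p * c * ∑ a ∈ Icc 1 (p - 1), (a : E)⁻¹ * emb p E z ^ n * ballMono E 0 (a : ℤ_[p]) 1 z +
    ∑ j ∈ Ico ⌈(r : ℝ) / 2⌉₊ n, -(c * L * ((n.choose j : E) * (-(p : E)) ^ (n - j))) *
      ballMono E j (0 : ℤ_[p]) 1 z

theorem pow_mul_ballMono_zero (n : ℕ) (α z : ℤ_[p]) :
    emb p E z ^ n * ballMono E 0 α 1 z = ∑ j ∈ range (n + 1),
      ((n.choose j : E) * emb p E α ^ (n - j)) * ballMono E j α 1 z := by
  by_cases hd : (p : ℤ_[p]) ^ 1 ∣ z - α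
  · have h := ballMono_expand (E := E) (M := n) (α := 0) hd
    rw [sub_zero, sub_zero] at h
    rw [h, ballMono_of_dvd (M := 0) hd, pow_zero, mul_one]
  · simp [ballMono_of_not_dvd hd]

theorem exists_csBound_smul_ballMono {s : ℝ} (hs : 0 < s) (c : E) (j : ℕ) (α : ℤ_[p]) (h : ℕ) :
    ∃ C, CsBound s (c • ballMono E j α h) C :=
  ⟨_, (CsBound.ballMono hs j α h).smul c⟩

theorem exists_csBound_sum {s : ℝ} {ι : Type*} (t : Finset ι) {f : ι → ℤ_[p] → E}
    (hf : ∀ i ∈ t, ∃ C, CsBound s (f i) C) : ∃ C, CsBound s (∑ i ∈ t, f i) C :=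
  sum_induction f (fun g => ∃ C, CsBound s g C)
    (fun _ _ ⟨C, h⟩ ⟨C', h'⟩ => ⟨max C C',
      (h.mono (le_max_left _ _)).add (h'.mono (le_max_right _ _))⟩) ⟨0, CsBound.zero _ le_rfl⟩ hf

theorem exists_csBound_locPoly {r : ℕ} (hr : 0 < r) (n : ℕ) (c L : E) :
    ∃ C, CsBound ((r : ℝ) / 2) (locPoly p r n c L) C := by
  have hs := half_pos_of_pos hr
  have h1 := exists_csBound_sum (Icc 1 (p - 1)) fun a _ =>
    exists_csBound_sum (range (n + 1)) fun j _ => exists_csBound_smul_ballMono (E := E) (p := p) hs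
      (p * c * (a : E)⁻¹ * ((n.choose j : E) * emb p E (a : ℕ) ^ (n - j))) j ((a : ℕ) : ℤ_[p]) 1
  have h2 := exists_csBound_sum (Ico ⌈(r : ℝ) / 2⌉₊ n) fun j _ =>
    exists_csBound_smul_ballMono (E := E) (p := p) hs
      (-(c * L * ((n.choose j : E) * (-(p : E)) ^ (n - j)))) j 0 1
  obtain ⟨C, h1⟩ := h1
  obtain ⟨C', h2⟩ := h2
  refine ⟨max C C', ?_⟩
  convert (h1.mono (le_max_left _ _)).add (h2.mono (le_max_right _ _)) using 1
  ext z
  simp only [locPoly, Pi.add_apply, Finset.sum_apply, Pi.smul_apply, smul_eq_mul, mul_sum]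
  congr 1
  refine sum_congr rfl fun a _ => ?_
  rw [mul_assoc (a : E)⁻¹, pow_mul_ballMono_zero, mul_sum, mul_sum]
  exact sum_congr rfl fun j _ => by ring

theorem extZero_locPoly (r n : ℕ) (c L : E) (z : ℚ_[p]) :
    extZero (locPoly p r n c L) z =
      (p : E) * c * (∑ a ∈ Icc 1 (p - 1),
          (a : E)⁻¹ * algebraMap ℚ_[p] E z ^ n * indBall p E (a : ℚ_[p]) z) +
        ∑ j ∈ Ico ⌈(r : ℝ) / 2⌉₊ n,
          (-1 : E) ^ (n - j + 1) * (n.choose j : E) * (c * (p : E) ^ (n - j)) * L *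
            algebraMap ℚ_[p] E z ^ j * indBall p E 0 z := by
  have h0 : ∀ h : ‖z‖ ≤ 1, indBall p E 0 z = ballMono E 0 0 1 (toInt z h) := fun h => by
    simpa using indBall_eq_ballMono (E := E) 0 h
  have h0' : 1 < ‖z‖ → indBall p E 0 z = 0 := fun h => by
    simpa using indBall_of_lt (E := E) 0 h
  by_cases hz : ‖z‖ ≤ 1
  · rw [extZero_of_le hz, locPoly]
    congr 1
    · congr 1
      refine sum_congr rfl fun a _ => ?_
      rw [indBall_eq_ballMono a hz, emb_apply, coe_toInt]
    · refine sum_congr rfl fun j _ => ?_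
      have h1 : ballMono E j 0 1 (toInt z hz) =
          algebraMap ℚ_[p] E z ^ j * ballMono E 0 0 1 (toInt z hz) := by
        by_cases hd : (p : ℤ_[p]) ^ 1 ∣ toInt z hz - 0
        · rw [ballMono_of_dvd hd, ballMono_of_dvd hd, sub_zero, pow_zero, mul_one, emb_apply,
            coe_toInt]
        · rw [ballMono_of_not_dvd hd, ballMono_of_not_dvd hd, mul_zero]
      rw [h0 hz, neg_pow (p : E), pow_succ, h1]
      ring
  · have hz := not_le.mp hz
    rw [extZero_of_lt hz, h0' hz]
    simp [indBall_of_lt _ hz]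

variable [CompleteSpace E] {sqrtp π : E} {r n : ℕ} {lam : ℕ → ℤ_[p]}

theorem sum_mul_logL_sub_locPoly_mem (hp : 5 ≤ p) (hsqrtp : sqrtp ^ 2 = (p : E))
    (hπ : IsUniformizer π) (hr : 0 < r) (hn : (r : ℝ) / 2 + 1 < n) (hnr : n ≤ r) (hrp : r < p)
    (hlam_p : lam p = -1)
    (hlam : ∀ j ≤ n, ∑ i ∈ insert p (range (n + 1)), lam i * (i : ℤ_[p]) ^ j = 0)
    {c L : E} (hc : ‖c‖ ≤ p) (hcL : ‖c * L‖ ≤ (p : ℝ) ^ ((n : ℝ) - r / 2)) :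
    (fun z : ℤ_[p] => c * ∑ i ∈ insert p (range (n + 1)), algebraMap ℚ_[p] E (lam i : ℚ_[p]) *
      algebraMap ℚ_[p] E ((z : ℚ_[p]) - i) ^ n * logL p L ((z : ℚ_[p]) - i) -
      locPoly p r n c L z) ∈ scaleLat π (latZero sqrtp r L) := by
  have hK := (isCsLattice_latZero (p := p) hr sqrtp L).scaleLat (norm_pos_iff.mp (hπ.norm_pos p))
  have hmul : ∀ x : ℤ_[p], ‖c * emb p E x‖ ≤ p := fun x => by
    rw [norm_mul, norm_emb]
    exact (mul_le_of_le_one_right (norm_nonneg _) (PadicInt.norm_le_one x)).trans hc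
  have h1 := hK.sum_mem (insert p (range (n + 1))) fun i _ =>
    singLog_mem hp hsqrtp hπ hn hnr hrp L (hmul (lam i)) ((i : ℕ) : ℤ_[p])
  have h2 := sum_singVal_sub_mem hsqrtp hπ hr hn hnr hrp L hlam_p hlam hcL
  have h3 := regLog_sub_mem hp hsqrtp hπ hr hn hnr hrp L hlam_p hlam hc
  convert hK.add_mem (hK.add_mem h1 h2) h3 using 1
  ext z
  simp only [Pi.add_apply, Finset.sum_apply, Pi.smul_apply, smul_eq_mul, locPoly, mul_assoc,
    mul_logL_eq, ← emb_apply, mul_add, sum_add_distrib, mul_sum]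
  have e : ∑ i ∈ insert p (range (n + 1)), c * (emb p E (lam i) * (L * singVal E n (i : ℤ_[p]) z)) =
      ∑ i ∈ insert p (range (n + 1)), c * (L * (emb p E (lam i) * singVal E n (i : ℤ_[p]) z)) :=
    sum_congr rfl fun i _ => by ring
  rw [e]
  ring

variable (E) in
theorem norm_harmonic_le_one {m : ℕ} (hm : m < p) : ‖((harmonic m : ℚ) : E)‖ ≤ 1 := by
  have : CharZero E := charZero_of_injective_algebraMap (algebraMap ℚ_[p] E).injective
  rw [harmonic, Rat.cast_sum]
  refine IsUltrametricDist.norm_sum_le_of_forall_le_of_nonneg zero_le_one fun i hi => ?_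
  have hi := mem_range.mp hi
  have h1 := norm_natCast_eq_one_of_lt (p := p) i.succ_ne_zero (by omega)
  rw [Rat.cast_inv, Rat.cast_natCast, norm_inv, ← map_natCast (algebraMap ℚ_[p] E),
    norm_algebraMap', h1, inv_one]

/-- The harmonic numbers have index less than p, hence are p-integral, and a bound C ≥ 1 is
insensitive to them. -/
theorem norm_le_of_norm_shiftedL_le {L : E} (hr : r / 2 + 1 < p) {C : ℝ} (hC : 1 ≤ C)
    (h : ‖shiftedL r L‖ ≤ C) : ‖L‖ ≤ C := by
  have e : L = (shiftedL r L + ((harmonic ((r - 1) / 2) : ℚ) : E)) +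
      ((harmonic (r / 2 + 1) : ℚ) : E) := by
    rw [shiftedL]
    ring
  rw [e]
  refine (IsUltrametricDist.norm_add_le_max _ _).trans (max_le
    ((IsUltrametricDist.norm_add_le_max _ _).trans (max_le h ?_)) ?_)
  · exact (norm_harmonic_le_one (p := p) E (by omega)).trans hC
  · exact (norm_harmonic_le_one (p := p) E hr).trans hC

theorem five_le_prime (hr : 3 ≤ r) (hrp : r < p) : 5 ≤ p := by
  rcases Nat.lt_or_ge 4 p with h | h
  · exact h
  · obtain rfl : p = 4 := by omega
    exact absurd (Fact.out : Nat.Prime 4) (by norm_num)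

end Main

end Breuil

theorem proposition9p6
    (p : ℕ) [Fact p.Prime]
    (E : Type*) [NormedField E] [NormedAlgebra ℚ_[p] E] [FiniteDimensional ℚ_[p] E]
    (sqrtp : E) (hsqrtp : sqrtp ^ 2 = (p : E))
    (π : E) (hπ : Breuil.IsUniformizer π)
    (L : E) (r n : ℕ)
    (hn : ((r : ℝ) + 2) / 2 < n) (hnr : n ≤ r) (hr : r ≤ p - 1)
    (ν : ℝ) (hL : Breuil.shiftedL r L ≠ 0) (hν : ν = Breuil.vp p (Breuil.shiftedL r L))
    (hν_le : ν ≤ 1 + (r : ℝ) / 2 - n)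
    (x : ℚ) (hx : (x : ℝ) + ν = (r : ℝ) / 2 - n)
    (px : E) (hpx : ‖px‖ = (p : ℝ) ^ (-(x : ℝ)))
    (lam : ℕ → ℤ_[p]) (hlam_p : lam p = -1)
    (hlam : ∀ j ≤ n, ∑ i ∈ insert p (Finset.range (n + 1)), lam i * (i : ℤ_[p]) ^ j = 0) :
    ∃ g f : Breuil.DSpace p E r,
      (∀ z : ℚ_[p], g.toFun z =
        px * ∑ i ∈ insert p (Finset.range (n + 1)),
          algebraMap ℚ_[p] E (lam i : ℚ_[p]) * algebraMap ℚ_[p] E (z - (i : ℚ_[p])) ^ n *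
            Breuil.logL p L (z - (i : ℚ_[p]))) ∧
      (∀ z : ℚ_[p], f.toFun z =
        (p : E) * px * (∑ a ∈ Finset.Icc 1 (p - 1),
          (a : E)⁻¹ * algebraMap ℚ_[p] E z ^ n * Breuil.indBall p E (a : ℚ_[p]) z) +
        ∑ j ∈ Finset.Ico ⌈(r : ℝ) / 2⌉₊ n,
          (-1 : E) ^ (n - j + 1) * (n.choose j : E) * (px * (p : E) ^ (n - j)) * L *
            algebraMap ℚ_[p] E z ^ j * Breuil.indBall p E 0 z) ∧
      ∃ θ ∈ Breuil.latticeTheta p sqrtp r L,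
        Breuil.toB L g - Breuil.toB L f = π • θ := by
  open Breuil in
  have : IsUltrametricDist E := IsUltrametricDist.of_normedAlgebra ℚ_[p]
  have : CompleteSpace E := FiniteDimensional.complete ℚ_[p] E
  have hp1 : (1 : ℝ) < p := one_lt_prime
  have hp0 : (0 : ℝ) < p := prime_pos
  have hn' : (r : ℝ) / 2 + 1 < n := by linarith
  have hrn : r + 3 ≤ 2 * n := by
    have : (r : ℝ) + 2 < 2 * n := by linarith
    exact_mod_cast this
  have hrp : r < p := by
    have := (Fact.out : p.Prime).pos
    omega
  have hp5 : 5 ≤ p := five_le_prime (r := r) (by omega) hrp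
  have hr0 : 0 < r := by omega
  -- The upper bound on ν amounts to x ≥ -1.
  have hpx_le : ‖px‖ ≤ p := by
    rw [hpx, ← Real.rpow_one (p : ℝ), ← Real.rpow_mul hp0.le, one_mul]
    exact Real.rpow_le_rpow_of_exponent_le hp1.le (by linarith)
  have hsh : ‖shiftedL r L‖ = (p : ℝ) ^ (-ν) := by
    rw [hν, vp, neg_neg, Real.rpow_logb hp0 hp1.ne' (norm_pos_iff.mpr hL)]
  -- Here -ν ≥ n-1-r/2 > 0, so p^{-ν} ≥ 1 as required.
  have hLn : ‖L‖ ≤ (p : ℝ) ^ (-ν) := norm_le_of_norm_shiftedL_le (p := p) (r := r) (by omega)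
    (Real.one_le_rpow hp1.le (by linarith)) hsh.le
  have hcL : ‖px * L‖ ≤ (p : ℝ) ^ ((n : ℝ) - r / 2) := by
    have e : (n : ℝ) - r / 2 = -(x : ℝ) + -ν := by linarith
    rw [norm_mul, hpx, e, Real.rpow_add hp0]
    gcongr
  obtain ⟨C, hC⟩ := exists_csBound_locPoly (p := p) hr0 n px L
  obtain ⟨f, hf⟩ := exists_toFun_eq (extZero_mem_DSub hr0 hC)
  have hzero := sum_mul_logL_sub_locPoly_mem hp5 hsqrtp hπ hr0 hn' hnr hrp hlam_p hlam hpx_le hcL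
  have hinfty := tsum_inftyCoeff_mem (n := n) (lam := lam) hp5 hsqrtp hπ hr0 hnr L hpx_le
  obtain ⟨g, hg, h⟩ := exists_toB_sub_eq_smul (f := f) (γ := fun z => px *
    ∑ i ∈ insert p (Finset.range (n + 1)), algebraMap ℚ_[p] E (lam i : ℚ_[p]) *
      algebraMap ℚ_[p] E (z - (i : ℚ_[p])) ^ n * logL p L (z - (i : ℚ_[p]))) hπ hzero hinfty
    fun z => by
      rw [hf]
      by_cases hz : ‖z‖ ≤ 1
      · rw [extZero_of_le hz, extZero_of_le hz, extInfty_of_le hz, coe_toInt]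
        ring
      · have hz := not_le.mp hz
        rw [extZero_of_lt hz, extZero_of_lt hz, extInfty_tsum_inftyCoeff hlam r L px hz]
        ring
  exact ⟨g, f, fun z => by rw [hg], fun z => by rw [hf, extZero_locPoly], h⟩

end
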